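/- For $n\ge 0$ let $\mathcal P_n$ be the partition monoid: its elements are the set partitions of $\{1,\dots,n\}\cup\{1',\dots,n'\}$. To form $\alpha\beta$, draw $\alpha$ between an upper row $1,\dots,n$ and a middle row $1'',\dots,n''$, draw $\beta$ between the middle row and a lower row $1',\dots,n'$ (two vertices of a block being joined), and let two vertices of the upper and lower rows be in the same block of $\alpha\beta$ if and only if they lie in the same connected component of the resulting graph. Let $\alpha^*$ be obtained from $\alpha$ by interchanging $i$ and $i'$ for all $i$, and let $\operatorname{rank}(\alpha)$ be the number of blocks of $\alpha$ containing both a dashed and an undashed element. The Brauer monoid $\mathcal B_n$ is the submonoid of $\mathcal P_n$ of all partitions all of whose blocks have size $2$. Let $$P_r=\{\varepsilon\in\mathcal B_n:\ \varepsilon^2=\varepsilon=\varepsilon^*,\ \operatorname{rank}(\varepsilon)=r\}.$$ For a finite semigroup $S$, let $\deg(S)$ (respectively $\deg'(S)$) be the least $m\ge1$ such that there is an injective semigroup homomorphism from $S$ into the monoid $\mathcal T_m$ of all self-maps (respectively the monoid $\mathcal{PT}_m$ of all partial self-maps) of $\{1,\dots,m\}$, maps being composed from left to right. A right congruence on $S$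 is an equivalence relation $\sigma$ such that $(a,b)\in\sigma$ implies $(ac,bc)\in\sigma$ for all $c\in S$; it gives a right action of $S$ on $S/\sigma$ by $[x]a=[xa]$, and a right congruence action is a right action isomorphic to one of this form. Let $\deg_{\mathrm{rc}}(S)$ be the least $m\ge1$ such that $S$ has a faithful right congruence action on a set of size $m$. **Theorem.** Let $n\ge3$. Then $$\deg'(\mathcal B_n)=\begin{cases}|P_1|+3|P_3| & \text{if } n \text{ is odd},\\ |P_0|+2|P_2|+3|P_4| & \text{if } n \text{ is even},\end{cases}\qquad\text{and}\qquad \deg(\mathcal B_n)=1+\deg'(\mathcal B_n).$$ If $n$ is odd, then $\deg(\mathcal B_n)=\deg_{\mathrm{rc}}(\mathcal B_n)$. Moreover, $$\deg'(\mathcal B_n)=\begin{cases}\dfrac{n+1}{2}\cdot n!! & \text{if } n \text{ is odd},\\[2mm] \dfrac{(n+4)(n+2)}{8}\cdot (n-1)!! & \text{if } n \text{ is even},\end{cases}$$ where $m!!=m(m-2)(m-4)\cdots1$ for odd $m\geq 1$. -/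

import Mathlib

open scoped Nat

/-! ## Diagram monoids -/

/-- The elements of the partition monoid `𝓟ₙ`: set partitions (encoded as equivalence relations) of
two rows of `n` vertices.  The vertex `Sum.inl i` is the `i`-th upper vertex, and `Sum.inr i` is the
`i`-th lower (dashed) vertex. -/
@[ext]
structure PartitionMonoid (n : ℕ) where
  toSetoid : Setoid (Fin n ⊕ Fin n)

namespace PartitionMonoid

variable {n : ℕ}

/-- `α.Rel x y` says that `x` and `y` lie in the same block of `α`. -/
def Rel (α : PartitionMonoid n) (x y : Fin n ⊕ Fin n) : Prop := α.toSetoid x y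

/-- The set of blocks of a partition. -/
def blocks (α : PartitionMonoid n) : Set (Set (Fin n ⊕ Fin n)) := α.toSetoid.classes

/-- Place the upper and lower vertices in rows `i` and `j` of a stack of rows of `n` vertices. -/
def rows {L : Type} (i j : L) : Fin n ⊕ Fin n → L × Fin n :=
  Sum.elim (fun x => (i, x)) (fun x => (j, x))

/-- The edges of the product graph of `α` and `β`, on three rows of `n` vertices (upper row `0`,
middle row `1`, lower row `2`): `α` is drawn on rows `0, 1` and `β` on rows `1, 2`, where a partition
is drawn by joining any two vertices of the same block. -/
inductive ProductEdge (α β : PartitionMonoid n) : Fin 3 × Fin n → Fin 3 × Fin n → Prop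
  | upper {x y : Fin n ⊕ Fin n} : α.Rel x y → ProductEdge α β (rows 0 1 x) (rows 0 1 y)
  | lower {x y : Fin n ⊕ Fin n} : β.Rel x y → ProductEdge α β (rows 1 2 x) (rows 1 2 y)

/-- In the product `α * β`, two vertices lie in the same block if and only if the corresponding
vertices (of rows `0` and `2`) lie in the same connected component of the product graph. -/
instance : Mul (PartitionMonoid n) where
  mul α β := ⟨(Relation.EqvGen.setoid (ProductEdge α β)).comap (rows 0 2)⟩

/-- The identity partition, with blocks `{i, i'}`. -/
instance : One (PartitionMonoid n) where
  one := ⟨Setoid.ker (Sum.elim id id)⟩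

/-- The involution `α ↦ α*`, interchanging upper and lower vertices. -/
instance : Star (PartitionMonoid n) where
  star α := ⟨α.toSetoid.comap Sum.swap⟩

/-- The rank: the number of transversals, i.e. of blocks containing both an upper and a lower
vertex. -/
noncomputable def rank (α : PartitionMonoid n) : ℕ :=
  {B ∈ α.blocks | (∃ i, Sum.inl i ∈ B) ∧ (∃ j, Sum.inr j ∈ B)}.ncard

theorem ext_rel {α β : PartitionMonoid n} (h : ∀ x y, α.Rel x y ↔ β.Rel x y) : α = β :=
  PartitionMonoid.ext (Setoid.ext h)

theorem mul_rel {α β : PartitionMonoid n} {x y : Fin n ⊕ Fin n} :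
    (α * β).Rel x y ↔ Relation.EqvGen (ProductEdge α β) (rows 0 2 x) (rows 0 2 y) := Iff.rfl

theorem one_rel {x y : Fin n ⊕ Fin n} :
    (1 : PartitionMonoid n).Rel x y ↔ (Sum.elim id id x : Fin n) = Sum.elim id id y := Iff.rfl

theorem star_rel {α : PartitionMonoid n} {x y : Fin n ⊕ Fin n} :
    (star α).Rel x y ↔ α.Rel x.swap y.swap := Iff.rfl

theorem Rel.refl {α : PartitionMonoid n} (x : Fin n ⊕ Fin n) : α.Rel x x := α.toSetoid.refl' x
theorem Rel.symm {α : PartitionMonoid n} {x y : Fin n ⊕ Fin n} (h : α.Rel x y) : α.Rel y x :=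
  α.toSetoid.symm' h
theorem Rel.trans {α : PartitionMonoid n} {x y z : Fin n ⊕ Fin n} (h : α.Rel x y)
    (h' : α.Rel y z) : α.Rel x z := α.toSetoid.trans' h h'

/-- Transport of generated equivalences. -/
theorem eqvGen_lift {V W : Type*} {r : V → V → Prop} {s : W → W → Prop} (f : V → W)
    (h : ∀ x y, r x y → Relation.EqvGen s (f x) (f y)) {x y : V} (hxy : Relation.EqvGen r x y) :
    Relation.EqvGen s (f x) (f y) := by
  induction hxy with
  | rel x y hh => exact h x y hh
  | refl x => exact .refl _
  | symm x y _ ih => exact ih.symm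
  | trans x y z _ _ ih₁ ih₂ => exact ih₁.trans _ _ _ ih₂

theorem star_star' (α : PartitionMonoid n) : star (star α) = α :=
  ext_rel fun x y => by simp [star_rel]

theorem star_le {α β : PartitionMonoid n} (h : ∀ x y, α.Rel x y → β.Rel x y)
    (x y : Fin n ⊕ Fin n) : (star α).Rel x y → (star β).Rel x y := h _ _

theorem star_mul_aux (α β : PartitionMonoid n) (x y : Fin n ⊕ Fin n)
    (h : (star (α * β)).Rel x y) : (star β * star α).Rel x y := by
  have key := eqvGen_lift (s := ProductEdge (star β) (star α))
    (fun v : Fin 3 × Fin n => ((Fin.rev v.1, v.2) : Fin 3 × Fin n)) (fun u v huv => ?_) h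
  · rcases x with x | x <;> rcases y with y | y <;> exact key
  · cases huv with
    | @upper a b hab =>
      have := ProductEdge.lower (α := star β) (β := star α) (x := a.swap) (y := b.swap)
        (by simpa [star_rel] using hab)
      rcases a with a | a <;> rcases b with b | b <;> exact .rel _ _ this
    | @lower a b hab =>
      have := ProductEdge.upper (α := star β) (β := star α) (x := a.swap) (y := b.swap)
        (by simpa [star_rel] using hab)
      rcases a with a | a <;> rcases b with b | b <;> exact .rel _ _ this

theorem star_mul' (α β : PartitionMonoid n) : star (α * β) = star β * star α := by
  refine ext_rel fun x y => ⟨star_mul_aux α β x y, fun h => ?_⟩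
  have h1 : (star (star (star β * star α))).Rel x y := by rwa [star_star']
  have h2 := star_le (star_mul_aux (star β) (star α)) x y h1
  rwa [star_star', star_star'] at h2

theorem one_mul_aux (α : PartitionMonoid n) : 1 * α = α := by
  refine ext_rel fun x y => ⟨fun h => ?_, fun h => ?_⟩
  · have key := eqvGen_lift (s := α.Rel)
      (fun v : Fin 3 × Fin n => if v.1 = 2 then Sum.inr v.2 else Sum.inl v.2)
      (fun u v huv => ?_) h
    · have h' : α.Rel _ _ := (Equivalence.eqvGen_iff α.toSetoid.iseqv).1 key
      rcases x with x | x <;> rcases y with y | y <;> simpa [rows] using h'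
    · cases huv with
      | @upper a b hab =>
        rw [one_rel] at hab
        rcases a with a | a <;> rcases b with b | b <;> simp at hab <;> subst hab <;>
          simp [rows] <;> exact .refl _
      | @lower a b hab =>
        rcases a with a | a <;> rcases b with b | b <;> simp [rows] <;> exact .rel _ _ hab
  · have e : ∀ z : Fin n ⊕ Fin n, Relation.EqvGen (ProductEdge 1 α) (rows 0 2 z) (rows 1 2 z) := by
      rintro (z | z)
      · exact .rel _ _ (ProductEdge.upper (x := .inl z) (y := .inr z) (by simp [one_rel]))
      · exact .refl _
    exact ((e x).trans _ _ _ (.rel _ _ (.lower h))).trans _ _ _ (e y).symm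

theorem star_one' : star (1 : PartitionMonoid n) = 1 :=
  ext_rel fun x y => by
    rw [star_rel, one_rel, one_rel]
    rcases x with x | x <;> rcases y with y | y <;> simp

theorem mul_one_aux (α : PartitionMonoid n) : α * 1 = α := by
  have := congrArg star (one_mul_aux (star α))
  rwa [star_mul', star_star', star_one'] at this

/-- Contracting a generated equivalence along a map whose range contains the endpoints of all
`C`-steps. -/
theorem eqvGen_bridge {V W : Type*} (f : V → W) (D C : W → W → Prop) (R : V → V → Prop)
    (hD : ∀ u v, Relation.EqvGen D (f u) (f v) → Relation.EqvGen R u v)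
    (hC : ∀ w w', C w w' → ∃ u v, w = f u ∧ w' = f v ∧ Relation.EqvGen R u v) {x y : V}
    (h : Relation.EqvGen (fun w w' => D w w' ∨ C w w') (f x) (f y)) : Relation.EqvGen R x y := by
  have key : ∀ w w', Relation.EqvGen (fun w w' => D w w' ∨ C w w') w w' →
      ∀ v, (∃ u, Relation.EqvGen D w (f u) ∧ Relation.EqvGen R u v) ↔
        (∃ u, Relation.EqvGen D w' (f u) ∧ Relation.EqvGen R u v) := by
    intro w w' h
    induction h with
    | rel w w' h =>
      intro v
      rcases h with h | h
      · exact ⟨fun ⟨u, h1, h2⟩ => ⟨u, (Relation.EqvGen.rel _ _ h).symm.trans _ _ _ h1, h2⟩,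
          fun ⟨u, h1, h2⟩ => ⟨u, (Relation.EqvGen.rel _ _ h).trans _ _ _ h1, h2⟩⟩
      · obtain ⟨a, b, rfl, rfl, hab⟩ := hC _ _ h
        exact ⟨fun ⟨u, h1, h2⟩ => ⟨b, .refl _,
            (hab.symm.trans _ _ _ (hD _ _ h1)).trans _ _ _ h2⟩,
          fun ⟨u, h1, h2⟩ => ⟨a, .refl _, (hab.trans _ _ _ (hD _ _ h1)).trans _ _ _ h2⟩⟩
    | refl => exact fun v => Iff.rfl
    | symm _ _ _ ih => exact fun v => (ih v).symm
    | trans _ _ _ _ _ ih₁ ih₂ => exact fun v => (ih₁ v).trans (ih₂ v)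
  obtain ⟨u, h1, h2⟩ := (key _ _ h y).2 ⟨y, .refl _, .refl _⟩
  exact (hD _ _ h1).trans _ _ _ h2

theorem mul_assoc_aux (α β γ : PartitionMonoid n) (x y : Fin n ⊕ Fin n)
    (h : ((α * β) * γ).Rel x y) : (α * (β * γ)).Rel x y := by
  -- the steps of the four-row product graph
  let C : Fin 4 × Fin n → Fin 4 × Fin n → Prop := fun w w' =>
    ∃ a b, w = rows 0 1 a ∧ w' = rows 0 1 b ∧ α.Rel a b
  let D : Fin 4 × Fin n → Fin 4 × Fin n → Prop := fun w w' =>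
    (∃ a b, w = rows 1 2 a ∧ w' = rows 1 2 b ∧ β.Rel a b) ∨
    (∃ a b, w = rows 2 3 a ∧ w' = rows 2 3 b ∧ γ.Rel a b)
  let i : Fin 3 → Fin 4 := ![0, 1, 3]
  let f : Fin 3 × Fin n → Fin 4 × Fin n := fun v => (i v.1, v.2)
  let k : Fin 3 × Fin n → Fin 4 × Fin n := fun v => (v.1.succ, v.2)
  have hk : Function.Injective k := by
    rintro ⟨a, a'⟩ ⟨b, b'⟩ h
    simpa [k] using h
  have step1 : Relation.EqvGen (fun w w' => D w w' ∨ C w w') (f (rows 0 2 x)) (f (rows 0 2 y)) := by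
    let j : Fin 3 → Fin 4 := ![0, 2, 3]
    have := eqvGen_lift (s := fun w w' => D w w' ∨ C w w')
      (fun v : Fin 3 × Fin n => ((j v.1, v.2) : Fin 4 × Fin n)) (fun u v huv => ?_) h
    · rcases x with x | x <;> rcases y with y | y <;> exact this
    · cases huv with
      | @upper a b hab =>
        have := eqvGen_lift (s := fun w w' => D w w' ∨ C w w')
          (fun v : Fin 3 × Fin n => ((v.1.castSucc, v.2) : Fin 4 × Fin n)) (fun u v huv => ?_) hab
        · rcases a with a | a <;> rcases b with b | b <;> exact this
        · cases huv with
          | @upper c d hcd =>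
            refine .rel _ _ (.inr ⟨c, d, ?_, ?_, hcd⟩)
            · rcases c with c | c <;> rfl
            · rcases d with d | d <;> rfl
          | @lower c d hcd =>
            refine .rel _ _ (.inl (.inl ⟨c, d, ?_, ?_, hcd⟩))
            · rcases c with c | c <;> rfl
            · rcases d with d | d <;> rfl
      | @lower a b hab =>
        refine .rel _ _ (.inl (.inr ⟨a, b, ?_, ?_, hab⟩))
        · rcases a with a | a <;> rfl
        · rcases b with b | b <;> rfl
  have hDk : ∀ w w', Relation.EqvGen D w w' → w = w' ∨
      ∃ a b, w = k a ∧ w' = k b ∧ Relation.EqvGen (ProductEdge β γ) a b := by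
    intro w w' h
    induction h with
    | rel w w' h =>
      right
      rcases h with ⟨a, b, rfl, rfl, hab⟩ | ⟨a, b, rfl, rfl, hab⟩
      · refine ⟨rows 0 1 a, rows 0 1 b, ?_, ?_, .rel _ _ (.upper hab)⟩
        · rcases a with a | a <;> rfl
        · rcases b with b | b <;> rfl
      · refine ⟨rows 1 2 a, rows 1 2 b, ?_, ?_, .rel _ _ (.lower hab)⟩
        · rcases a with a | a <;> rfl
        · rcases b with b | b <;> rfl
    | refl => exact .inl rfl
    | symm w w' _ ih =>
      rcases ih with rfl | ⟨a, b, rfl, rfl, hab⟩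
      · exact .inl rfl
      · exact .inr ⟨b, a, rfl, rfl, hab.symm⟩
    | trans w w' w'' _ _ ih₁ ih₂ =>
      rcases ih₁ with rfl | ⟨a, b, rfl, rfl, hab⟩
      · exact ih₂
      · rcases ih₂ with rfl | ⟨c, d, hc, rfl, hcd⟩
        · exact .inr ⟨a, b, rfl, rfl, hab⟩
        · obtain rfl := hk hc
          exact .inr ⟨a, d, rfl, rfl, hab.trans _ _ _ hcd⟩
  refine eqvGen_bridge f D C (ProductEdge α (β * γ)) ?_ ?_ step1
  · intro u v huv
    have hf : Function.Injective f := by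
      rintro ⟨a, a'⟩ ⟨b, b'⟩ h
      simp only [f, Prod.mk.injEq] at h
      refine Prod.ext ?_ h.2
      have h1 := h.1
      revert h1
      fin_cases a <;> fin_cases b <;> simp [i]
    rcases hDk _ _ huv with h | ⟨a, b, ha, hb, hab⟩
    · rw [hf h]; exact .refl _
    · have conv : ∀ (u a : Fin 3 × Fin n), f u = k a →
          ∃ z, u = rows 1 2 z ∧ a = rows 0 2 z := by
        rintro ⟨u, u'⟩ ⟨a, a'⟩ h
        simp only [f, k, Prod.mk.injEq] at h
        obtain ⟨h, rfl⟩ := h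
        fin_cases u <;> fin_cases a <;> simp [i, Fin.ext_iff] at h
        · exact ⟨.inl u', rfl, rfl⟩
        · exact ⟨.inr u', rfl, rfl⟩
      obtain ⟨z, rfl, rfl⟩ := conv _ _ ha
      obtain ⟨z', rfl, rfl⟩ := conv _ _ hb
      exact .rel _ _ (.lower hab)
  · rintro w w' ⟨a, b, rfl, rfl, hab⟩
    refine ⟨rows 0 1 a, rows 0 1 b, ?_, ?_, .rel _ _ (.upper hab)⟩
    · rcases a with a | a <;> rfl
    · rcases b with b | b <;> rfl

instance : Monoid (PartitionMonoid n) where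
  mul_assoc α β γ := by
    refine ext_rel fun x y => ⟨mul_assoc_aux α β γ x y, fun h => ?_⟩
    have h1 : (star (star (α * (β * γ)))).Rel x y := by rwa [star_star']
    simp only [star_mul' α (β * γ), star_mul' β γ] at h1
    have h2 := star_le (mul_assoc_aux (star γ) (star β) (star α)) x y h1
    simpa only [star_mul', star_star'] using h2
  one_mul := one_mul_aux
  mul_one := mul_one_aux

instance : StarMul (PartitionMonoid n) where
  star_involutive := star_star'
  star_mul := star_mul'

/-! ### Closure of the set of Brauer partitions under products -/

/-- If `a, b` are involutions of a finite set with no common fixed point, then every orbit of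
`⟨a, b⟩` with an element fixed by `a` or `b` contains exactly one further such element. -/
theorem exists_unique_end {V : Type*} [Finite V] (a b : Equiv.Perm V) (ha : ∀ v, a (a v) = v)
    (hb : ∀ v, b (b v) = v) (hab : ∀ v, ¬ (a v = v ∧ b v = v)) (x : V) (hx : b x = x) :
    ∃! y, y ≠ x ∧ (a y = y ∨ b y = y) ∧
      Relation.EqvGen (fun u v => v = a u ∨ v = b u) x y := by
  set c : Equiv.Perm V := a * b with hc
  have haa : a⁻¹ = a := by ext v; rw [Equiv.Perm.inv_eq_iff_eq]; exact (ha v).symm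
  have hbb : b⁻¹ = b := by ext v; rw [Equiv.Perm.inv_eq_iff_eq]; exact (hb v).symm
  have hbc : ∀ k : ℤ, b ((c ^ k) x) = (c ^ (-k)) x := by
    intro k
    have h1 : b * c * b⁻¹ = c⁻¹ := by
      rw [hc, mul_inv_rev, haa, hbb]
      ext v; simp [hb]
    have h2 : b * c ^ k * b⁻¹ = c ^ (-k) := by
      rw [← conj_zpow, h1, zpow_neg, inv_zpow]
    rw [← h2, hbb]
    simp [hx]
  have hac : ∀ k : ℤ, a ((c ^ k) x) = (c ^ (1 - k)) x := by
    intro k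
    have h1 : a = c * b := by ext v; simp [hc, hb]
    rw [sub_eq_add_neg, zpow_add, zpow_one, Equiv.Perm.mul_apply, ← hbc, h1]
    rfl
  set m := Function.minimalPeriod (c • ·) x with hm
  have hper : ∀ k : ℤ, (c ^ k) x = x ↔ (m : ℤ) ∣ k := fun k => by
    rw [hm, ← MulAction.zpow_smul_eq_iff_minimalPeriod_dvd, Equiv.Perm.smul_def]
  have hper2 : ∀ k l : ℤ, (c ^ k) x = (c ^ l) x ↔ (m : ℤ) ∣ k - l := by
    intro k l
    rw [← hper, sub_eq_neg_add, zpow_add, Equiv.Perm.mul_apply, zpow_neg, Equiv.Perm.inv_eq_iff_eq]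
  have horb : ∀ y, Relation.EqvGen (fun u v => v = a u ∨ v = b u) x y ↔ ∃ k : ℤ, y = (c ^ k) x := by
    have aux : ∀ u v, Relation.EqvGen (fun u v => v = a u ∨ v = b u) u v →
        ((∃ k : ℤ, u = (c ^ k) x) ↔ ∃ k : ℤ, v = (c ^ k) x) := by
      intro u v h
      induction h with
      | rel u v h =>
        rcases h with rfl | rfl
        · refine ⟨fun ⟨k, hk⟩ => ⟨1 - k, by rw [hk, hac]⟩, fun ⟨k, hk⟩ => ⟨1 - k, ?_⟩⟩
          rw [← hac, ← hk, ha]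
        · refine ⟨fun ⟨k, hk⟩ => ⟨-k, by rw [hk, hbc]⟩, fun ⟨k, hk⟩ => ⟨-k, ?_⟩⟩
          rw [← hbc, ← hk, hb]
      | refl => exact Iff.rfl
      | symm _ _ _ ih => exact ih.symm
      | trans _ _ _ _ _ h1 h2 => exact h1.trans h2
    intro y
    refine ⟨fun h => (aux _ _ h).1 ⟨0, by simp⟩, ?_⟩
    rintro ⟨k, rfl⟩
    have hstep : ∀ v, Relation.EqvGen (fun u v => v = a u ∨ v = b u) v (c v) := fun v =>
      (Relation.EqvGen.rel v (b v) (.inr rfl)).trans _ _ _ (.rel _ _ (.inl rfl))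
    induction k with
    | zero => exact .refl _
    | succ k ih =>
      have := hstep ((c ^ (k : ℤ)) x)
      rw [← Equiv.Perm.mul_apply, ← zpow_one_add, add_comm] at this
      exact ih.trans _ _ _ this
    | pred k ih =>
      have := hstep ((c ^ (-(k : ℤ) - 1)) x)
      rw [← Equiv.Perm.mul_apply, ← zpow_one_add, add_sub_cancel] at this
      exact ih.trans _ _ _ this.symm
  have hmpos : 0 < m := by
    have h1 : Function.Injective (fun v : V => c • v) := MulAction.injective c
    exact Function.minimalPeriod_pos_of_mem_periodicPts (h1.mem_periodicPts x)
  have hax : a x ≠ x := fun h => hab x ⟨h, hx⟩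
  have hm1 : ¬ (m : ℤ) ∣ 1 := by
    intro h
    have h1 := (hper 1).2 h
    rw [zpow_one, hc, Equiv.Perm.mul_apply, hx] at h1
    exact hax h1
  have hfixa : ∀ k : ℤ, a ((c ^ k) x) = (c ^ k) x ↔ (m : ℤ) ∣ 1 - k - k := fun k => by
    rw [hac, hper2]
  have hfixb : ∀ k : ℤ, b ((c ^ k) x) = (c ^ k) x ↔ (m : ℤ) ∣ -k - k := fun k => by
    rw [hbc, hper2]
  rcases Nat.even_or_odd' m with ⟨t, ht | ht⟩
  · refine ⟨(c ^ (t : ℤ)) x, ⟨?_, .inr ?_, (horb _).2 ⟨_, rfl⟩⟩, ?_⟩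
    · rw [Ne, hper]
      intro h
      have := Int.le_of_dvd (by omega) h
      omega
    · rw [hfixb]; exact ⟨-1, by rw [ht]; push_cast; ring⟩
    · rintro y ⟨hy1, hy2, hy3⟩
      obtain ⟨k, rfl⟩ := (horb _).1 hy3
      rw [Ne, hper] at hy1
      rw [hfixa, hfixb] at hy2
      rw [hper2]
      rcases hy2 with ⟨j, hj⟩ | ⟨j, hj⟩
      · rw [ht] at hj; push_cast at hj
        exfalso
        have : (2 : ℤ) ∣ 1 := ⟨(t : ℤ) * j + k, by linear_combination hj⟩
        omega
      · rw [ht] at hj; push_cast at hj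
        have hk : k = -(t : ℤ) * j := by linarith
        rcases Int.even_or_odd' j with ⟨s, hs | hs⟩
        · exact absurd ⟨-s, by rw [ht, hk, hs]; push_cast; ring⟩ hy1
        · exact ⟨-s - 1, by rw [ht, hk, hs]; push_cast; ring⟩
  · refine ⟨(c ^ ((t : ℤ) + 1)) x, ⟨?_, .inl ?_, (horb _).2 ⟨_, rfl⟩⟩, ?_⟩
    · rw [Ne, hper]
      intro h
      have := Int.le_of_dvd (by omega) h
      have h0 : t = 0 := by omega
      exact hm1 (by rw [ht, h0]; simp)
    · rw [hfixa]; exact ⟨-1, by rw [ht]; push_cast; ring⟩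
    · rintro y ⟨hy1, hy2, hy3⟩
      obtain ⟨k, rfl⟩ := (horb _).1 hy3
      rw [Ne, hper] at hy1
      rw [hfixa, hfixb] at hy2
      rw [hper2]
      have hcop : IsCoprime (m : ℤ) 2 := ⟨1, -t, by rw [ht]; push_cast; ring⟩
      rcases hy2 with ⟨j, hj⟩ | ⟨j, hj⟩
      · refine hcop.dvd_of_dvd_mul_right ⟨-j - 1, ?_⟩
        have h2 : (m : ℤ) = 2 * t + 1 := by rw [ht]; push_cast; ring
        linear_combination -hj + h2
      · exact absurd (hcop.dvd_of_dvd_mul_right ⟨-j, by linear_combination -hj⟩) hy1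

theorem forall_blocks_iff {α : PartitionMonoid n} :
    (∀ B ∈ α.blocks, B.ncard = 2) ↔ ∀ x, ∃! y, y ≠ x ∧ α.Rel x y := by
  have h1 : (∀ B ∈ α.blocks, B.ncard = 2) ↔ ∀ x, {y | α.Rel y x}.ncard = 2 :=
    ⟨fun h x => h _ ⟨x, rfl⟩, by rintro h _ ⟨x, rfl⟩; exact h x⟩
  rw [h1]
  refine forall_congr' fun x => ?_
  rw [Set.ncard_eq_two]
  constructor
  · rintro ⟨u, v, huv, hs⟩
    have hy : ∀ y, α.Rel y x ↔ y = u ∨ y = v := fun y => by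
      simpa using Set.ext_iff.1 hs y
    rcases (hy x).1 (.refl x) with rfl | rfl
    · exact ⟨v, ⟨huv.symm, ((hy v).2 (.inr rfl)).symm⟩, fun y ⟨h1, h2⟩ =>
        ((hy y).1 h2.symm).resolve_left h1⟩
    · exact ⟨u, ⟨huv, ((hy u).2 (.inl rfl)).symm⟩, fun y ⟨h1, h2⟩ =>
        ((hy y).1 h2.symm).resolve_right h1⟩
  · rintro ⟨y, ⟨h1, h2⟩, h3⟩
    refine ⟨x, y, h1.symm, Set.ext fun z => ⟨fun hz => ?_, ?_⟩⟩
    · by_cases hzx : z = x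
      · exact .inl hzx
      · exact .inr (h3 z ⟨hzx, Rel.symm hz⟩)
    · rintro (rfl | rfl)
      · exact .refl _
      · exact h2.symm

/-- Draw an involution of two rows of vertices on two rows of a stack of rows. -/
theorem exists_perm {L : Type} [DecidableEq L] {i j : L} (hij : i ≠ j) {α : PartitionMonoid n}
    (h : ∀ x, ∃! y, y ≠ x ∧ α.Rel x y) :
    ∃ a : Equiv.Perm (L × Fin n), (∀ v, a (a v) = v) ∧ (∀ v, a v = v ↔ v.1 ≠ i ∧ v.1 ≠ j) ∧
      ∀ x y, α.Rel x y ↔ rows i j y = rows i j x ∨ rows i j y = a (rows i j x) := by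
  choose g hg hg' using h
  have hgg : ∀ x, g (g x) = x := fun x =>
    (hg' (g x) x ⟨(hg x).1.symm, (hg x).2.symm⟩).symm
  have hinj : Function.Injective (rows (n := n) i j) := by
    rintro (x | x) (y | y) h <;> simp [rows, hij, hij.symm] at h <;> simp [h]
  let F : L × Fin n → L × Fin n := fun v =>
    if v.1 = i then rows i j (g (.inl v.2)) else if v.1 = j then rows i j (g (.inr v.2)) else v
  have hF : ∀ x, F (rows i j x) = rows i j (g x) := by
    rintro (x | x) <;> simp [F, rows, hij.symm]
  have hrow : ∀ v : L × Fin n, (∃ x, v = rows i j x) ∨ (v.1 ≠ i ∧ v.1 ≠ j) := by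
    rintro ⟨l, v⟩
    by_cases h1 : l = i
    · exact .inl ⟨.inl v, by simp [rows, h1]⟩
    · by_cases h2 : l = j
      · exact .inl ⟨.inr v, by simp [rows, h2]⟩
      · exact .inr ⟨h1, h2⟩
  have hFo : ∀ v : L × Fin n, v.1 ≠ i ∧ v.1 ≠ j → F v = v := by
    rintro v ⟨h1, h2⟩
    simp [F, h1, h2]
  have hFF : Function.Involutive F := by
    intro v
    rcases hrow v with ⟨x, rfl⟩ | h
    · rw [hF, hF, hgg]
    · rw [hFo v h, hFo v h]
  refine ⟨hFF.toPerm F, hFF, fun v => ⟨fun hv => ?_, hFo v⟩, fun x y => ?_⟩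
  · rcases hrow v with ⟨x, rfl⟩ | h
    · change F _ = _ at hv
      rw [hF] at hv
      exact absurd (hinj hv) (hg x).1
    · exact h
  · change _ ↔ _ ∨ _ = F _
    rw [hF, hinj.eq_iff, hinj.eq_iff]
    constructor
    · intro h
      by_cases hyx : y = x
      · exact .inl hyx
      · exact .inr (hg' x y ⟨hyx, h⟩)
    · rintro (rfl | rfl)
      · exact .refl _
      · exact (hg x).2

theorem mul_blocks {α β : PartitionMonoid n} (hα : ∀ B ∈ α.blocks, B.ncard = 2)
    (hβ : ∀ B ∈ β.blocks, B.ncard = 2) : ∀ B ∈ (α * β).blocks, B.ncard = 2 := by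
  rw [forall_blocks_iff] at *
  obtain ⟨a, ha, ha', haα⟩ := exists_perm (L := Fin 3) (i := 0) (j := 1) (by decide) hα
  obtain ⟨b, hb, hb', hbβ⟩ := exists_perm (L := Fin 3) (i := 1) (j := 2) (by decide) hβ
  have hrow01 : ∀ v : Fin 3 × Fin n, v.1 ≠ 2 → ∃ x, v = rows 0 1 x := by
    rintro ⟨l, v⟩ h
    fin_cases l <;> simp at h
    · exact ⟨.inl v, rfl⟩
    · exact ⟨.inr v, rfl⟩
  have hrow12 : ∀ v : Fin 3 × Fin n, v.1 ≠ 0 → ∃ x, v = rows 1 2 x := by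
    rintro ⟨l, v⟩ h
    fin_cases l <;> simp at h
    · exact ⟨.inl v, rfl⟩
    · exact ⟨.inr v, rfl⟩
  have hrow02 : ∀ v : Fin 3 × Fin n, v.1 ≠ 1 → ∃ x, v = rows 0 2 x := by
    rintro ⟨l, v⟩ h
    fin_cases l <;> simp at h
    · exact ⟨.inl v, rfl⟩
    · exact ⟨.inr v, rfl⟩
  have ha2 : ∀ v, a v = v ↔ v.1 = 2 := by
    intro v; rw [ha']; rcases v with ⟨l, v⟩; fin_cases l <;> simp
  have hb2 : ∀ v, b v = v ↔ v.1 = 0 := by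
    intro v; rw [hb']; rcases v with ⟨l, v⟩; fin_cases l <;> simp
  have hgen : ∀ u v, Relation.EqvGen (ProductEdge α β) u v ↔
      Relation.EqvGen (fun u v => v = a u ∨ v = b u) u v := by
    intro u v
    constructor
    · refine eqvGen_lift id fun u v h => ?_
      cases h with
      | upper h =>
        rcases (haα _ _).1 h with h | h
        · simp only [id, h]; exact .refl _
        · exact .rel _ _ (.inl h)
      | lower h =>
        rcases (hbβ _ _).1 h with h | h
        · simp only [id, h]; exact .refl _
        · exact .rel _ _ (.inr h)
    · refine eqvGen_lift id fun u v h => ?_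
      rcases h with h | h
      · by_cases hu : u.1 = 2
        · rw [(ha2 u).2 hu] at h; subst h; exact .refl _
        · have hv : v.1 ≠ 2 := by
            rw [Ne, ← ha2, h, ha]
            intro h'; exact hu ((ha2 u).1 h'.symm)
          obtain ⟨x, rfl⟩ := hrow01 u hu
          obtain ⟨y, rfl⟩ := hrow01 v hv
          exact .rel _ _ (.upper ((haα _ _).2 (.inr h)))
      · by_cases hu : u.1 = 0
        · rw [(hb2 u).2 hu] at h; subst h; exact .refl _
        · have hv : v.1 ≠ 0 := by
            rw [Ne, ← hb2, h, hb]
            intro h'; exact hu ((hb2 u).1 h'.symm)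
          obtain ⟨x, rfl⟩ := hrow12 u hu
          obtain ⟨y, rfl⟩ := hrow12 v hv
          exact .rel _ _ (.lower ((hbβ _ _).2 (.inr h)))
  have hinj : Function.Injective (rows (n := n) (0 : Fin 3) 2) := by
    rintro (x | x) (y | y) h <;> simp [rows] at h <;> simp [h]
  have hne : ∀ v, ¬ (a v = v ∧ b v = v) := by
    rintro v ⟨h1, h2⟩
    rw [ha2] at h1; rw [hb2] at h2
    exact absurd (h1.symm.trans h2) (by decide)
  intro x
  have main : ∃! y, y ≠ rows 0 2 x ∧ (a y = y ∨ b y = y) ∧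
      Relation.EqvGen (fun u v => v = a u ∨ v = b u) (rows 0 2 x) y := by
    rcases x with x | x
    · exact exists_unique_end a b ha hb hne _ ((hb2 _).2 rfl)
    · have := exists_unique_end b a hb ha (fun v h => hne v h.symm) (rows 0 2 (.inr x))
        ((ha2 _).2 rfl)
      simpa only [or_comm] using this
  obtain ⟨y, ⟨h1, h2, h3⟩, h4⟩ := main
  obtain ⟨z, rfl⟩ := hrow02 y (by
    rw [ha2, hb2] at h2
    rcases h2 with h2 | h2 <;> rw [h2] <;> decide)
  refine ⟨z, ⟨fun h => h1 (by rw [h]), (hgen _ _).2 h3⟩, fun w ⟨hw1, hw2⟩ => hinj (h4 _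
    ⟨fun h => hw1 (hinj h), ?_, (hgen _ _).1 hw2⟩)⟩
  rw [ha2, hb2]
  rcases w with w | w
  · exact .inr rfl
  · exact .inl rfl

theorem one_blocks : ∀ B ∈ (1 : PartitionMonoid n).blocks, B.ncard = 2 := by
  rw [forall_blocks_iff]
  rintro (x | x)
  · refine ⟨.inr x, ⟨by simp, by simp [one_rel]⟩, ?_⟩
    rintro (y | y) ⟨h1, h2⟩ <;> simp_all [one_rel]
  · refine ⟨.inl x, ⟨by simp, by simp [one_rel]⟩, ?_⟩
    rintro (y | y) ⟨h1, h2⟩ <;> simp_all [one_rel]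

end PartitionMonoid

/-- The Brauer monoid `𝓑ₙ`: the submonoid of `𝓟ₙ` of all partitions whose blocks have size `2`. -/
def brauerMonoid (n : ℕ) : Submonoid (PartitionMonoid n) where
  carrier := {α | ∀ B ∈ α.blocks, B.ncard = 2}
  mul_mem' := PartitionMonoid.mul_blocks
  one_mem' := PartitionMonoid.one_blocks

/-- The set `P_r` of projections of rank `r` of `𝓑ₙ`, i.e. of elements `ε` of rank `r` with
`ε² = ε = ε*`. -/
def brauerProjections (n r : ℕ) : Set (PartitionMonoid n) :=
  {ε | ε ∈ brauerMonoid n ∧ ε * ε = ε ∧ star ε = ε ∧ ε.rank = r}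

/-! ## Transformation degrees -/

/-- Self-maps of `X`. -/
def FullTransformation (X : Type*) : Type _ := X → X

/-- The full transformation monoid `𝓣_X`; maps are composed from left to right. -/
instance (X : Type*) : Monoid (FullTransformation X) where
  mul f g := fun x => g (f x)
  one := fun x => x
  mul_assoc _ _ _ := rfl
  one_mul _ := rfl
  mul_one _ := rfl

/-- Partial self-maps of `X`; `f x = none` means that `f` is not defined at `x`. -/
def PartialTransformation (X : Type*) : Type _ := X → Option X

/-- The partial transformation monoid `𝓟𝓣_X`; maps are composed from left to right. -/
instance (X : Type*) : Monoid (PartialTransformation X) where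
  mul f g := fun x => (f x).bind g
  one := fun x => some x
  mul_assoc f g h := funext fun x => Option.bind_assoc (f x) g h
  one_mul _ := rfl
  mul_one f := funext fun x => Option.bind_fun_some (f x)

/-- The minimum transformation degree `deg(S)`: the least `m ≥ 1` such that the semigroup `S` embeds
in `𝓣_m`. -/
noncomputable def transformationDegree (S : Type*) [Semigroup S] : ℕ :=
  sInf {m : ℕ | 1 ≤ m ∧ ∃ f : S →ₙ* FullTransformation (Fin m), Function.Injective f}

/-- The minimum partial transformation degree `deg'(S)`: the least `m ≥ 1` such that the semigroup
`S` embeds in `𝓟𝓣_m`. -/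
noncomputable def partialTransformationDegree (S : Type*) [Semigroup S] : ℕ :=
  sInf {m : ℕ | 1 ≤ m ∧ ∃ f : S →ₙ* PartialTransformation (Fin m), Function.Injective f}

/-- A right (semigroup) action of `S` on `X`. -/
structure RightAction (X S : Type*) [Semigroup S] where
  act : X → S → X
  act_act : ∀ x a b, act (act x a) b = act x (a * b)

/-- An action is faithful if distinct elements of `S` act differently. -/
def RightAction.IsFaithful {X S : Type*} [Semigroup S] (μ : RightAction X S) : Prop :=
  ∀ a b, (∀ x, μ.act x a = μ.act x b) → a = b

/-- Isomorphism of actions. -/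
def RightAction.IsIsomorphic {X Y S : Type*} [Semigroup S] (μ : RightAction X S)
    (ν : RightAction Y S) : Prop :=
  ∃ ξ : X ≃ Y, ∀ x a, ξ (μ.act x a) = ν.act (ξ x) a

/-- A right congruence: an equivalence that is compatible with right multiplication. -/
structure RightCongruence (S : Type*) [Semigroup S] extends Setoid S where
  mul_right : ∀ {a b : S} (c : S), toSetoid a b → toSetoid (a * c) (b * c)

/-- The action `[x] a = [x a]` of `S` on the classes of a right congruence. -/
def RightCongruence.action {S : Type*} [Semigroup S] (σ : RightCongruence S) :
    RightAction (Quotient σ.toSetoid) S where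
  act q a := Quotient.map (fun x => x * a) (fun _ _ h => σ.mul_right a h) q
  act_act q a b := by
    induction q using Quotient.inductionOn with
    | h x => simp [Quotient.map_mk, mul_assoc]

/-- Actions isomorphic to the action on the classes of some right congruence. -/
def RightAction.IsRightCongruenceAction {X S : Type*} [Semigroup S] (μ : RightAction X S) : Prop :=
  ∃ σ : RightCongruence S, μ.IsIsomorphic σ.action

/-- The minimum right congruence degree `deg_rc(S)`: the least `m ≥ 1` such that `S` has a faithful
right congruence action of degree `m`. -/
noncomputable def rightCongruenceDegree (S : Type*) [Semigroup S] : ℕ :=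
  sInf {m : ℕ | 1 ≤ m ∧
    ∃ μ : RightAction (Fin m) S, μ.IsFaithful ∧ μ.IsRightCongruenceAction}

/-!
The proof compares lower bounds for arbitrary faithful actions of the Brauer monoid with explicit
representations that attain them. Blocks have size two, so an element is a perfect matching of the
two rows, made up of upper hooks, lower hooks and transversals. A projection is determined by its
upper hooks, hence by an involution of the upper row (`hookPerm`), and all projections of a given
rank are conjugate under permutations (`exists_conj`). The main tool for products is the rigidity
`mul_mul_eq`: if the ranks of `α` and `β` add up to at most two, then `α * γ * β = α * β` for all
`γ`. The minimal ideal consists of the elements of rank `n % 2`, so every rank below the critical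
rank `4 - n % 2` is rigid against it.

**Lower bounds.** A point of a right action *collapses* if elements of the minimal ideal with the
same lower hooks act on it in the same way. In a faithful action some point does not collapse
(`not_forall_collapses`). If a point fixed by a projection of rank above the critical one does not
collapse, then neither does some point fixed by a projection of smaller rank
(`collapses_of_critical`), so that there is such a point `z` at the critical rank. If a cyclic
permutation of three transversals of its projection fixed `z`, then `z` would collapse
(`Frame.collapses`), so `z` has an orbit of size three under this permutation. As two distinct projections of the same rank at least two are
separated by the ranks of their right multiples (`exists_rank_lt`), the three points yield three for
each projection of critical rank, none of which come from smaller ranks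
(`ncard_below_critical_add_le`). For even `n`, the two elements of a group `H`-class of rank two
likewise yield two points for each projection of rank two (`ncard_below_two_add_le`). Finally, the
points that come from the minimal ideal contain a copy of the set of minimal projections, and at
least one more point because otherwise all points would collapse
(`ncard_projections_lt_ncard_below`). Let `N` be the sum of these numbers without the additional
point. Then a faithful action has at least `N + 1` points; a faithful partial action has at least
`N`, because it becomes total when a sink is added.

**Representations.** A `Labelling` assigns labels to some elements of a monoid in such a way that
right multiplication acts on labels by partial maps. Given a *frame*, i.e. a projection `p` of
critical rank with three of its transversals, let `κ` be a minimal projection that joins the first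
two of them. `Frame.label` labels those `α` for which `p * α` is compatible with `κ`; the label
consists of `κ * α` and, if `p * α` has the rank of `p`, of the lower hooks of `p * α`. There is one
label for each minimal projection, and by rigidity there are at most three for each projection of
critical rank (`Frame.ncard_label_le`). This distinguishes upper hooks with a common end
(`up_of_hooked`), and for odd `n` also upper hooks from transversals (`not_tr_of_odd`), so that it
is faithful. The total action that arises when the unlabelled elements are collected in a sink is then
a right congruence action with `N + 1` points. For even `n`, the Schützenberger representation of
rank two (`rankLabel`) has to be added in order to tell upper hooks from transversals.

The closed formulas result from counting involutions with a given number of fixed points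
(`ncard_projections_mul`).
-/

set_option autoImplicit false

/-! ### Vertices and their partners -/

/-- The Brauer monoid as a type. -/
abbrev Brauer (n : ℕ) : Type := brauerMonoid n

namespace Brauer

variable {n : ℕ}

/-- The upper vertices `i` and `j` lie in the same block. -/
abbrev Up (α : Brauer n) (i j : Fin n) : Prop := α.1.Rel (.inl i) (.inl j)

/-- The upper vertex `i` and the lower vertex `j` lie in the same block. -/
abbrev Tr (α : Brauer n) (i j : Fin n) : Prop := α.1.Rel (.inl i) (.inr j)

/-- The lower vertices `i` and `j` lie in the same block. -/
abbrev Lo (α : Brauer n) (i j : Fin n) : Prop := α.1.Rel (.inr i) (.inr j)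

theorem exists_partner (α : Brauer n) (x : Fin n ⊕ Fin n) : ∃ y, y ≠ x ∧ α.1.Rel x y :=
  (PartitionMonoid.forall_blocks_iff.1 α.2 x).exists

theorem partner_unique {α : Brauer n} {x y z : Fin n ⊕ Fin n} (hy : α.1.Rel x y)
    (hz : α.1.Rel x z) (hy' : y ≠ x) (hz' : z ≠ x) : y = z :=
  (PartitionMonoid.forall_blocks_iff.1 α.2 x).unique ⟨hy', hy⟩ ⟨hz', hz⟩

/-- Two perfect matchings agree if every vertex has a common partner. -/
theorem ext_partner {α β : Brauer n} (h : ∀ x, ∃ y, y ≠ x ∧ α.1.Rel x y ∧ β.1.Rel x y) :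
    α = β := by
  refine Subtype.ext (PartitionMonoid.ext_rel fun x y => ?_)
  obtain ⟨z, hz, hα, hβ⟩ := h x
  rcases eq_or_ne y x with rfl | hy
  · exact ⟨fun _ => .refl _, fun _ => .refl _⟩
  · exact ⟨fun h => partner_unique h hα hy hz ▸ hβ, fun h => partner_unique h hβ hy hz ▸ hα⟩

theorem ext_le {α β : Brauer n} (h : ∀ x y, α.1.Rel x y → β.1.Rel x y) : α = β :=
  ext_partner fun x => by
    obtain ⟨y, hy, hxy⟩ := exists_partner α x
    exact ⟨y, hy, hxy, h _ _ hxy⟩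

theorem Up.unique {α : Brauer n} {i j k : Fin n} (h : Up α i j) (h' : Up α i k) (hj : j ≠ i)
    (hk : k ≠ i) : j = k :=
  Sum.inl_injective (partner_unique h h' (by simpa using hj) (by simpa using hk))

theorem Lo.unique {α : Brauer n} {i j k : Fin n} (h : Lo α i j) (h' : Lo α i k) (hj : j ≠ i)
    (hk : k ≠ i) : j = k :=
  Sum.inr_injective (partner_unique h h' (by simpa using hj) (by simpa using hk))

theorem Tr.unique {α : Brauer n} {i j k : Fin n} (h : Tr α i j) (h' : Tr α i k) : j = k :=
  Sum.inr_injective (partner_unique h h' (by simp) (by simp))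

theorem Tr.unique_left {α : Brauer n} {i j k : Fin n} (h : Tr α i k) (h' : Tr α j k) : i = j :=
  Sum.inl_injective (partner_unique h.symm h'.symm (by simp) (by simp))

theorem Tr.not_up {α : Brauer n} {i j k : Fin n} (h : Tr α i k) (h' : Up α i j) : j = i := by
  by_contra hj
  simpa using partner_unique h h' (by simp) (by simpa using hj)

theorem Tr.not_lo {α : Brauer n} {i j k : Fin n} (h : Tr α i k) (h' : Lo α k j) : j = k := by
  by_contra hj
  simpa using partner_unique h.symm h' (by simp) (by simpa using hj)

theorem up_or_tr (α : Brauer n) (i : Fin n) : (∃ j, j ≠ i ∧ Up α i j) ∨ ∃ k, Tr α i k := by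
  obtain ⟨y | y, hy, h⟩ := exists_partner α (.inl i)
  · exact .inl ⟨y, by simpa using hy, h⟩
  · exact .inr ⟨y, h⟩

theorem lo_or_tr (α : Brauer n) (i : Fin n) : (∃ j, j ≠ i ∧ Lo α i j) ∨ ∃ k, Tr α k i := by
  obtain ⟨y | y, hy, h⟩ := exists_partner α (.inr i)
  · exact .inr ⟨y, h.symm⟩
  · exact .inl ⟨y, by simpa using hy, h⟩

instance : Finite (Brauer n) := by
  have : Finite (PartitionMonoid n) :=
    Finite.of_injective (β := Fin n ⊕ Fin n → Fin n ⊕ Fin n → Prop) (fun α => α.Rel)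
      fun α β h => PartitionMonoid.ext_rel fun x y => by rw [show α.Rel = β.Rel from h]
  exact Subtype.finite

/-! ### The involution -/

theorem star_mem {α : PartitionMonoid n} (h : α ∈ brauerMonoid n) : star α ∈ brauerMonoid n := by
  change ∀ B ∈ (star α).blocks, B.ncard = 2
  rw [PartitionMonoid.forall_blocks_iff]
  intro x
  obtain ⟨y, ⟨h1, h2⟩, h3⟩ := PartitionMonoid.forall_blocks_iff.1 h x.swap
  refine ⟨y.swap, ⟨fun e => h1 (by simp [← e]), ?_⟩, fun z ⟨hz, hz'⟩ => ?_⟩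
  · simpa [PartitionMonoid.star_rel] using h2
  · rw [← h3 z.swap ⟨fun e => hz (Sum.swap_leftInverse.injective e), hz'⟩, Sum.swap_swap]

instance : StarMul (Brauer n) where
  star α := ⟨star α.1, star_mem α.2⟩
  star_involutive α := Subtype.ext (star_star α.1)
  star_mul α β := Subtype.ext (star_mul α.1 β.1)

theorem star_rel {α : Brauer n} {x y : Fin n ⊕ Fin n} :
    (star α).1.Rel x y ↔ α.1.Rel x.swap y.swap := Iff.rfl

theorem tr_star {α : Brauer n} {i j : Fin n} : Tr (star α) i j ↔ Tr α j i :=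
  ⟨fun h => PartitionMonoid.Rel.symm h, fun h => PartitionMonoid.Rel.symm h⟩

/-! ### Paths in the product graph -/

section Paths

variable {α β : Brauer n} {a b c d e f : Fin n}

theorem rel_upper {x y : Fin n ⊕ Fin n} (h : α.1.Rel x y) :
    Relation.EqvGen (PartitionMonoid.ProductEdge α.1 β.1) (PartitionMonoid.rows 0 1 x)
      (PartitionMonoid.rows 0 1 y) := .rel _ _ (.upper h)

theorem rel_lower {x y : Fin n ⊕ Fin n} (h : β.1.Rel x y) :
    Relation.EqvGen (PartitionMonoid.ProductEdge α.1 β.1) (PartitionMonoid.rows 1 2 x)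
      (PartitionMonoid.rows 1 2 y) := .rel _ _ (.lower h)

theorem Up.mul (h : Up α a b) : Up (α * β) a b := rel_upper (β := β) h

theorem Lo.mul (h : Lo β a b) : Lo (α * β) a b := rel_lower (α := α) h

theorem tr_mul (h₁ : Tr α a b) (h₂ : Tr β b c) : Tr (α * β) a c :=
  (rel_upper (β := β) h₁).trans _ _ _ (rel_lower (α := α) h₂)

theorem up_mul (h₁ : Tr α a b) (h₂ : Up β b c) (h₃ : Tr α d c) : Up (α * β) a d :=
  ((rel_upper (β := β) h₁).trans _ _ _ (rel_lower (α := α) h₂)).trans _ _ _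
    (rel_upper (β := β) h₃.symm)

theorem lo_mul (h₁ : Tr β b a) (h₂ : Lo α b c) (h₃ : Tr β c d) : Lo (α * β) a d :=
  ((rel_lower (α := α) h₁.symm).trans _ _ _ (rel_upper (β := β) h₂)).trans _ _ _
    (rel_lower (α := α) h₃)

theorem tr_mul_zigzag (h₁ : Tr α a b) (h₂ : Up β b c) (h₃ : Lo α c d) (h₄ : Tr β d e) :
    Tr (α * β) a e :=
  (((rel_upper (β := β) h₁).trans _ _ _ (rel_lower (α := α) h₂)).trans _ _ _
    (rel_upper (β := β) h₃)).trans _ _ _ (rel_lower (α := α) h₄)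

theorem up_mul_zigzag (h₁ : Tr α a b) (h₂ : Up β b c) (h₃ : Lo α c d) (h₄ : Up β d e)
    (h₅ : Tr α f e) : Up (α * β) a f :=
  ((((rel_upper (β := β) h₁).trans _ _ _ (rel_lower (α := α) h₂)).trans _ _ _
    (rel_upper (β := β) h₃)).trans _ _ _ (rel_lower (α := α) h₄)).trans _ _ _
    (rel_upper (β := β) h₅.symm)

end Paths

theorem mul_star_mul (α : Brauer n) : α * star α * α = α := by
  symm
  refine ext_le fun x y h => ?_
  have hT : ∀ {i k}, Tr α i k → Tr (α * star α) i i := fun h => tr_mul h (tr_star.2 h)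
  rcases x with i | i <;> rcases y with j | j
  · exact Up.mul (Up.mul h)
  · exact tr_mul (hT h) h
  · exact PartitionMonoid.Rel.symm (tr_mul (hT h.symm) h.symm)
  · exact Lo.mul h

theorem mul_star_mul' (α : Brauer n) : α * (star α * α) = α := by
  rw [← mul_assoc, mul_star_mul]

theorem star_mul_star (α : Brauer n) : star α * α * star α = star α := by
  simpa using mul_star_mul (star α)

/-! ### Rank -/

/-- The upper vertices that lie in a transversal. -/
def dom (α : Brauer n) : Set (Fin n) := {i | ∃ k, Tr α i k}

/-- The number of transversals of a Brauer element. -/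
noncomputable def rank (α : Brauer n) : ℕ := (dom α).ncard

theorem mem_dom {α : Brauer n} {i : Fin n} : i ∈ dom α ↔ ∃ k, Tr α i k := Iff.rfl

theorem rank_eq (α : Brauer n) : α.1.rank = rank α := by
  symm
  refine Set.ncard_congr (fun i _ => {y | α.1.Rel y (.inl i)}) ?_ ?_ ?_
  · rintro i ⟨k, hk⟩
    exact ⟨⟨_, rfl⟩, ⟨i, .refl _⟩, ⟨k, hk.symm⟩⟩
  · rintro i j ⟨k, hk⟩ - h
    have : Sum.inl i ∈ {y | α.1.Rel y (.inl j)} := by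
      rw [← h]
      exact .refl _
    exact (hk.not_up this).symm
  · rintro B ⟨⟨x, rfl⟩, ⟨i, hi⟩, ⟨k, hk⟩⟩
    have hi : α.1.Rel (.inl i) x := hi
    have hk : α.1.Rel (.inr k) x := hk
    refine ⟨i, ⟨k, hi.trans hk.symm⟩, Set.ext fun y => ?_⟩
    exact ⟨fun h => PartitionMonoid.Rel.trans h hi, fun h => PartitionMonoid.Rel.trans h hi.symm⟩

theorem dom_mul_subset (α β : Brauer n) : dom (α * β) ⊆ dom α := by
  rintro i ⟨k, hk⟩
  rcases up_or_tr α i with ⟨j, hj, h⟩ | h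
  · exact absurd (hk.not_up (h.mul)) hj
  · exact h

theorem rank_mul_le_left (α β : Brauer n) : rank (α * β) ≤ rank α :=
  Set.ncard_le_ncard (dom_mul_subset α β) (Set.toFinite _)

theorem rank_star (α : Brauer n) : rank (star α) = rank α := by
  symm
  classical
  have hk : ∀ i (hi : i ∈ dom α), Tr α i hi.choose := fun i hi => hi.choose_spec
  refine Set.ncard_congr (fun i hi => hi.choose) ?_ ?_ ?_
  · exact fun i hi => ⟨i, tr_star.2 (hk i hi)⟩
  · intro i j hi hj h
    have h1 := hk i hi
    rw [h] at h1
    exact h1.unique_left (hk j hj)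
  · rintro k ⟨i, hi⟩
    rw [tr_star] at hi
    exact ⟨i, ⟨k, hi⟩, (hk i ⟨k, hi⟩).unique hi⟩

theorem rank_mul_le_right (α β : Brauer n) : rank (α * β) ≤ rank β := by
  rw [← rank_star, star_mul, ← rank_star β]
  exact rank_mul_le_left _ _

theorem rank_mul_lt {α β : Brauer n} {i j : Fin n} (hi : i ∈ dom α) (hij : j ≠ i)
    (h : Up (α * β) i j) : rank (α * β) < rank α :=
  Set.ncard_lt_ncard ((Set.ssubset_iff_of_subset (dom_mul_subset α β)).2
    ⟨i, hi, fun ⟨_, hk⟩ => hij (hk.not_up h)⟩) (Set.toFinite _)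

/-! ### The permutation of hooks -/

open Classical in
/-- The involution of the upper vertices that swaps the two ends of each upper hook, and fixes the
ends of the transversals. -/
noncomputable def hookPerm (α : Brauer n) : Equiv.Perm (Fin n) :=
  Function.Involutive.toPerm
    (fun i => if h : ∃ j, j ≠ i ∧ Up α i j then h.choose else i) (by
      intro i
      by_cases h : ∃ j, j ≠ i ∧ Up α i j
      · have h1 := h.choose_spec
        set j := h.choose with hj
        have h2 : ∃ k, k ≠ j ∧ Up α j k := ⟨i, h1.1.symm, h1.2.symm⟩
        have h3 := h2.choose_spec
        simp only [dif_pos h, ← hj, dif_pos h2]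
        exact h3.2.unique h1.2.symm h3.1 h1.1.symm
      · simp only [dif_neg h])

theorem hookPerm_apply_of_ne {α : Brauer n} {i j : Fin n} (hj : j ≠ i) (h : Up α i j) :
    hookPerm α i = j := by
  classical
  have h1 : ∃ j, j ≠ i ∧ Up α i j := ⟨j, hj, h⟩
  change (if h : ∃ j, j ≠ i ∧ Up α i j then h.choose else i) = j
  rw [dif_pos h1]
  exact h1.choose_spec.2.unique h h1.choose_spec.1 hj

theorem hookPerm_apply_of_mem {α : Brauer n} {i : Fin n} (h : i ∈ dom α) : hookPerm α i = i := by
  classical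
  obtain ⟨k, hk⟩ := h
  change (if h : ∃ j, j ≠ i ∧ Up α i j then h.choose else i) = i
  rw [dif_neg]
  rintro ⟨j, hj, h⟩
  exact hj (hk.not_up h)

theorem hookPerm_apply_eq_iff {α : Brauer n} {i : Fin n} : hookPerm α i = i ↔ i ∈ dom α := by
  refine ⟨fun h => ?_, hookPerm_apply_of_mem⟩
  rcases up_or_tr α i with ⟨j, hj, h'⟩ | h'
  · exact absurd ((hookPerm_apply_of_ne hj h').symm.trans h) hj
  · exact h'

theorem up_hookPerm (α : Brauer n) (i : Fin n) : Up α i (hookPerm α i) := by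
  rcases up_or_tr α i with ⟨j, hj, h'⟩ | h'
  · rwa [hookPerm_apply_of_ne hj h']
  · rw [hookPerm_apply_of_mem h']
    exact .refl _

theorem up_iff {α : Brauer n} {i j : Fin n} : Up α i j ↔ j = i ∨ j = hookPerm α i := by
  constructor
  · intro h
    by_cases hj : j = i
    · exact .inl hj
    · exact .inr (hookPerm_apply_of_ne hj h).symm
  · rintro (rfl | rfl)
    · exact .refl _
    · exact up_hookPerm α i

theorem hookPerm_hookPerm (α : Brauer n) (i : Fin n) : hookPerm α (hookPerm α i) = i :=
  Function.Involutive.toPerm_involutive _ i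

theorem hookPerm_sq (α : Brauer n) : hookPerm α ^ 2 = 1 := by
  ext i
  simp [sq, hookPerm_hookPerm]

theorem fixedPoints_hookPerm (α : Brauer n) : {i | hookPerm α i = i} = dom α :=
  Set.ext fun _ => hookPerm_apply_eq_iff

theorem card_fixedPoints_hookPerm (α : Brauer n) :
    Fintype.card (Function.fixedPoints (hookPerm α)) = rank α := by
  rw [rank, ← fixedPoints_hookPerm, ← Nat.card_coe_set_eq, Nat.card_eq_fintype_card]
  rfl

theorem rank_mod_two (α : Brauer n) : rank α % 2 = n % 2 := by
  let f : Function.End (Fin n) := fun i => hookPerm α i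
  have h : Fintype.card (Fin n) ≡ Fintype.card (Function.fixedPoints f) [MOD 2] :=
    Equiv.Perm.card_fixedPoints_modEq (n := 1) (funext fun i => hookPerm_hookPerm α i)
  rw [Fintype.card_fin] at h
  rw [← card_fixedPoints_hookPerm α]
  exact h.symm

/-! ### Projections -/

theorem isStarProjection_mul_star (α : Brauer n) : IsStarProjection (α * star α) where
  isIdempotentElem := by
    change α * star α * (α * star α) = α * star α
    rw [← mul_assoc, mul_star_mul]
  isSelfAdjoint := by simp [IsSelfAdjoint]

theorem isStarProjection_star_mul (α : Brauer n) : IsStarProjection (star α * α) := by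
  simpa using isStarProjection_mul_star (star α)

theorem rank_mul_star (α : Brauer n) : rank (α * star α) = rank α :=
  (rank_mul_le_left _ _).antisymm <| by
    conv_lhs => rw [← mul_star_mul α]
    exact rank_mul_le_left _ _

theorem rank_star_mul (α : Brauer n) : rank (star α * α) = rank α := by
  simpa [rank_star] using rank_mul_star (star α)

theorem dom_mul_star (α : Brauer n) : dom (α * star α) = dom α :=
  (dom_mul_subset _ _).antisymm fun _ ⟨_, hk⟩ => ⟨_, tr_mul hk (tr_star.2 hk)⟩

theorem up_mul_star {α : Brauer n} {i j : Fin n} : Up (α * star α) i j ↔ Up α i j := by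
  refine ⟨fun h => ?_, Up.mul⟩
  by_cases hj : j = i
  · rw [hj]
    exact .refl _
  rcases up_or_tr α i with ⟨k, hk, h'⟩ | h'
  · rwa [Up.unique h h'.mul hj hk]
  · rw [← mem_dom, ← dom_mul_star] at h'
    obtain ⟨k, hk⟩ := h'
    exact absurd (hk.not_up h) hj

theorem tr_of_mem_dom {p : Brauer n} (hp : IsStarProjection p) {i : Fin n} (hi : i ∈ dom p) :
    Tr p i i := by
  obtain ⟨k, hk⟩ := hi
  have := tr_mul hk (tr_star.2 hk)
  rwa [hp.isSelfAdjoint.star_eq, hp.isIdempotentElem.eq] at this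

theorem lo_iff_up {p : Brauer n} (hp : IsStarProjection p) {i j : Fin n} : Lo p i j ↔ Up p i j := by
  conv_lhs => rw [← hp.isSelfAdjoint.star_eq]
  exact star_rel

/-- A projection is a left identity for exactly those elements that have all of its hooks. -/
theorem proj_mul_eq_iff {p : Brauer n} (hp : IsStarProjection p) {α : Brauer n} :
    p * α = α ↔ ∀ i j, Up p i j → Up α i j := by
  refine ⟨fun h i j hij => h ▸ hij.mul, fun h => ?_⟩
  have hdom : dom α ⊆ dom p := by
    rintro i ⟨k, hk⟩
    rcases up_or_tr p i with ⟨j, hj, h'⟩ | h'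
    · exact absurd (hk.not_up (h _ _ h')) hj
    · exact h'
  symm
  refine ext_le fun x y hxy => ?_
  rcases x with i | i <;> rcases y with j | j
  · rcases eq_or_ne j i with rfl | hj
    · exact .refl _
    rcases up_or_tr p i with ⟨k, hk, h'⟩ | hi
    · rw [Up.unique hxy (h _ _ h') hj hk]
      exact h'.mul
    · rcases up_or_tr p j with ⟨k, hk, h'⟩ | hj'
      · obtain rfl := Up.unique hxy.symm (h _ _ h') hj.symm hk
        exact Up.mul h'.symm
      · exact up_mul (tr_of_mem_dom hp hi) hxy (tr_of_mem_dom hp hj')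
  · exact tr_mul (tr_of_mem_dom hp (hdom ⟨j, hxy⟩)) hxy
  · exact (tr_mul (tr_of_mem_dom hp (hdom ⟨i, hxy.symm⟩)) hxy.symm).symm
  · exact Lo.mul hxy

theorem proj_ext {p q : Brauer n} (hp : IsStarProjection p) (hq : IsStarProjection q)
    (h : ∀ i j, Up p i j ↔ Up q i j) : p = q := by
  have h1 := (proj_mul_eq_iff hp).2 fun i j => (h i j).1
  have h2 := (proj_mul_eq_iff hq).2 fun i j => (h i j).2
  rw [← hp.isSelfAdjoint.star_eq, ← h2, star_mul, hp.isSelfAdjoint.star_eq,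
    hq.isSelfAdjoint.star_eq, h1]

theorem proj_ext_hookPerm {p q : Brauer n} (hp : IsStarProjection p) (hq : IsStarProjection q)
    (h : hookPerm p = hookPerm q) : p = q :=
  proj_ext hp hq fun i j => by rw [up_iff, up_iff, h]

theorem mul_star_eq_of_rank {p α : Brauer n} (hp : IsStarProjection p) (h : p * α = α)
    (hr : rank p ≤ rank α) : α * star α = p := by
  have hsub : dom α ⊆ dom p := h ▸ dom_mul_subset p α
  have hd : dom α = dom p := Set.eq_of_subset_of_ncard_le hsub hr (Set.toFinite _)
  refine proj_ext (isStarProjection_mul_star α) hp fun i j => ?_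
  rw [up_mul_star]
  refine ⟨fun hij => ?_, (proj_mul_eq_iff hp).1 h i j⟩
  by_cases hj : j = i
  · rw [hj]
    exact .refl _
  rcases up_or_tr p i with ⟨k, hk, h'⟩ | h'
  · rwa [Up.unique hij ((proj_mul_eq_iff hp).1 h _ _ h') hj hk]
  · rw [← mem_dom, ← hd] at h'
    obtain ⟨k, hk⟩ := h'
    exact absurd (hk.not_up hij) hj

/-- The set of projections of rank `r`. -/
def projections (n r : ℕ) : Set (Brauer n) := {p | IsStarProjection p ∧ rank p = r}

theorem image_projections (r : ℕ) :
    Subtype.val '' projections n r = brauerProjections n r := by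
  ext ε
  constructor
  · rintro ⟨p, ⟨hp, hr⟩, rfl⟩
    exact ⟨p.2, congrArg Subtype.val hp.isIdempotentElem.eq,
      congrArg Subtype.val hp.isSelfAdjoint.star_eq, (rank_eq p).trans hr⟩
  · rintro ⟨h1, h2, h3, h4⟩
    exact ⟨⟨ε, h1⟩, ⟨⟨Subtype.ext h2, Subtype.ext h3⟩, (rank_eq _).symm.trans h4⟩, rfl⟩

theorem ncard_brauerProjections (r : ℕ) :
    (brauerProjections n r).ncard = (projections n r).ncard := by
  rw [← image_projections, Set.ncard_image_of_injective _ Subtype.val_injective]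

/-! ### Rigidity of products of small rank -/

/-- Two perfect matchings that agree outside a set of at most two vertices are equal. -/
theorem ext_of_ncard_le_two {α β : Brauer n} (A : Set (Fin n ⊕ Fin n)) (hA : A.ncard ≤ 2)
    (h : ∀ x ∉ A, ∃ y, y ≠ x ∧ α.1.Rel x y ∧ β.1.Rel x y) : α = β := by
  refine ext_partner fun x => ?_
  by_cases hx : x ∈ A
  swap
  · exact h x hx
  obtain ⟨y, hy, hxy⟩ := exists_partner α x
  obtain ⟨z, hz, hxz⟩ := exists_partner β x
  by_cases hyA : y ∈ A
  swap
  · obtain ⟨w, hw, h1, h2⟩ := h y hyA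
    obtain rfl := partner_unique hxy.symm h1 hy.symm hw
    exact ⟨y, hy, hxy, h2.symm⟩
  by_cases hzA : z ∈ A
  swap
  · obtain ⟨w, hw, h1, h2⟩ := h z hzA
    obtain rfl := partner_unique hxz.symm h2 hz.symm hw
    exact ⟨z, hz, h1.symm, hxz⟩
  rcases eq_or_ne y z with rfl | hyz
  · exact ⟨y, hy, hxy, hxz⟩
  have h3 : ({x, y, z} : Set (Fin n ⊕ Fin n)).ncard = 3 :=
    Set.ncard_eq_three.2 ⟨x, y, z, hy.symm, hz.symm, hyz, rfl⟩
  have h4 := Set.ncard_le_ncard (s := {x, y, z}) (t := A)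
    (by rintro _ (rfl | rfl | rfl) <;> assumption) (Set.toFinite _)
  omega

/-- The vertices that are left over once the upper hooks of `α` and the lower hooks of `β` are
drawn. -/
def freeVertices (α β : Brauer n) : Set (Fin n ⊕ Fin n) :=
  Sum.inl '' dom α ∪ Sum.inr '' dom (star β)

theorem ncard_freeVertices (α β : Brauer n) : (freeVertices α β).ncard = rank α + rank β := by
  rw [freeVertices, Set.ncard_union_eq, Set.ncard_image_of_injective _ Sum.inl_injective,
    Set.ncard_image_of_injective _ Sum.inr_injective]
  · rw [← rank_star β]
    rfl
  · rw [Set.disjoint_left]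
    rintro _ ⟨i, -, rfl⟩ ⟨j, -, h⟩
    cases h

theorem inl_mem_freeVertices {α β : Brauer n} {i : Fin n} :
    Sum.inl i ∈ freeVertices α β ↔ i ∈ dom α := by
  simp [freeVertices]

theorem inr_mem_freeVertices {α β : Brauer n} {i : Fin n} :
    Sum.inr i ∈ freeVertices α β ↔ i ∈ dom (star β) := by
  simp [freeVertices]

theorem exists_of_notMem_freeVertices {α β : Brauer n} {x : Fin n ⊕ Fin n}
    (hx : x ∉ freeVertices α β) :
    ∃ y, y ≠ x ∧ y ∉ freeVertices α β ∧ ∀ γ, (α * γ * β).1.Rel x y := by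
  rcases x with i | i
  · rw [inl_mem_freeVertices] at hx
    rcases up_or_tr α i with ⟨j, hj, h⟩ | h
    · refine ⟨.inl j, by simpa using hj, ?_, fun γ => Up.mul (Up.mul h)⟩
      rw [inl_mem_freeVertices]
      rintro ⟨k, hk⟩
      exact hj (hk.not_up h.symm).symm
    · exact absurd h hx
  · rw [inr_mem_freeVertices] at hx
    rcases lo_or_tr β i with ⟨j, hj, h⟩ | ⟨k, h⟩
    · refine ⟨.inr j, by simpa using hj, ?_, fun γ => Lo.mul h⟩
      rw [inr_mem_freeVertices]
      rintro ⟨k, hk⟩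
      exact hj ((tr_star.1 hk).not_lo h.symm).symm
    · exact absurd ⟨k, tr_star.2 h⟩ hx

/-- If the ranks of `α` and `β` add up to at most two, then the middle factor of a product
`α * γ * β` does not matter. -/
theorem mul_mul_eq {α β : Brauer n} (h : rank α + rank β ≤ 2) (γ : Brauer n) :
    α * γ * β = α * β := by
  refine ext_of_ncard_le_two (freeVertices α β) (by rwa [ncard_freeVertices]) fun x hx => ?_
  obtain ⟨y, hy, -, hxy⟩ := exists_of_notMem_freeVertices hx
  exact ⟨y, hy, hxy γ, by simpa using hxy 1⟩

/-! ### Permutations -/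

/-- The Brauer element of a fixed-point-free involution of the vertices. -/
def ofInvolution (m : Fin n ⊕ Fin n → Fin n ⊕ Fin n) (hm : ∀ x, m (m x) = x) (hm' : ∀ x, m x ≠ x) :
    Brauer n :=
  ⟨⟨{ r := fun x y => y = x ∨ y = m x
      iseqv := by
        refine ⟨fun x => .inl rfl, ?_, ?_⟩
        · rintro x y (rfl | rfl)
          · exact .inl rfl
          · exact .inr (hm x).symm
        · rintro x y z (rfl | rfl) (rfl | rfl)
          · exact .inl rfl
          · exact .inr rfl
          · exact .inr rfl
          · exact .inl (hm x) }⟩, by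
    change ∀ B ∈ PartitionMonoid.blocks _, B.ncard = 2
    rw [PartitionMonoid.forall_blocks_iff]
    exact fun x => ⟨m x, ⟨hm' x, .inr rfl⟩, fun y ⟨h1, h2⟩ => h2.resolve_left h1⟩⟩

theorem rel_ofInvolution (m : Fin n ⊕ Fin n → Fin n ⊕ Fin n) (hm hm') (x : Fin n ⊕ Fin n) :
    (ofInvolution m hm hm').1.Rel x (m x) := .inr rfl

/-- The Brauer element of rank `n` that joins the upper vertex `π i` to the lower vertex `i`. -/
def perm (π : Equiv.Perm (Fin n)) : Brauer n :=
  ofInvolution (Sum.elim (fun i => .inr (π.symm i)) fun i => .inl (π i))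
    (by rintro (i | i) <;> simp) (by rintro (i | i) <;> simp)

theorem tr_perm (π : Equiv.Perm (Fin n)) (i : Fin n) : Tr (perm π) (π i) i :=
  PartitionMonoid.Rel.symm (rel_ofInvolution _ _ _ (Sum.inr i))

theorem tr_perm' (π : Equiv.Perm (Fin n)) (i : Fin n) : Tr (perm π) i (π.symm i) := by
  simpa using tr_perm π (π.symm i)

/-- Elements all of whose blocks are transversals are determined by these. -/
theorem ext_tr {α β : Brauer n} (π : Equiv.Perm (Fin n)) (hα : ∀ i, Tr α (π i) i)
    (hβ : ∀ i, Tr β (π i) i) : α = β := by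
  refine ext_partner ?_
  rintro (i | i)
  · exact ⟨.inr (π.symm i), by simp, by simpa using hα (π.symm i), by simpa using hβ (π.symm i)⟩
  · exact ⟨.inl (π i), by simp, (hα i).symm, (hβ i).symm⟩

theorem tr_one (i : Fin n) : Tr (1 : Brauer n) i i := PartitionMonoid.one_rel.2 rfl

theorem perm_one : perm (1 : Equiv.Perm (Fin n)) = 1 :=
  ext_tr 1 (tr_perm 1) tr_one

theorem perm_mul (π ρ : Equiv.Perm (Fin n)) : perm (π * ρ) = perm π * perm ρ :=
  ext_tr (π * ρ) (tr_perm _) fun i => tr_mul (tr_perm π (ρ i)) (tr_perm ρ i)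

theorem star_perm (π : Equiv.Perm (Fin n)) : star (perm π) = perm π⁻¹ :=
  ext_tr π⁻¹ (fun i => tr_star.2 (tr_perm' π i)) (tr_perm _)

theorem perm_mul_star (π : Equiv.Perm (Fin n)) : perm π * star (perm π) = 1 := by
  rw [star_perm, ← perm_mul, mul_inv_cancel, perm_one]

theorem star_mul_perm (π : Equiv.Perm (Fin n)) : star (perm π) * perm π = 1 := by
  rw [star_perm, ← perm_mul, inv_mul_cancel, perm_one]

theorem up_perm_mul {π : Equiv.Perm (Fin n)} {α : Brauer n} {i j : Fin n} :
    Up (perm π * α) (π i) (π j) ↔ Up α i j := by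
  have key : ∀ (ρ : Equiv.Perm (Fin n)) (β : Brauer n) {i j}, Up β i j →
      Up (perm ρ * β) (ρ i) (ρ j) := fun ρ β i j h => up_mul (tr_perm ρ i) h (tr_perm ρ j)
  refine ⟨fun h => ?_, key π α⟩
  have := key π⁻¹ _ h
  rw [← mul_assoc, ← perm_mul, inv_mul_cancel, perm_one, one_mul] at this
  simpa using this

theorem IsStarProjection.conj {p : Brauer n} (hp : IsStarProjection p)
    (π : Equiv.Perm (Fin n)) : IsStarProjection (perm π * p * star (perm π)) where
  isIdempotentElem := by
    have h := hp.isIdempotentElem.eq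
    change _ * _ = _
    calc perm π * p * star (perm π) * (perm π * p * star (perm π))
        = perm π * p * (star (perm π) * perm π) * p * star (perm π) := by simp only [mul_assoc]
      _ = perm π * (p * p) * star (perm π) := by rw [star_mul_perm]; simp only [mul_assoc, one_mul]
      _ = _ := by rw [h]
  isSelfAdjoint := by
    simp [IsSelfAdjoint, hp.isSelfAdjoint.star_eq, mul_assoc]

theorem up_mul_star_perm {π : Equiv.Perm (Fin n)} {α : Brauer n} {i j : Fin n} :
    Up (α * star (perm π)) i j ↔ Up α i j := by
  refine ⟨fun h => ?_, Up.mul⟩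
  have := h.mul (β := perm π)
  rwa [mul_assoc, star_mul_perm, mul_one] at this

theorem hookPerm_eq {α : Brauer n} {π : Equiv.Perm (Fin n)}
    (h : ∀ i j, Up α i j ↔ j = i ∨ j = π i) : hookPerm α = π := by
  ext1 i
  by_cases hi : π i = i
  · rw [hi]
    by_contra hne
    have := (h i _).1 (up_hookPerm α i)
    rw [hi, or_self] at this
    exact hne this
  · exact hookPerm_apply_of_ne hi ((h _ _).2 (.inr rfl))

theorem hookPerm_conj (p : Brauer n) (π : Equiv.Perm (Fin n)) :
    hookPerm (perm π * p * star (perm π)) = π * hookPerm p * π⁻¹ := by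
  refine hookPerm_eq fun i j => ?_
  obtain ⟨i, rfl⟩ := π.surjective i
  obtain ⟨j, rfl⟩ := π.surjective j
  rw [up_mul_star_perm, up_perm_mul, up_iff]
  simp

theorem rank_perm_mul (π : Equiv.Perm (Fin n)) (α : Brauer n) : rank (perm π * α) = rank α := by
  refine (rank_mul_le_right _ _).antisymm ?_
  calc rank α = rank (star (perm π) * (perm π * α)) := by
        rw [← mul_assoc, star_mul_perm, one_mul]
    _ ≤ _ := rank_mul_le_right _ _

theorem rank_mul_perm (π : Equiv.Perm (Fin n)) (α : Brauer n) : rank (α * perm π) = rank α := by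
  rw [← rank_star, star_mul, star_perm, rank_perm_mul, rank_star]

/-- Projections of the same rank are conjugate under a permutation. -/
theorem exists_conj {r : ℕ} {p q : Brauer n} (hp : p ∈ projections n r)
    (hq : q ∈ projections n r) : ∃ π : Equiv.Perm (Fin n), star (perm π) * p * perm π = q := by
  have hconj : IsConj (hookPerm p) (hookPerm q) := by
    have hc : ∀ α : Brauer n, (hookPerm α).cycleType =
        Multiset.replicate ((n - rank α) / 2) 2 := by
      intro α
      have h1 := Equiv.Perm.cycleType_of_pow_prime_eq_one (p := 2) (hookPerm_sq α)
      have h2 := Equiv.Perm.card_fixedPoints (hookPerm α)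
      rw [card_fixedPoints_hookPerm, Fintype.card_fin, h1, Multiset.sum_replicate] at h2
      rw [h1]
      congr 1
      have h3 := (hookPerm α).sum_cycleType ▸ Finset.card_le_univ (hookPerm α).support
      rw [h1, Multiset.sum_replicate, Fintype.card_fin] at h3
      simp only [smul_eq_mul] at h2 h3
      omega
    rw [Equiv.Perm.isConj_iff_cycleType_eq, hc, hc, hp.2, hq.2]
  obtain ⟨c, hc⟩ := isConj_iff.1 hconj
  refine ⟨c⁻¹, ?_⟩
  rw [star_perm, inv_inv, ← star_perm c]
  exact proj_ext_hookPerm (IsStarProjection.conj hp.1 c) hq.1 (by rw [hookPerm_conj, hc])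

/-! ### Hooks -/

theorem exists_proj_hookPerm (f : Equiv.Perm (Fin n)) (hf : ∀ i, f (f i) = i) :
    ∃ p : Brauer n, IsStarProjection p ∧ hookPerm p = f := by
  let m : Fin n ⊕ Fin n → Fin n ⊕ Fin n :=
    Sum.elim (fun i => if f i = i then .inr i else .inl (f i))
      fun i => if f i = i then .inl i else .inr (f i)
  have hm : ∀ x, m (m x) = x := by
    rintro (i | i) <;> by_cases h : f i = i <;> simp [m, h, hf] <;>
      exact fun h' => absurd h'.symm h
  have hm' : ∀ x, m x ≠ x := by
    rintro (i | i) <;> by_cases h : f i = i <;> simp [m, h]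
  set α := ofInvolution m hm hm'
  refine ⟨_, isStarProjection_mul_star α, hookPerm_eq fun i j => ?_⟩
  rw [up_mul_star]
  have h1 : α.1.Rel (.inl i) (m (.inl i)) := rel_ofInvolution m hm hm' _
  by_cases h : f i = i
  · have h2 : Tr α i i := by simpa [m, h] using h1
    rw [h, or_self]
    refine ⟨h2.not_up, ?_⟩
    rintro rfl
    exact .refl _
  · have h2 : Up α i (f i) := by simpa [m, h] using h1
    constructor
    · intro h'
      by_cases hj : j = i
      · exact .inl hj
      · exact .inr (Up.unique h' h2 hj h)
    · rintro (rfl | rfl)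
      · exact .refl _
      · exact h2

theorem exists_hook (i j : Fin n) :
    ∃ p : Brauer n, IsStarProjection p ∧ hookPerm p = Equiv.swap i j :=
  exists_proj_hookPerm _ (Equiv.swap i j).symm_apply_apply

/-- The projection whose only upper hook joins `i` to `j`; for `i = j`, this is the identity. -/
noncomputable def hook (i j : Fin n) : Brauer n := (exists_hook i j).choose

theorem isStarProjection_hook (i j : Fin n) : IsStarProjection (hook i j) :=
  (exists_hook i j).choose_spec.1

theorem hookPerm_hook (i j : Fin n) : hookPerm (hook i j) = Equiv.swap i j :=
  (exists_hook i j).choose_spec.2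

theorem up_hook (i j : Fin n) : Up (hook i j) i j := by
  rw [up_iff, hookPerm_hook, Equiv.swap_apply_left]
  exact .inr rfl

theorem mem_dom_hook {i j k : Fin n} (hi : k ≠ i) (hj : k ≠ j) : k ∈ dom (hook i j) := by
  rw [← hookPerm_apply_eq_iff, hookPerm_hook, Equiv.swap_apply_of_ne_of_ne hi hj]

theorem tr_hook {i j k : Fin n} (hi : k ≠ i) (hj : k ≠ j) : Tr (hook i j) k k :=
  tr_of_mem_dom (isStarProjection_hook i j) (mem_dom_hook hi hj)

theorem perm_mul_hook (π : Equiv.Perm (Fin n)) (i j : Fin n) :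
    perm π * hook i j = hook (π i) (π j) * perm π := by
  have : perm π * hook i j * star (perm π) = hook (π i) (π j) :=
    proj_ext_hookPerm (IsStarProjection.conj (isStarProjection_hook i j) π)
      (isStarProjection_hook _ _)
      (by rw [hookPerm_conj, hookPerm_hook, hookPerm_hook, Equiv.swap_apply_apply])
  rw [← this, mul_assoc, star_mul_perm, mul_one]

/-- To see that two self-adjoint elements commute, it suffices to look at the upper vertices. -/
theorem comm_of_upper {p q : Brauer n} (hp : IsSelfAdjoint p) (hq : IsSelfAdjoint q)
    (h : ∀ i, ∃ y, y ≠ .inl i ∧ (p * q).1.Rel (.inl i) y ∧ (q * p).1.Rel (.inl i) y) :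
    p * q = q * p := by
  refine ext_partner ?_
  rintro (i | i)
  · exact h i
  · obtain ⟨y, hy, h1, h2⟩ := h i
    have e1 : star (p * q) = q * p := by rw [star_mul, hp.star_eq, hq.star_eq]
    have e2 : star (q * p) = p * q := by rw [star_mul, hp.star_eq, hq.star_eq]
    rw [← e2, star_rel] at h1
    rw [← e1, star_rel] at h2
    exact ⟨y.swap, fun h => hy (by rw [← Sum.swap_swap y, h]; rfl), h2, h1⟩

/-- A hook between two transversals of a projection commutes with that projection. -/
theorem mul_hook_comm {p : Brauer n} (hp : IsStarProjection p) {c d : Fin n} (hc : c ∈ dom p)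
    (hd : d ∈ dom p) (hcd : c ≠ d) : p * hook c d = hook c d * p := by
  refine comm_of_upper hp.isSelfAdjoint (isStarProjection_hook c d).isSelfAdjoint fun i => ?_
  have hc' := tr_of_mem_dom hp hc
  have hd' := tr_of_mem_dom hp hd
  by_cases hic : i = c
  · subst hic
    exact ⟨.inl d, by simpa using hcd.symm, up_mul hc' (up_hook _ _) hd', (up_hook _ _).mul⟩
  by_cases hid : i = d
  · subst hid
    exact ⟨.inl c, by simpa using hcd, (up_mul hc' (up_hook _ _) hd').symm,
      (up_hook c i).mul.symm⟩
  have hi := tr_hook hic hid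
  rcases up_or_tr p i with ⟨j, hj, h⟩ | h
  · have hj' : Tr (hook c d) j j := by
      refine tr_hook ?_ ?_ <;> rintro rfl
      · exact hic (hc'.not_up h.symm)
      · exact hid (hd'.not_up h.symm)
    exact ⟨.inl j, by simpa using hj, h.mul, up_mul hi h hj'⟩
  · have := tr_of_mem_dom hp h
    exact ⟨.inr i, by simp, tr_mul this hi, tr_mul hi this⟩

/-- A permutation that only moves the transversals of a projection commutes with it. -/
theorem mul_perm_comm {p : Brauer n} (hp : IsStarProjection p) {π : Equiv.Perm (Fin n)}
    (hπ : ∀ i ∉ dom p, π i = i) : p * perm π = perm π * p := by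
  have : perm π * p * star (perm π) = p := by
    refine proj_ext_hookPerm (IsStarProjection.conj hp π) hp ?_
    rw [hookPerm_conj, mul_inv_eq_iff_eq_mul]
    ext1 i
    simp only [Equiv.Perm.mul_apply]
    by_cases hi : i ∈ dom p
    · have h1 : π i ∈ dom p := by
        by_contra h
        have := π.injective (hπ _ h)
        exact h (this.symm ▸ hi)
      rw [hookPerm_apply_of_mem hi, hookPerm_apply_of_mem h1]
    · rw [hπ i hi, hπ]
      rw [← hookPerm_apply_eq_iff] at hi ⊢
      rw [hookPerm_hookPerm]
      exact fun h => hi h.symm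
  conv_lhs => rw [← this]
  rw [mul_assoc, star_mul_perm, mul_one]

theorem isStarProjection_mul_hook {p : Brauer n} (hp : IsStarProjection p) {c d : Fin n}
    (hc : c ∈ dom p) (hd : d ∈ dom p) (hcd : c ≠ d) : IsStarProjection (p * hook c d) where
  isIdempotentElem := by
    change p * hook c d * (p * hook c d) = p * hook c d
    rw [mul_assoc, ← mul_assoc _ p, ← mul_hook_comm hp hc hd hcd, mul_assoc p,
      (isStarProjection_hook c d).isIdempotentElem.eq, ← mul_assoc, hp.isIdempotentElem.eq]
  isSelfAdjoint := by
    rw [IsSelfAdjoint, star_mul, hp.isSelfAdjoint.star_eq,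
      (isStarProjection_hook c d).isSelfAdjoint.star_eq, mul_hook_comm hp hc hd hcd]

theorem up_mul_hook {p : Brauer n} (hp : IsStarProjection p) {c d : Fin n}
    (hc : c ∈ dom p) (hd : d ∈ dom p) : Up (p * hook c d) c d :=
  up_mul (tr_of_mem_dom hp hc) (up_hook c d) (tr_of_mem_dom hp hd)

theorem rank_mul_hook_lt {p : Brauer n} (hp : IsStarProjection p) {c d : Fin n}
    (hc : c ∈ dom p) (hd : d ∈ dom p) (hcd : c ≠ d) : rank (p * hook c d) < rank p :=
  rank_mul_lt hc hcd.symm (up_mul_hook hp hc hd)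

theorem hook_mul_eq {α : Brauer n} {c d : Fin n} (h : Up α c d) : hook c d * α = α := by
  refine (proj_mul_eq_iff (isStarProjection_hook c d)).2 fun i j hij => ?_
  rw [up_iff, hookPerm_hook] at hij
  rcases hij with rfl | rfl
  · exact .refl _
  · by_cases hc : i = c
    · rwa [hc, Equiv.swap_apply_left]
    by_cases hd : i = d
    · rw [hd, Equiv.swap_apply_right]
      exact h.symm
    rw [Equiv.swap_apply_of_ne_of_ne hc hd]
    exact .refl _

theorem hook_mul_hook_comm {a b c d : Fin n} (hac : a ≠ c) (had : a ≠ d) (hbc : b ≠ c)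
    (hbd : b ≠ d) (hcd : c ≠ d) : hook a b * hook c d = hook c d * hook a b :=
  mul_hook_comm (isStarProjection_hook a b) (mem_dom_hook hac.symm hbc.symm)
    (mem_dom_hook had.symm hbd.symm) hcd

/-! ### Lowering the rank of one of two projections -/

theorem rank_mul_eq_of_forall {α β : Brauer n} (h : ∀ i ∈ dom α, i ∈ dom (α * β)) :
    rank (α * β) = rank α :=
  (rank_mul_le_left α β).antisymm (Set.ncard_le_ncard h (Set.toFinite _))

/-- A hook at a transversal `k` of `q` lowers the rank of `q`; if `k` lies in a hook of `q'`, it at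
most reroutes a transversal of `q'`. -/
theorem exists_rank_lt_of_not_mem {q q' : Brauer n} (hq : IsStarProjection q)
    (hq' : IsStarProjection q') (h2 : 2 ≤ rank q) {k : Fin n} (hk : k ∈ dom q) (hk' : k ∉ dom q') :
    ∃ η, rank (q * η) < rank q ∧ rank (q' * η) = rank q' := by
  obtain ⟨m, hm, hmk⟩ := Set.exists_ne_of_one_lt_ncard h2 k
  refine ⟨hook k m, rank_mul_hook_lt hq hk hm hmk.symm, rank_mul_eq_of_forall fun a ha => ?_⟩
  have hak : a ≠ k := fun h => hk' (h ▸ ha)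
  have hat := tr_of_mem_dom hq' ha
  by_cases ham : a = m
  · subst ham
    have hlk : hookPerm q' k ≠ k := by rwa [Ne, hookPerm_apply_eq_iff]
    have hl := up_hookPerm q' k
    have hla : hookPerm q' k ≠ a := fun h => hak ((hat.not_up (h ▸ hl).symm).symm)
    exact ⟨_, tr_mul_zigzag hat (up_hook k a).symm ((lo_iff_up hq').2 hl) (tr_hook hlk hla)⟩
  · exact ⟨a, tr_mul hat (tr_hook hak ham)⟩

theorem exists_rank_lt_of_dom_eq {q q' : Brauer n} (hq : IsStarProjection q)
    (hq' : IsStarProjection q') (h2 : 2 ≤ rank q) (hd : dom q = dom q') (hne : q ≠ q') :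
    ∃ η, rank (q * η) = rank q ∧ rank (q' * η) < rank q' := by
  obtain ⟨j, hj⟩ : ∃ j, hookPerm q j ≠ hookPerm q' j := by
    by_contra h
    push Not at h
    exact hne (proj_ext_hookPerm hq hq' (Equiv.ext h))
  have hjq : j ∉ dom q := fun h => hj (by
    rw [hookPerm_apply_of_mem h, hookPerm_apply_of_mem (hd ▸ h)])
  obtain ⟨m₁, hm₁, m₂, hm₂, hm⟩ := (Set.one_lt_ncard_iff (Set.toFinite _)).1 h2 |>
    fun ⟨a, b, h1, h2, h3⟩ => (⟨a, h1, b, h2, h3⟩ : ∃ a ∈ dom q, ∃ b ∈ dom q, a ≠ b)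
  have hiff : ∀ (p : Brauer n) x, hookPerm p x ∈ dom p → x ∈ dom p := fun p x h => by
    rw [← hookPerm_apply_eq_iff] at h ⊢
    rw [hookPerm_hookPerm] at h
    exact h.symm
  set i := hookPerm q j with hi
  set k := hookPerm q' j with hk
  have hiq : i ∉ dom q := fun h => hjq (hiff q j h)
  have hkq : k ∉ dom q := fun h => hjq (hd ▸ hiff q' j (hd ▸ h))
  have hij : i ≠ j := fun h => hjq (hookPerm_apply_eq_iff.1 h)
  have hkj : k ≠ j := fun h => hjq (hd ▸ hookPerm_apply_eq_iff.1 h)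
  set l := hookPerm q k with hl
  have hlq : l ∉ dom q := fun h => hkq (hiff q k h)
  have hlk : l ≠ k := fun h => hkq (hookPerm_apply_eq_iff.1 h)
  have hlj : l ≠ j := by
    intro h
    have := hookPerm_hookPerm q k
    rw [← hl, h] at this
    exact hj this
  have ne : ∀ {x y}, x ∈ dom q → y ∉ dom q → x ≠ y := fun hx hy h => hy (h ▸ hx)
  -- the upper hooks of `η` link the transversal at `m₁` to that at `m₂` through the hook `jk` of
  -- `q'`, but through no hook of `q`
  have hη₁ : Up (hook m₁ j * hook k m₂) m₁ j := (up_hook m₁ j).mul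
  have hη₂ : Up (hook m₁ j * hook k m₂) k m₂ :=
    up_mul (tr_hook (ne hm₁ hkq).symm hkj) (up_hook k m₂) (tr_hook hm.symm (ne hm₂ hjq))
  have hη : ∀ {x}, x ≠ m₁ → x ≠ j → x ≠ k → x ≠ m₂ → Tr (hook m₁ j * hook k m₂) x x :=
    fun h1 h2 h3 h4 => tr_mul (tr_hook h1 h2) (tr_hook h3 h4)
  have ht := fun {x} (hx : x ∈ dom q) => tr_of_mem_dom hq hx
  have ht' := fun {x} (hx : x ∈ dom q) => tr_of_mem_dom hq' (hd ▸ hx : x ∈ dom q')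
  refine ⟨hook m₁ j * hook k m₂, rank_mul_eq_of_forall fun a ha => ?_,
    rank_mul_lt (hd ▸ hm₁) hm.symm ?_⟩
  · by_cases h1 : a = m₁
    · subst h1
      exact ⟨i, tr_mul_zigzag (ht hm₁) hη₁ ((lo_iff_up hq).2 (up_hookPerm q j))
        (hη (ne hm₁ hiq).symm hij hj (ne hm₂ hiq).symm)⟩
    by_cases h2 : a = m₂
    · subst h2
      exact ⟨l, tr_mul_zigzag (ht hm₂) hη₂.symm ((lo_iff_up hq).2 (up_hookPerm q k))
        (hη (ne hm₁ hlq).symm hlj hlk (ne hm₂ hlq).symm)⟩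
    exact ⟨a, tr_mul (ht ha) (hη h1 (ne ha hjq) (ne ha hkq) h2)⟩
  · exact up_mul_zigzag (ht' hm₁) hη₁ ((lo_iff_up hq').2 (up_hookPerm q' j)) hη₂ (ht' hm₂)

/-- Two distinct projections of the same rank `r ≥ 2` can be told apart by a right multiplication
that preserves the rank of one and lowers that of the other. -/
theorem exists_rank_lt {r : ℕ} (hr : 2 ≤ r) {q q' : Brauer n} (hq : q ∈ projections n r)
    (hq' : q' ∈ projections n r) (hne : q ≠ q') :
    ∃ η, (rank (q * η) = r ∧ rank (q' * η) < r) ∨ (rank (q' * η) = r ∧ rank (q * η) < r) := by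
  obtain ⟨hq, hqr⟩ := hq
  obtain ⟨hq', hqr'⟩ := hq'
  by_cases hd : dom q = dom q'
  · obtain ⟨η, h1, h2⟩ := exists_rank_lt_of_dom_eq hq hq' (hqr ▸ hr) hd hne
    exact ⟨η, .inl ⟨h1.trans hqr, h2.trans_eq hqr'⟩⟩
  · have : ¬ dom q ⊆ dom q' := fun h => hd (Set.eq_of_subset_of_ncard_le h
      (hqr'.trans hqr.symm).le (Set.toFinite _))
    obtain ⟨k, hk, hk'⟩ := Set.not_subset.1 this
    obtain ⟨η, h1, h2⟩ := exists_rank_lt_of_not_mem hq hq' (hqr ▸ hr) hk hk'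
    exact ⟨η, .inr ⟨h2.trans hqr', h1.trans_eq hqr⟩⟩

/-! ### The number of projections -/

/-- A projection is determined by its permutation of hooks, which is any involution, so that the
projections of rank `r` are counted by the permutations of cycle type `2 ^ k`. -/
theorem ncard_projections_mul (r k : ℕ) :
    (projections (r + 2 * k) r).ncard * (r ! * 2 ^ k * k !) = (r + 2 * k)! := by
  classical
  have h1 : (projections (r + 2 * k) r).ncard =
      (Finset.univ.filter fun f : Equiv.Perm (Fin (r + 2 * k)) =>
        f.cycleType = Multiset.replicate k 2).card := by
    rw [← Set.ncard_coe_finset]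
    refine Set.ncard_congr (fun p _ => hookPerm p) ?_ ?_ ?_
    · rintro p ⟨hp, hr⟩
      have h1 := Equiv.Perm.cycleType_of_pow_prime_eq_one (p := 2) (hookPerm_sq p)
      have h2 := Equiv.Perm.card_fixedPoints (hookPerm p)
      have h3 := (hookPerm p).sum_cycleType_le
      rw [card_fixedPoints_hookPerm, hr, Fintype.card_fin, h1, Multiset.sum_replicate,
        smul_eq_mul] at h2
      rw [h1, Multiset.sum_replicate, smul_eq_mul, Fintype.card_fin] at h3
      simp only [Finset.coe_filter, Finset.mem_univ, true_and, Set.mem_ofPred_eq]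
      rw [h1]
      congr 1
      omega
    · exact fun p q hp hq h => proj_ext_hookPerm hp.1 hq.1 h
    · intro f hf
      simp only [Finset.coe_filter, Finset.mem_univ, true_and, Set.mem_ofPred_eq] at hf
      have hf2 : f ^ 2 = 1 := by
        rw [← orderOf_dvd_iff_pow_eq_one, ← Equiv.Perm.lcm_cycleType, hf, Multiset.lcm_dvd]
        exact fun b hb => (Multiset.eq_of_mem_replicate hb).dvd
      obtain ⟨p, hp, rfl⟩ := exists_proj_hookPerm f fun i => by
        rw [← Equiv.Perm.mul_apply, ← sq, hf2, Equiv.Perm.one_apply]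
      refine ⟨p, ⟨hp, ?_⟩, rfl⟩
      rw [← card_fixedPoints_hookPerm, Equiv.Perm.card_fixedPoints, hf, Multiset.sum_replicate,
        Fintype.card_fin, smul_eq_mul]
      omega
  have h2 := Equiv.Perm.card_of_cycleType_mul_eq (Fin (r + 2 * k)) (Multiset.replicate k 2)
  rw [h1]
  rw [Multiset.sum_replicate, Multiset.prod_replicate, smul_eq_mul, Fintype.card_fin, if_pos,
    show r + 2 * k - k * 2 = r by omega] at h2
  · rw [← h2]
    congr 2
    rcases Nat.eq_zero_or_pos k with rfl | hk
    · simp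
    · rw [Multiset.toFinset_replicate, if_neg hk.ne', Finset.prod_singleton,
        Multiset.count_replicate_self]
  · refine ⟨by omega, fun a ha => (Multiset.eq_of_mem_replicate ha).ge⟩

theorem projections_nonempty {r : ℕ} (hr : r ≤ n) (h : r % 2 = n % 2) :
    (projections n r).Nonempty := by
  obtain ⟨k, rfl⟩ : ∃ k, n = r + 2 * k := ⟨(n - r) / 2, by omega⟩
  refine Set.nonempty_of_ncard_ne_zero fun h => ?_
  have := ncard_projections_mul r k
  rw [h, zero_mul] at this
  exact (Nat.factorial_ne_zero _) this.symm

/-! ### The minimal ideal and the critical rank -/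

theorem rank_mul_of_right {α δ : Brauer n} (hδ : rank δ = n % 2) : rank (α * δ) = n % 2 := by
  have := rank_mul_le_right α δ
  have := rank_mod_two (α * δ)
  omega

theorem rank_mul_of_left {α δ : Brauer n} (hδ : rank δ = n % 2) : rank (δ * α) = n % 2 := by
  have := rank_mul_le_left δ α
  have := rank_mod_two (δ * α)
  omega

/-- Below the critical rank `4 - n % 2`, the product of `α` with an element of the minimal ideal
depends only on `α` and on the lower hooks of that element. -/
theorem mul_mul_of_rank_lt {α δ : Brauer n} (hα : rank α < 4 - n % 2) (hδ : rank δ = n % 2)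
    (γ : Brauer n) : α * γ * δ = α * δ :=
  mul_mul_eq (by have := rank_mod_two α; omega) γ

/-- The dual of `mul_mul_of_rank_lt`. -/
theorem mul_mul_of_rank_lt' {α δ : Brauer n} (hα : rank α < 4 - n % 2) (hδ : rank δ = n % 2)
    (γ : Brauer n) : δ * γ * α = δ * α :=
  mul_mul_eq (by have := rank_mod_two α; omega) γ

theorem mul_mul_of_minimal {ζ δ : Brauer n} (hζ : rank ζ = n % 2) (hδ : rank δ = n % 2)
    (γ : Brauer n) : ζ * γ * δ = ζ * δ :=
  mul_mul_of_rank_lt (by omega) hδ γ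

/-- A projection of the critical rank `4 - n % 2` together with three of its transversals. -/
structure Frame (n : ℕ) where
  p : Brauer n
  hp : p ∈ projections n (4 - n % 2)
  v : Fin 3 ↪ Fin n
  mem_dom : ∀ i, v i ∈ dom p

theorem Frame.nonempty (hn : 3 ≤ n) : Nonempty (Frame n) := by
  obtain ⟨p, hp⟩ := projections_nonempty (n := n) (r := 4 - n % 2) (by omega) (by omega)
  have h : Nonempty (Fin 3 ↪ dom p) := by
    classical
    refine Function.Embedding.nonempty_of_card_le ?_
    rw [Fintype.card_fin, ← Nat.card_eq_fintype_card, Nat.card_coe_set_eq]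
    have : (dom p).ncard = 4 - n % 2 := hp.2
    omega
  obtain ⟨v⟩ := h
  exact ⟨⟨p, hp, v.trans (Function.Embedding.subtype _), fun i => (v i).2⟩⟩

namespace Frame

variable (F : Frame n)

/-- The projection obtained from that of the frame by joining the transversals `i` and `i + 1`,
with indices modulo three. -/
noncomputable def s (i : Fin 3) : Brauer n := F.p * hook (F.v i) (F.v (i + 1))

/-- The cyclic permutation of the three transversals of the frame. -/
noncomputable def σ : Equiv.Perm (Fin n) := (Equiv.addRight (1 : Fin 3)).viaFintypeEmbedding F.v

theorem σ_apply (i : Fin 3) : F.σ (F.v i) = F.v (i + 1) :=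
  Equiv.Perm.viaFintypeEmbedding_apply_image _ _ _

theorem σ_apply_of_notMem {j : Fin n} (h : j ∉ dom F.p) : F.σ j = j :=
  Equiv.Perm.viaFintypeEmbedding_apply_notMem_range _ _ (by
    rintro ⟨i, rfl⟩
    exact h (F.mem_dom i))

theorem v_ne (i : Fin 3) : F.v i ≠ F.v (i + 1) :=
  F.v.injective.ne (by revert i; decide)

theorem v_ne' (i : Fin 3) : F.v i ≠ F.v (i + 1 + 1) :=
  F.v.injective.ne (by revert i; decide)

theorem eq_add_one_or {i j : Fin 3} (h : j ≠ i) : j = i + 1 ∨ i = j + 1 := by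
  revert i j
  decide

theorem isStarProjection_s (i : Fin 3) : IsStarProjection (F.s i) :=
  isStarProjection_mul_hook F.hp.1 (F.mem_dom _) (F.mem_dom _) (F.v_ne i)

theorem rank_s_lt (i : Fin 3) : rank (F.s i) < 4 - n % 2 :=
  F.hp.2 ▸ rank_mul_hook_lt F.hp.1 (F.mem_dom _) (F.mem_dom _) (F.v_ne i)

theorem p_mul_s (i : Fin 3) : F.p * F.s i = F.s i := by
  rw [s, ← mul_assoc, F.hp.1.isIdempotentElem.eq]

theorem p_mul_σ : F.p * perm F.σ = perm F.σ * F.p :=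
  mul_perm_comm F.hp.1 fun _ => F.σ_apply_of_notMem

theorem σ_mul_s (i : Fin 3) : perm F.σ * F.s i = F.s (i + 1) * perm F.σ := by
  rw [s, s, ← mul_assoc, ← F.p_mul_σ, mul_assoc, perm_mul_hook, σ_apply, σ_apply, mul_assoc]

theorem up_s (i : Fin 3) : Up (F.s i) (F.v i) (F.v (i + 1)) :=
  up_mul_hook F.hp.1 (F.mem_dom _) (F.mem_dom _)

theorem s_mul_eq {i : Fin 3} {α : Brauer n} (h : Up (F.p * α) (F.v i) (F.v (i + 1))) :
    F.s i * α = F.p * α := by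
  rw [s, mul_hook_comm F.hp.1 (F.mem_dom _) (F.mem_dom _) (F.v_ne i), mul_assoc, hook_mul_eq h]

/-- Every element of the minimal ideal joins two of the three transversals of a frame. -/
theorem exists_s_mul {δ : Brauer n} (hδ : rank δ = n % 2) : ∃ i, F.p * δ = F.s i * δ := by
  by_contra! hne
  have hcard := ncard_freeVertices F.p δ
  rw [F.hp.2, hδ, show 4 - n % 2 + n % 2 = 4 by omega] at hcard
  set A := freeVertices F.p δ
  have hv : ∀ i, Sum.inl (F.v i) ∈ A := fun i => inl_mem_freeVertices.2 (F.mem_dom i)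
  set R : Set (Fin n ⊕ Fin n) := Set.range (Sum.inl ∘ F.v)
  have hR : R.ncard = 3 := by
    rw [show R = Set.range _ from rfl, ← Set.image_univ, Set.ncard_image_of_injective _
      (Sum.inl_injective.comp F.v.injective), Set.ncard_univ, Nat.card_fin]
  have hRA : R ⊆ A := by
    rintro _ ⟨i, rfl⟩
    exact hv i
  have h1 : (A \ R).ncard ≤ 1 := by
    rw [Set.ncard_sdiff hRA (Set.toFinite _), hcard, hR]
  -- the partners of the three transversals all lie in the one-element set `A \ R`
  have key : ∀ i, ∃ y ∈ A \ R, (F.p * δ).1.Rel (.inl (F.v i)) y ∧ y ≠ .inl (F.v i) := by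
    intro i
    obtain ⟨y, hy, hxy⟩ := exists_partner (F.p * δ) (.inl (F.v i))
    refine ⟨y, ⟨?_, ?_⟩, hxy, hy⟩
    · by_contra hyA
      obtain ⟨w, hw, hwA, hrel⟩ := exists_of_notMem_freeVertices hyA
      have := hrel 1
      rw [mul_one] at this
      exact hwA (partner_unique this hxy.symm hw hy.symm ▸ hv i)
    · rintro ⟨j, rfl⟩
      have hij : j ≠ i := fun h => hy (by rw [h]; rfl)
      rcases eq_add_one_or hij with rfl | rfl
      · exact hne i (F.s_mul_eq hxy).symm
      · exact hne j (F.s_mul_eq hxy.symm).symm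
  obtain ⟨y, hyA, hy, hy'⟩ := key 0
  obtain ⟨z, hzA, hz, hz'⟩ := key 1
  obtain rfl := (Set.ncard_le_one (Set.toFinite _)).1 h1 y hyA z hzA
  have := Sum.inl_injective (partner_unique hy.symm hz.symm hy'.symm hz'.symm)
  exact absurd (F.v.injective this) (by decide)

theorem exists_mul_s {δ : Brauer n} (hδ : rank δ = n % 2) : ∃ i, δ * F.p = δ * F.s i := by
  obtain ⟨i, hi⟩ := F.exists_s_mul (rank_star δ ▸ hδ)
  refine ⟨i, ?_⟩
  rw [← star_inj, star_mul, star_mul, F.hp.1.isSelfAdjoint.star_eq,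
    (F.isStarProjection_s i).isSelfAdjoint.star_eq, hi]

theorem s_mul_injective {α β : Brauer n} {i j : Fin 3} (h : F.s i * α = F.s j * β) : i = j := by
  by_contra hij
  have h1 : Up (F.s i * α) (F.v i) (F.v (i + 1)) := (F.up_s i).mul
  have h2 : Up (F.s i * α) (F.v j) (F.v (j + 1)) := h ▸ (F.up_s j).mul
  rcases eq_add_one_or (Ne.symm hij) with rfl | rfl
  · exact F.v_ne' _ (Up.unique h1.symm h2 (F.v_ne _) (F.v_ne _).symm)
  · exact F.v_ne' _ (Up.unique h2.symm h1 (F.v_ne _) (F.v_ne _).symm)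

theorem mul_s_injective {α β : Brauer n} {i j : Fin 3} (h : α * F.s i = β * F.s j) : i = j := by
  rw [← star_inj, star_mul, star_mul, (F.isStarProjection_s i).isSelfAdjoint.star_eq,
    (F.isStarProjection_s j).isSelfAdjoint.star_eq] at h
  exact F.s_mul_injective h

end Frame

/-! ### Strata of an action -/

section Actions

variable {X : Type*} (μ : RightAction X (Brauer n))

theorem act_mul (x : X) (α β : Brauer n) : μ.act x (α * β) = μ.act (μ.act x α) β :=
  (μ.act_act x α β).symm

/-- The points that are reached by an element of rank less than `r`. -/
def below (r : ℕ) : Set X := {x | ∃ y α, rank α < r ∧ μ.act y α = x}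

theorem below_mono {r t : ℕ} (h : r ≤ t) : below μ r ⊆ below μ t :=
  fun _ ⟨y, α, hα, hx⟩ => ⟨y, α, hα.trans_le h, hx⟩

theorem act_mem_below {r : ℕ} {x : X} (hx : x ∈ below μ r) (α : Brauer n) :
    μ.act x α ∈ below μ r := by
  obtain ⟨y, β, hβ, rfl⟩ := hx
  exact ⟨y, β * α, (rank_mul_le_left _ _).trans_lt hβ, act_mul μ _ _ _⟩

theorem act_perm_mem_below {r : ℕ} {x : X} {π : Equiv.Perm (Fin n)} {p : Brauer n}
    (hx : μ.act x p = x) (h : μ.act x (perm π) ∈ below μ r) : x ∈ below μ r := by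
  have := act_mem_below μ h (star (perm π) * p)
  rwa [← act_mul, ← mul_assoc, perm_mul_star, one_mul, hx] at this

/-- A family of `d` points that are fixed by a projection of rank `r ≥ 2` and do not come from lower
ranks yields `d` points for each projection of rank `r`. -/
theorem ncard_below_add_le [Finite X] {r d : ℕ} (hr : 2 ≤ r) {p : Brauer n}
    (hp : p ∈ projections n r) (z : Fin d → X) (hz : Function.Injective z)
    (hzp : ∀ i, μ.act (z i) p = z i) (hzr : ∀ i, z i ∉ below μ r) :
    (below μ r).ncard + d * (projections n r).ncard ≤ (below μ (r + 1)).ncard := by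
  choose π hπ using fun q : projections n r => exists_conj hp q.2
  let w : Fin d × projections n r → X := fun a => μ.act (z a.1) (perm (π a.2))
  have hwq : ∀ a, μ.act (w a) a.2 = w a := by
    intro a
    change μ.act (μ.act (z a.1) (perm (π a.2))) a.2 = μ.act (z a.1) (perm (π a.2))
    conv_lhs => rw [← hπ a.2]
    rw [← act_mul, ← mul_assoc, ← mul_assoc, perm_mul_star, one_mul, act_mul, hzp]
  have hwr : ∀ a, w a ∉ below μ r := fun a h => hzr a.1 (act_perm_mem_below μ (hzp a.1) h)
  have aux : ∀ a b η, w a = w b → rank (a.2.1 * η) = r → rank (b.2.1 * η) < r → False := by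
    intro a b η hab h1 h2
    refine hwr a ?_
    have h3 : μ.act (w a) η ∈ below μ r :=
      ⟨w b, b.2 * η, h2, by rw [act_mul, hwq, hab]⟩
    have h4 := mul_star_eq_of_rank a.2.2.1 (α := a.2.1 * η)
      (by rw [← mul_assoc, a.2.2.1.isIdempotentElem.eq]) (by rw [h1, a.2.2.2])
    have h5 := act_mem_below μ h3 (star (a.2.1 * η))
    rwa [← hwq a, ← act_mul, ← act_mul, ← mul_assoc, h4, hwq] at h5
  have hw : Function.Injective w := by
    rintro ⟨i, q⟩ ⟨j, q'⟩ h
    by_cases hq : q = q'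
    · subst hq
      have := congrArg (fun x => μ.act x (star (perm (π q)) * p)) h
      simp only [w, ← act_mul] at this
      rw [← mul_assoc, perm_mul_star, one_mul, hzp, hzp] at this
      rw [hz this]
    · obtain ⟨η, ⟨h1, h2⟩ | ⟨h1, h2⟩⟩ := exists_rank_lt hr q.2 q'.2 fun h => hq (Subtype.ext h)
      · exact (aux ⟨i, q⟩ ⟨j, q'⟩ η h h1 h2).elim
      · exact (aux ⟨j, q'⟩ ⟨i, q⟩ η h.symm h1 h2).elim
  have hcard : (Set.range w).ncard = d * (projections n r).ncard := by
    rw [← Set.image_univ, Set.ncard_image_of_injective _ hw, Set.ncard_univ, Nat.card_prod,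
      Nat.card_fin, Nat.card_coe_set_eq]
  rw [← hcard, ← Set.ncard_union_eq]
  · refine Set.ncard_le_ncard (Set.union_subset (below_mono μ (Nat.le_succ r)) ?_) (Set.toFinite _)
    rintro _ ⟨a, rfl⟩
    exact ⟨w a, a.2, a.2.2.2.trans_lt (Nat.lt_succ_self r), hwq a⟩
  · rw [Set.disjoint_left]
    rintro _ h ⟨a, rfl⟩
    exact hwr a h

/-! ### Collapsing points -/

/-- A point collapses if the elements of the minimal ideal act on it through their lower hooks
only. -/
def Collapses (z : X) : Prop :=
  ∀ α δ, rank δ = n % 2 → μ.act z (α * δ) = μ.act z δ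

variable {μ}

theorem Collapses.act {z : X} (h : Collapses μ z) (γ : Brauer n) : Collapses μ (μ.act z γ) :=
  fun α δ hδ => by
    rw [← act_mul, ← mul_assoc, h _ _ hδ, ← act_mul, h _ _ hδ]

theorem Collapses.of_perm {z : X} {π : Equiv.Perm (Fin n)} (h : Collapses μ (μ.act z (perm π))) :
    Collapses μ z := by
  have h1 := h.act (star (perm π))
  rw [← act_mul, perm_mul_star] at h1
  intro α δ hδ
  have := h1 α δ hδ
  rwa [← act_mul, ← act_mul, one_mul, one_mul] at this

theorem collapses_of_act_eq {z : X} {p : Brauer n} (hp : rank p < 4 - n % 2)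
    (h : μ.act z p = z) : Collapses μ z := fun α δ hδ => by
  rw [← h, ← act_mul, ← act_mul, ← mul_assoc, mul_mul_of_rank_lt hp hδ]

theorem collapses_of_mem_below {z : X} (hz : z ∈ below μ (4 - n % 2)) : Collapses μ z := by
  obtain ⟨y, α, hα, rfl⟩ := hz
  exact collapses_of_act_eq (p := star α * α) ((rank_star_mul α).trans_lt hα)
    (by rw [← act_mul, mul_star_mul'])

/-- If each point fixed by a projection of critical rank collapses, then all points do: a point
fixed by a projection `p` of larger rank collapses because every element of the minimal ideal joins
some transversals `c`, `d` of `p`, and `p` has two further transversals `s`, `t`. -/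
theorem collapses_of_critical
    (h : ∀ p ∈ projections n (4 - n % 2), ∀ z, μ.act z p = z → Collapses μ z) (z : X) :
    Collapses μ z := by
  have key : ∀ k, ∀ p ∈ projections n k, ∀ z, μ.act z p = z → Collapses μ z := by
    intro k
    induction k using Nat.strong_induction_on with
    | _ k ih =>
    intro p hp z hz
    rcases lt_trichotomy k (4 - n % 2) with hk | hk | hk
    · exact collapses_of_act_eq (hp.2 ▸ hk) hz
    · exact h p (hk ▸ hp) z hz
    have hk5 : 5 ≤ (dom p).ncard := by
      have h1 := hp.2
      have h2 := rank_mod_two p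
      change 5 ≤ rank p
      omega
    have hcol : ∀ c ∈ dom p, ∀ d ∈ dom p, c ≠ d → Collapses μ (μ.act z (p * hook c d)) := by
      intro c hc d hd hcd
      have h1 := isStarProjection_mul_hook hp.1 hc hd hcd
      refine ih _ (hp.2 ▸ rank_mul_hook_lt hp.1 hc hd hcd) _ ⟨h1, rfl⟩ _ ?_
      rw [← act_mul, h1.isIdempotentElem.eq]
    have hdom : ∀ {β : Brauer n} {c d}, c ∈ dom p → c ≠ d → Up (p * β) c d → d ∈ dom p := by
      intro β c d hc hcd hβ
      rcases up_or_tr p d with ⟨e, he, h'⟩ | h'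
      · obtain rfl := Up.unique h'.mul hβ.symm he hcd
        obtain ⟨k, hk⟩ := hc
        exact absurd (hk.not_up h'.symm) hcd.symm
      · exact h'
    have half : ∀ {δ : Brauer n} {c d s t}, rank δ = n % 2 → c ∈ dom p → d ∈ dom p → s ∈ dom p →
        t ∈ dom p → c ≠ d → s ≠ t → s ≠ c → s ≠ d → t ≠ c → t ≠ d → Up (p * δ) c d →
        μ.act z δ = μ.act (μ.act z (p * hook s t)) δ := by
      intro δ c d s t hδ hc hd hs ht hcd hst hsc hsd htc htd hup
      calc μ.act z δ = μ.act (μ.act z (p * hook c d)) δ := by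
            rw [← act_mul, mul_hook_comm hp.1 hc hd hcd, mul_assoc, hook_mul_eq hup, act_mul, hz]
        _ = μ.act (μ.act z (p * hook c d)) (hook s t * δ) := (hcol c hc d hd hcd _ _ hδ).symm
        _ = μ.act (μ.act z (p * hook s t)) (hook c d * δ) := by
            rw [← act_mul, ← act_mul, ← mul_assoc, mul_assoc p,
              hook_mul_hook_comm hsc.symm htc.symm hsd.symm htd.symm hst]
            simp only [mul_assoc]
        _ = μ.act (μ.act z (p * hook s t)) δ := hcol s hs t ht hst _ _ hδ
    intro α δ hδ
    have hα := rank_mul_of_right (α := α) hδ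
    obtain ⟨c, hc, hc'⟩ : ∃ c ∈ dom p, c ∉ dom (p * δ) ∪ dom (p * (α * δ)) := by
      refine Set.exists_mem_notMem_of_ncard_lt_ncard ?_ (Set.toFinite _)
      have h1 : (dom (p * δ)).ncard = n % 2 := rank_mul_of_right hδ
      have h2 : (dom (p * (α * δ))).ncard = n % 2 := rank_mul_of_right hα
      have := Set.ncard_union_le (dom (p * δ)) (dom (p * (α * δ)))
      omega
    rw [Set.mem_union, not_or] at hc'
    obtain ⟨d, hdc, hd⟩ := (up_or_tr (p * δ) c).resolve_right hc'.1
    obtain ⟨d', hdc', hd'⟩ := (up_or_tr (p * (α * δ)) c).resolve_right hc'.2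
    obtain ⟨s, t, hs, ht, hst⟩ :
        ∃ s t, s ∈ dom p \ {c, d, d'} ∧ t ∈ dom p \ {c, d, d'} ∧ s ≠ t := by
      refine (Set.one_lt_ncard_iff (Set.toFinite _)).1 ?_
      have h1 := Set.le_ncard_sdiff {c, d, d'} (dom p)
      have h2 := Set.ncard_insert_le c {d, d'}
      have h3 := Set.ncard_insert_le d {d'}
      rw [Set.ncard_singleton] at h3
      omega
    simp only [Set.mem_sdiff, Set.mem_insert_iff, Set.mem_singleton_iff, not_or] at hs ht
    rw [half hδ hc (hdom hc hdc.symm hd) hs.1 ht.1 hdc.symm hst hs.2.1 hs.2.2.1 ht.2.1 ht.2.2.1 hd,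
      half hα hc (hdom hc hdc'.symm hd') hs.1 ht.1 hdc'.symm hst hs.2.1 hs.2.2.2 ht.2.1 ht.2.2.2
        hd',
      hcol s hs.1 t ht.1 hst _ _ hδ]
  have h1 : IsStarProjection (1 : Brauer n) := ⟨one_mul 1, star_one _⟩
  intro α δ hδ
  have := key _ 1 ⟨h1, rfl⟩ (μ.act z 1) (by rw [← act_mul, one_mul]) α δ hδ
  rwa [← act_mul, ← act_mul, one_mul, one_mul] at this

/-! ### Lower bounds for faithful actions -/

theorem projections_minimal_nonempty (hn : 3 ≤ n) : (projections n (n % 2)).Nonempty :=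
  projections_nonempty (by omega) (by omega)

/-- If all points collapse, then the elements of the minimal ideal with the same lower hooks act
alike, but these are not all equal. -/
theorem not_forall_collapses (hn : 3 ≤ n) (hμ : μ.IsFaithful) : ¬ ∀ z, Collapses μ z := by
  intro h
  obtain ⟨F⟩ := Frame.nonempty hn
  obtain ⟨δ, -, hδ⟩ := projections_minimal_nonempty hn
  have h1 : F.s 0 * δ = F.s 1 * δ := hμ _ _ fun z => by rw [h z _ _ hδ, h z _ _ hδ]
  exact absurd (F.s_mul_injective h1) (by decide)

/-- A point that is fixed by the projection and by the three-cycle of a frame collapses, since the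
three projections `F.s i`, one of which can replace `F.p` in front of any element of the minimal
ideal, then act on it in the same way. -/
theorem Frame.collapses (F : Frame n) {z : X} (hz : μ.act z F.p = z)
    (hσ : μ.act z (perm F.σ) = z) : Collapses μ z := by
  have hs : ∀ δ : Brauer n, rank δ = n % 2 → ∀ i,
      μ.act z (F.s i * δ) = μ.act z (F.s (i + 1) * δ) := by
    intro δ hδ i
    conv_lhs => rw [← hσ]
    rw [← act_mul, ← mul_assoc, F.σ_mul_s, mul_mul_of_rank_lt (F.rank_s_lt _) hδ]
  have hz' : ∀ δ : Brauer n, rank δ = n % 2 → μ.act z δ = μ.act z (F.s 0 * δ) := by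
    intro δ hδ
    obtain ⟨i, hi⟩ := F.exists_s_mul hδ
    conv_lhs => rw [← hz]
    rw [← act_mul, hi]
    have h0 := hs δ hδ 0
    have h1 := hs δ hδ 1
    fin_cases i
    · rfl
    · exact h0.symm
    · exact h1.symm.trans h0.symm
  intro α δ hδ
  rw [hz' _ (rank_mul_of_right hδ), hz' δ hδ, ← mul_assoc, mul_mul_of_rank_lt (F.rank_s_lt _) hδ]

/-- A faithful action has a point that is fixed by the projection of a given frame and does not
collapse; by `Frame.collapses`, the three-cycle of the frame moves this point. -/
theorem Frame.exists_not_collapses (F : Frame n) (hn : 3 ≤ n) (hμ : μ.IsFaithful) :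
    ∃ z, μ.act z F.p = z ∧ ¬ Collapses μ z := by
  by_contra! hcol
  refine not_forall_collapses hn hμ (collapses_of_critical fun p hp z hz => ?_)
  obtain ⟨π, hπ⟩ := exists_conj F.hp hp
  refine Collapses.of_perm (π := π⁻¹) (hcol _ ?_)
  rw [← star_perm, ← act_mul]
  conv_rhs => rw [← hz, ← hπ]
  rw [← act_mul, mul_assoc, mul_assoc, perm_mul_star, mul_one]

theorem Frame.σ_σ_σ (F : Frame n) : F.σ * F.σ * F.σ = 1 := by
  ext1 j
  simp only [Equiv.Perm.mul_apply, Equiv.Perm.one_apply]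
  by_cases hj : j ∈ Set.range F.v
  · obtain ⟨i, rfl⟩ := hj
    rw [σ_apply, σ_apply, σ_apply]
    congr 1
    revert i
    decide
  · have : F.σ j = j := Equiv.Perm.viaFintypeEmbedding_apply_notMem_range _ _ hj
    rw [this, this, this]

/-- A point that does not collapse has an orbit of size three under the three-cycle of a frame, and
does not come from ranks below the critical one. -/
theorem ncard_below_critical_add_le [Finite X] (hn : 3 ≤ n) (hμ : μ.IsFaithful) :
    (below μ (4 - n % 2)).ncard + 3 * (projections n (4 - n % 2)).ncard ≤ Nat.card X := by
  obtain ⟨F⟩ := Frame.nonempty hn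
  obtain ⟨z, hz, hcol⟩ := F.exists_not_collapses hn hμ
  have h1 : μ.act z (perm F.σ) ≠ z := fun h => hcol (F.collapses hz h)
  have h3 : μ.act (μ.act (μ.act z (perm F.σ)) (perm F.σ)) (perm F.σ) = z := by
    rw [← act_mul, ← act_mul, ← mul_assoc, ← perm_mul, ← perm_mul, F.σ_σ_σ, perm_one, ← hz,
      ← act_mul, mul_one]
  have hfix : ∀ {x}, μ.act x F.p = x → μ.act (μ.act x (perm F.σ)) F.p = μ.act x (perm F.σ) := by
    intro x hx
    rw [← act_mul, ← F.p_mul_σ, act_mul, hx]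
  have hz' : z ∉ below μ (4 - n % 2) := fun h => hcol (collapses_of_mem_below h)
  have hb : ∀ {x}, μ.act x F.p = x → x ∉ below μ (4 - n % 2) →
      μ.act x (perm F.σ) ∉ below μ (4 - n % 2) :=
    fun hx hx' h => hx' (act_perm_mem_below μ hx h)
  refine (ncard_below_add_le μ (by omega) F.hp
    ![z, μ.act z (perm F.σ), μ.act (μ.act z (perm F.σ)) (perm F.σ)] ?_ ?_ ?_).trans
    (Set.ncard_le_card _)
  · have h2 : μ.act (μ.act z (perm F.σ)) (perm F.σ) ≠ z := fun h => h1 (by rwa [h] at h3)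
    have h4 : μ.act (μ.act z (perm F.σ)) (perm F.σ) ≠ μ.act z (perm F.σ) :=
      fun h => h2 (by rwa [h] at h3)
    intro i j h
    fin_cases i <;> fin_cases j
    · rfl
    · exact absurd h.symm h1
    · exact absurd h.symm h2
    · exact absurd h h1
    · rfl
    · exact absurd h.symm h4
    · exact absurd h h2
    · exact absurd h h4
    · rfl
  · intro i
    fin_cases i
    · exact hz
    · exact hfix hz
    · exact hfix (hfix hz)
  · intro i
    fin_cases i
    · exact hz'
    · exact hb hz hz'
    · exact hb (hfix hz) (hb hz hz')

/-- For even `n`, the two elements of a group `H`-class of rank two can only be separated by points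
that do not come from rank zero. -/
theorem ncard_below_two_add_le [Finite X] (hn : 3 ≤ n) (hn2 : n % 2 = 0) (hμ : μ.IsFaithful) :
    (below μ 2).ncard + 2 * (projections n 2).ncard ≤ (below μ 3).ncard := by
  obtain ⟨p, hp⟩ := projections_nonempty (n := n) (r := 2) (by omega) (by omega)
  obtain ⟨u, v, hu, hv, huv⟩ := (Set.one_lt_ncard_iff (Set.toFinite (dom p))).1
    (show 1 < (dom p).ncard from Nat.lt_of_lt_of_eq one_lt_two hp.2.symm)
  set τ := Equiv.swap u v
  have hcomm : p * perm τ = perm τ * p := mul_perm_comm hp.1 fun i hi =>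
    Equiv.swap_apply_of_ne_of_ne (fun h => hi (h ▸ hu)) (fun h => hi (h ▸ hv))
  have hne : p ≠ p * perm τ := by
    intro h
    have h1 : Tr (p * perm τ) u v :=
      tr_mul (tr_of_mem_dom hp.1 hu) (by simpa [τ] using tr_perm τ v)
    exact huv ((tr_of_mem_dom hp.1 hu).unique (h ▸ h1))
  obtain ⟨x, hx⟩ : ∃ x, μ.act x p ≠ μ.act x (p * perm τ) := by
    by_contra! h
    exact hne (hμ _ _ h)
  rw [act_mul] at hx
  set z := μ.act x p
  have hz : μ.act z p = z := by rw [← act_mul, hp.1.isIdempotentElem.eq]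
  have hττ : μ.act (μ.act z (perm τ)) (perm τ) = z := by
    rw [← act_mul, ← perm_mul, Equiv.swap_mul_self, perm_one, ← hz, ← act_mul, mul_one]
  have hfix : μ.act (μ.act z (perm τ)) p = μ.act z (perm τ) := by
    rw [← act_mul, ← hcomm, act_mul, hz]
  have hzb : z ∉ below μ 2 := by
    rintro ⟨y, α, hα, h⟩
    have hα0 : rank α = n % 2 := by
      have := rank_mod_two α
      omega
    apply hx
    rw [← hfix, ← h, ← act_mul, ← act_mul, ← mul_assoc,
      mul_mul_of_rank_lt' (by rw [hp.2]; omega) hα0, act_mul, h, hz]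
  refine ncard_below_add_le μ le_rfl hp ![z, μ.act z (perm τ)] ?_ ?_ ?_
  · intro i j h
    fin_cases i <;> fin_cases j
    · rfl
    · exact absurd h hx
    · exact absurd h.symm hx
    · rfl
  · intro i
    fin_cases i
    · exact hz
    · exact hfix
  · intro i
    fin_cases i
    · exact hzb
    · exact fun h => hzb (act_perm_mem_below μ hz h)

/-- The right action on the minimal ideal is rigid: any two distinct minimal projections are moved
to projections over a frame that are still distinct. -/
theorem Frame.exists_separating (F : Frame n) (hn : 3 ≤ n) {ζ q q' : Brauer n}
    (hζ : rank ζ = n % 2) (hq : q ∈ projections n (n % 2)) (hq' : q' ∈ projections n (n % 2))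
    (hne : q ≠ q') : ∃ γ i j, i ≠ j ∧ ζ * q * γ = ζ * F.s i ∧ ζ * q' * γ = ζ * F.s j := by
  suffices h : ∃ π : Equiv.Perm (Fin n),
      ζ * q * (perm π * F.p) ≠ ζ * q' * (perm π * F.p) by
    obtain ⟨π, h⟩ := h
    have key : ∀ q : Brauer n, ∃ i, ζ * q * (perm π * F.p) = ζ * F.s i := by
      intro q
      obtain ⟨i, hi⟩ := F.exists_mul_s (δ := ζ * (q * perm π)) (rank_mul_of_left hζ)
      refine ⟨i, ?_⟩
      rw [← mul_assoc, mul_assoc ζ, hi, mul_mul_of_rank_lt' (F.rank_s_lt i) hζ]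
    obtain ⟨i, hi⟩ := key q
    obtain ⟨j, hj⟩ := key q'
    refine ⟨_, i, j, ?_, hi, hj⟩
    rintro rfl
    exact h (hi.trans hj.symm)
  -- Let `j` lie in a hook of `q` that is not one of `q'`. The permutation carries the first two
  -- vertices of the frame to this hook, and the third to the end `c` of the hook of `q'` at `j` (to
  -- any other vertex if there is none), so that only one of the products joins the first two.
  have aux : ∀ {q q' : Brauer n}, q ∈ projections n (n % 2) → q' ∈ projections n (n % 2) →
      ∀ j, hookPerm q j ≠ j → hookPerm q' j ≠ hookPerm q j →
      ∃ π : Equiv.Perm (Fin n), ζ * q * (perm π * F.p) ≠ ζ * q' * (perm π * F.p) := by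
    intro q q' hq hq' j hj hj'
    obtain ⟨c, hcj, hcq, hc⟩ : ∃ c, c ≠ j ∧ c ≠ hookPerm q j ∧
        (hookPerm q' j = j ∨ c = hookPerm q' j) := by
      by_cases h : hookPerm q' j = j
      · obtain ⟨c, -, hc⟩ := Set.exists_mem_notMem_of_ncard_lt_ncard
          (s := {j, hookPerm q j}) (t := Set.univ)
          (by
            rw [Set.ncard_univ, Nat.card_fin]
            exact (Set.ncard_insert_le _ _).trans_lt (by rw [Set.ncard_singleton]; omega))
        simp only [Set.mem_insert_iff, Set.mem_singleton_iff, not_or] at hc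
        exact ⟨c, hc.1, hc.2, .inl h⟩
      · exact ⟨_, h, hj', .inr rfl⟩
    have hw : Function.Injective ![j, hookPerm q j, c] := by
      intro a b h
      fin_cases a <;> fin_cases b
      · rfl
      · exact absurd h.symm hj
      · exact absurd h.symm hcj
      · exact absurd h hj
      · rfl
      · exact absurd h.symm hcq
      · exact absurd h hcj
      · exact absurd h hcq
      · rfl
    have := Equiv.Perm.isMultiplyPretransitive (Fin n) 3
    obtain ⟨π, hπ⟩ := MulAction.exists_smul_eq (Equiv.Perm (Fin n)) F.v
      (⟨_, hw⟩ : Fin 3 ↪ Fin n)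
    have hπ' : ∀ i, π (F.v i) = ![j, hookPerm q j, c] i := fun i => DFunLike.congr_fun hπ i
    have ht : ∀ i, Tr (perm π * F.p) (![j, hookPerm q j, c] i) (F.v i) := fun i =>
      tr_mul (hπ' i ▸ tr_perm π (F.v i)) (tr_of_mem_dom F.hp.1 (F.mem_dom i))
    refine ⟨π, fun h => ?_⟩
    have h1 : Lo (ζ * q * (perm π * F.p)) (F.v 0) (F.v 1) :=
      lo_mul (ht 0) (Lo.mul ((lo_iff_up hq.1).2 (up_hookPerm q j))) (ht 1)
    rw [h] at h1
    have hv : F.v 1 ≠ F.v 0 := (F.v_ne 0).symm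
    rcases hc with hc | hc
    · have h2 : star (ζ * q') * (ζ * q') = q' := by
        have := mul_star_eq_of_rank hq'.1 (α := star (ζ * q'))
          (by rw [star_mul, hq'.1.isSelfAdjoint.star_eq, ← mul_assoc, hq'.1.isIdempotentElem.eq])
          (by rw [hq'.2, rank_star, rank_mul_of_left hζ])
        rwa [star_star] at this
      have h3 : j ∈ dom (star (ζ * q')) := by
        have := dom_mul_star (star (ζ * q'))
        rw [star_star, h2] at this
        rw [← this]
        exact hookPerm_apply_eq_iff.1 hc
      obtain ⟨k, hk⟩ := h3
      exact hv ((tr_mul (tr_star.1 hk) (ht 0)).not_lo h1)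
    · have h2 : Lo (ζ * q' * (perm π * F.p)) (F.v 0) (F.v 2) :=
        lo_mul (ht 0) (Lo.mul ((lo_iff_up hq'.1).2 (up_iff.2 (.inr hc)))) (ht 2)
      exact absurd (F.v.injective (h1.unique h2 hv (F.v_ne' 0).symm)) (by decide)
  obtain ⟨j, hj⟩ : ∃ j, hookPerm q j ≠ hookPerm q' j := by
    by_contra! h
    exact hne (proj_ext_hookPerm hq.1 hq'.1 (Equiv.ext h))
  by_cases h : hookPerm q j = j
  · obtain ⟨π, hπ⟩ := aux hq' hq j (fun h' => hj (h.trans h'.symm)) hj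
    exact ⟨π, hπ.symm⟩
  · exact aux hq hq' j h hj.symm

/-- The part of a faithful action reached by the minimal ideal has an orbit that is isomorphic to
the set of minimal projections, and further points since otherwise all points would collapse. -/
theorem ncard_projections_lt_ncard_below [Finite X] (hn : 3 ≤ n) (hμ : μ.IsFaithful) :
    (projections n (n % 2)).ncard + 1 ≤ (below μ (n % 2 + 1)).ncard := by
  obtain ⟨F⟩ := Frame.nonempty hn
  obtain ⟨ζ, -, hζ⟩ := projections_minimal_nonempty hn
  have hne : ζ * F.s 0 ≠ ζ * F.s 1 := fun h => absurd (F.mul_s_injective h) (by decide)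
  obtain ⟨x, hx⟩ : ∃ x, μ.act x (ζ * F.s 0) ≠ μ.act x (ζ * F.s 1) := by
    by_contra! h
    exact hne (hμ _ _ h)
  have hstep : ∀ i j, μ.act x (ζ * F.s (i + 1)) = μ.act x (ζ * F.s (j + 1)) →
      μ.act x (ζ * F.s i) = μ.act x (ζ * F.s j) := by
    intro i j h
    have key : ∀ i, ζ * F.s (i + 1) * perm F.σ = ζ * F.s i := fun i => by
      rw [mul_assoc, ← F.σ_mul_s, ← mul_assoc, mul_mul_of_rank_lt' (F.rank_s_lt i) hζ]
    rw [← key i, ← key j, act_mul, h, ← act_mul]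
  have hinj : ∀ i j, i ≠ j → μ.act x (ζ * F.s i) ≠ μ.act x (ζ * F.s j) := by
    have h01 : ∀ i, μ.act x (ζ * F.s i) ≠ μ.act x (ζ * F.s (i + 1)) := by
      intro i h
      fin_cases i
      · exact hx h
      · exact hx (hstep 0 1 h)
      · exact hx (hstep 0 1 (hstep 1 2 h))
    intro i j hij h
    rcases Frame.eq_add_one_or hij.symm with rfl | rfl
    · exact h01 _ h
    · exact h01 _ h.symm
  set Y : Set X := (fun q => μ.act x (ζ * q)) '' projections n (n % 2) with hY
  have hYcard : Y.ncard = (projections n (n % 2)).ncard := by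
    refine Set.InjOn.ncard_image fun q hq q' hq' h => ?_
    by_contra hqq
    obtain ⟨γ, i, j, hij, h1, h2⟩ := F.exists_separating hn hζ hq hq' hqq
    refine hinj i j hij ?_
    rw [← h1, ← h2, act_mul, act_mul _ _ (ζ * q')]
    exact congrArg (fun x => μ.act x γ) h
  have hYb : Y ⊆ below μ (n % 2 + 1) := by
    rintro _ ⟨q, hq, rfl⟩
    exact ⟨x, ζ * q, by rw [rank_mul_of_left hζ]; omega, rfl⟩
  have hssub : Y ⊂ below μ (n % 2 + 1) := by
    refine hYb.ssubset_of_ne fun hYe => not_forall_collapses hn hμ ?_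
    have key : ∀ z (δ : Brauer n), rank δ = n % 2 →
        μ.act z δ = μ.act x (ζ * (star δ * δ)) := by
      intro z δ hδ
      have : μ.act z δ ∈ Y := hYe ▸ ⟨z, δ, by omega, rfl⟩
      obtain ⟨q, -, hq⟩ := this
      have hδ' : rank (star δ * δ) = n % 2 := (rank_star_mul δ).trans hδ
      rw [← mul_mul_of_minimal hζ hδ' q, act_mul _ _ (ζ * q), show μ.act x (ζ * q) = _ from hq,
        ← act_mul, mul_star_mul']
    intro z α δ hδ
    have h1 : μ.act z (α * δ) = μ.act z (α * δ * (star δ * δ)) := by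
      rw [mul_assoc, mul_star_mul']
    rw [h1, act_mul, key z _ (rank_mul_of_right hδ), key z δ hδ, ← act_mul,
      mul_mul_of_minimal hζ ((rank_star_mul δ).trans hδ)]
  have := Set.ncard_lt_ncard hssub (Set.toFinite _)
  omega

end Actions

end Brauer

/-! ### Representations from labellings -/

section Labelling

/-- A family of labellings of a monoid `S` whose kernels are right congruences, and for which the
elements without a label form a right ideal. -/
structure Labelling (S ι A : Type*) [Monoid S] where
  label : ι → S → Option A
  mul_right : ∀ {i a b} (c : S), label i a = label i b → label i (a * c) = label i (b * c)
  none_mul : ∀ {i a} (c : S), label i a = none → label i (a * c) = none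

namespace Labelling

variable {S ι A : Type*} [Monoid S] (ℓ : Labelling S ι A)

/-- The set of labels that occur. -/
def points : Set (ι × A) := {x | ∃ s, ℓ.label x.1 s = some x.2}

/-- A labelling is faithful if the right translations of `S` act on labels faithfully. -/
def IsFaithful : Prop := ∀ a b, (∀ i s, ℓ.label i (s * a) = ℓ.label i (s * b)) → a = b

open Classical in
/-- The point labelling an element. -/
noncomputable def point (i : ι) (s : S) : Option ℓ.points :=
  if h : ∃ y, ℓ.label i s = some y then some ⟨(i, h.choose), s, h.choose_spec⟩ else none

theorem point_eq_none {i : ι} {s : S} : ℓ.point i s = none ↔ ℓ.label i s = none := by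
  rw [point, Option.eq_none_iff_forall_ne_some]
  split_ifs with h
  · obtain ⟨y, hy⟩ := h
    simp [hy]
  · rw [Option.eq_none_iff_forall_ne_some]
    simpa using h

theorem point_eq_some {i : ι} {s : S} {x : ℓ.points} :
    ℓ.point i s = some x ↔ x.1.1 = i ∧ ℓ.label i s = some x.1.2 := by
  rw [point]
  split_ifs with h
  · have := h.choose_spec
    constructor
    · intro h'
      rw [Option.some_inj] at h'
      rw [← h']
      exact ⟨rfl, this⟩
    · rintro ⟨h1, h2⟩
      rw [Option.some_inj]
      refine Subtype.ext (Prod.ext h1.symm ?_)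
      rw [this, Option.some_inj] at h2
      exact h2
  · simp only [false_iff, not_and]
    exact fun _ h' => h ⟨_, h'⟩

theorem point_eq_point {i : ι} {s t : S} :
    ℓ.point i s = ℓ.point i t ↔ ℓ.label i s = ℓ.label i t := by
  cases h : ℓ.point i t with
  | none => rw [point_eq_none, ℓ.point_eq_none.1 h]
  | some x =>
    obtain ⟨h1, h2⟩ := ℓ.point_eq_some.1 h
    rw [point_eq_some, h2]
    exact ⟨fun h => h.2, fun h => ⟨h1, h⟩⟩

/-- The partial transformations of the labels induced by the right translations of `S`. -/
noncomputable def partialAction (a : S) : PartialTransformation ℓ.points :=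
  fun x => ℓ.point x.1.1 (x.2.choose * a)

theorem point_bind (i : ι) (s a : S) :
    (ℓ.point i s).bind (ℓ.partialAction a) = ℓ.point i (s * a) := by
  cases h : ℓ.point i s with
  | none =>
    exact (ℓ.point_eq_none.2 (ℓ.none_mul a (ℓ.point_eq_none.1 h))).symm
  | some x =>
    obtain ⟨rfl, h2⟩ := ℓ.point_eq_some.1 h
    exact ℓ.point_eq_point.2 (ℓ.mul_right a (x.2.choose_spec.trans h2.symm))

theorem exists_partialTransformation (hℓ : ℓ.IsFaithful) :
    ∃ f : S →ₙ* PartialTransformation ℓ.points, Function.Injective f := by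
  refine ⟨⟨ℓ.partialAction, fun a b => funext fun x => ?_⟩, fun a b h => hℓ a b fun i s => ?_⟩
  · change ℓ.point _ _ = (ℓ.point _ _).bind (ℓ.partialAction b)
    rw [point_bind, mul_assoc]
  · rw [← point_eq_point, ← point_bind, ← point_bind, show ℓ.partialAction a = _ from h]
    rfl

end Labelling

/-- The right congruence given by a single labelling. -/
def Labelling.rightCongruence {S A : Type*} [Monoid S] (ℓ : Labelling S Unit A) :
    RightCongruence S where
  toSetoid := Setoid.ker (ℓ.label ())
  mul_right c h := ℓ.mul_right c h

theorem Labelling.action_isFaithful {S A : Type*} [Monoid S] {ℓ : Labelling S Unit A}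
    (hℓ : ℓ.IsFaithful) : ℓ.rightCongruence.action.IsFaithful := fun a b h =>
  hℓ a b fun _ s => Quotient.exact (h (Quotient.mk _ s))

theorem Labelling.card_quotient_le {S A : Type*} [Monoid S] (ℓ : Labelling S Unit A)
    (hfin : ℓ.points.Finite) : Finite (Quotient ℓ.rightCongruence.toSetoid) ∧
      Nat.card (Quotient ℓ.rightCongruence.toSetoid) ≤ ℓ.points.ncard + 1 := by
  have : Finite ℓ.points := hfin
  let f : Quotient ℓ.rightCongruence.toSetoid → Option ℓ.points :=
    Quotient.lift (ℓ.point ()) fun a b h => ℓ.point_eq_point.2 h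
  have hf : Function.Injective f := by
    rintro ⟨a⟩ ⟨b⟩ h
    exact Quotient.sound (ℓ.point_eq_point.1 h)
  refine ⟨Finite.of_injective f hf, (Nat.card_le_card_of_injective f hf).trans ?_⟩
  rw [Finite.card_option, Nat.card_coe_set_eq]

end Labelling

/-! ### Comparison of the degrees -/

section Degrees

variable {S : Type*} [Semigroup S]

theorem exists_partialTransformation_fin {T : Type*} {m : ℕ} (e : T ≃ Fin m)
    (h : ∃ f : S →ₙ* PartialTransformation T, Function.Injective f) :
    ∃ f : S →ₙ* PartialTransformation (Fin m), Function.Injective f := by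
  obtain ⟨f, hf⟩ := h
  refine ⟨⟨fun a x => (f a (e.symm x)).map e, fun a b => funext fun x => ?_⟩, fun a b h => hf ?_⟩
  · rw [map_mul]
    change Option.map e (Option.bind _ _) = Option.bind (Option.map _ _) _
    cases h : f a (e.symm x) with
    | none => rfl
    | some y =>
      simp
      rfl
  · refine funext fun x => Option.map_injective e.injective ?_
    have := congrFun h (e x)
    change (f a (e.symm (e x))).map e = (f b (e.symm (e x))).map e at this
    rwa [e.symm_apply_apply] at this

theorem exists_transformation_fin {T : Type*} {m : ℕ} (e : Option T ≃ Fin m)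
    (h : ∃ f : S →ₙ* PartialTransformation T, Function.Injective f) :
    ∃ f : S →ₙ* FullTransformation (Fin m), Function.Injective f := by
  obtain ⟨f, hf⟩ := h
  refine ⟨⟨fun a x => e ((e.symm x).bind (f a)), fun a b => funext fun x => ?_⟩, fun a b h => hf ?_⟩
  · rw [map_mul]
    change e (Option.bind _ _) = e (Option.bind (e.symm (e _)) _)
    rw [e.symm_apply_apply]
    cases e.symm x with
    | none => rfl
    | some y => rfl
  · refine funext fun x => e.injective ?_
    have := congrFun h (e (some x))
    change e ((e.symm (e (some x))).bind (f a)) = e ((e.symm (e (some x))).bind (f b)) at this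
    rwa [e.symm_apply_apply] at this

/-- The action of a semigroup of transformations. -/
def transformationAction {T : Type*} (f : S →ₙ* FullTransformation T) : RightAction T S where
  act x a := f a x
  act_act x a b := by
    rw [map_mul]
    rfl

theorem transformationAction_isFaithful {T : Type*} {f : S →ₙ* FullTransformation T}
    (hf : Function.Injective f) : (transformationAction f).IsFaithful :=
  fun _ _ h => hf (funext h)

/-- A bound for faithful total actions bounds faithful partial actions, since a partial action
becomes total when a sink is added. -/
theorem le_of_partialTransformation {N m : ℕ}
    (hlow : ∀ m (μ : RightAction (Fin m) S), μ.IsFaithful → N + 1 ≤ m)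
    (h : ∃ f : S →ₙ* PartialTransformation (Fin m), Function.Injective f) : N ≤ m := by
  have e : Option (Fin m) ≃ Fin (m + 1) := (finSuccEquiv m).symm
  obtain ⟨f, hf⟩ := exists_transformation_fin e h
  have := hlow _ _ (transformationAction_isFaithful hf)
  omega

theorem RightAction.exists_fin {X : Type*} [Finite X] {σ : RightCongruence S}
    (hσ : σ.action.IsFaithful) (e : X ≃ Quotient σ.toSetoid) :
    ∃ μ : RightAction (Fin (Nat.card X)) S, μ.IsFaithful ∧ μ.IsRightCongruenceAction := by
  let e' := (Finite.equivFin X).symm.trans e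
  refine ⟨⟨fun x a => e'.symm (σ.action.act (e' x) a), fun x a b => ?_⟩, fun a b h => ?_, σ, e', ?_⟩
  · rw [e'.apply_symm_apply, σ.action.act_act]
  · refine hσ a b fun x => e'.symm.injective ?_
    simpa using h (e'.symm x)
  · intro x a
    exact e'.apply_symm_apply _

end Degrees

section LabellingDegrees

variable {S ι A : Type*} [Monoid S] {N : ℕ}

theorem Labelling.ncard_points_eq {ℓ : Labelling S ι A} (hℓ : ℓ.IsFaithful)
    (hlow : ∀ m (μ : RightAction (Fin m) S), μ.IsFaithful → N + 1 ≤ m)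
    (hfin : ℓ.points.Finite) (hcard : ℓ.points.ncard ≤ N) : ℓ.points.ncard = N := by
  have : Finite ℓ.points := hfin
  refine hcard.antisymm (le_of_partialTransformation hlow ?_)
  rw [← Nat.card_coe_set_eq]
  exact exists_partialTransformation_fin (Finite.equivFin _) (ℓ.exists_partialTransformation hℓ)

/-- A faithful labelling with at most `N` labels computes the degrees, if no faithful action has
fewer than `N + 1` points. -/
theorem Labelling.partialTransformationDegree_eq {ℓ : Labelling S ι A} (hℓ : ℓ.IsFaithful)
    (hlow : ∀ m (μ : RightAction (Fin m) S), μ.IsFaithful → N + 1 ≤ m)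
    (hfin : ℓ.points.Finite) (hcard : ℓ.points.ncard ≤ N) (hN : 1 ≤ N) :
    partialTransformationDegree S = N := by
  have : Finite ℓ.points := hfin
  refine IsLeast.csInf_eq ⟨⟨hN, ?_⟩, fun m hm => le_of_partialTransformation hlow hm.2⟩
  rw [← ℓ.ncard_points_eq hℓ hlow hfin hcard, ← Nat.card_coe_set_eq]
  exact exists_partialTransformation_fin (Finite.equivFin _) (ℓ.exists_partialTransformation hℓ)

theorem Labelling.transformationDegree_eq {ℓ : Labelling S ι A} (hℓ : ℓ.IsFaithful)
    (hlow : ∀ m (μ : RightAction (Fin m) S), μ.IsFaithful → N + 1 ≤ m)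
    (hfin : ℓ.points.Finite) (hcard : ℓ.points.ncard ≤ N) :
    transformationDegree S = N + 1 := by
  have : Finite ℓ.points := hfin
  refine IsLeast.csInf_eq ⟨⟨Nat.le_add_left _ _, ?_⟩, ?_⟩
  · rw [← ℓ.ncard_points_eq hℓ hlow hfin hcard, ← Nat.card_coe_set_eq, ← Finite.card_option]
    exact exists_transformation_fin (Finite.equivFin _) (ℓ.exists_partialTransformation hℓ)
  · rintro m ⟨-, f, hf⟩
    exact hlow m _ (transformationAction_isFaithful hf)

theorem Labelling.rightCongruenceDegree_eq {ℓ : Labelling S Unit A} (hℓ : ℓ.IsFaithful)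
    (hlow : ∀ m (μ : RightAction (Fin m) S), μ.IsFaithful → N + 1 ≤ m)
    (hfin : ℓ.points.Finite) (hcard : ℓ.points.ncard ≤ N) :
    rightCongruenceDegree S = N + 1 := by
  obtain ⟨hQ, hQcard⟩ := ℓ.card_quotient_le hfin
  obtain ⟨μ, hμ, hμ'⟩ := RightAction.exists_fin (Labelling.action_isFaithful hℓ) (Equiv.refl _)
  have h := hlow _ μ hμ
  refine IsLeast.csInf_eq ⟨⟨Nat.le_add_left _ _, ?_⟩, fun m hm => ?_⟩
  · have : N + 1 = Nat.card (Quotient ℓ.rightCongruence.toSetoid) := by omega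
    rw [this]
    exact ⟨μ, hμ, hμ'⟩
  · obtain ⟨-, ν, hν, -⟩ := hm
    exact hlow m ν hν

end LabellingDegrees

namespace Brauer

variable {n : ℕ}

/-! ### The labelling at the critical rank -/

theorem mul_star_mul_star_of_eq {γ δ : Brauer n} (h : star γ * γ = star δ * δ) :
    γ * star δ * star (γ * star δ) = γ * star γ := by
  rw [star_mul, star_star, mul_assoc, ← mul_assoc (star δ), ← h, star_mul_star]

theorem star_mul_mul_mul (γ c : Brauer n) :
    star (γ * c) * (γ * c) = star c * (star γ * γ) * c := by
  rw [star_mul]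
  simp only [mul_assoc]

namespace Frame

variable (F : Frame n)

theorem exists_κ (hn : 3 ≤ n) : ∃ κ ∈ projections n (n % 2), F.s 0 * κ = κ := by
  obtain ⟨δ, -, hδ⟩ := projections_minimal_nonempty hn
  have h : rank (F.s 0 * δ) = n % 2 := rank_mul_of_right hδ
  refine ⟨_, ⟨isStarProjection_mul_star (F.s 0 * δ), (rank_mul_star _).trans h⟩, ?_⟩
  rw [← mul_assoc, ← mul_assoc, (F.isStarProjection_s 0).isIdempotentElem.eq]

variable {F} {κ : Brauer n}

theorem p_mul_κ (hκ' : F.s 0 * κ = κ) : F.p * κ = κ := by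
  rw [← hκ', ← mul_assoc, F.p_mul_s]

theorem κ_mul_p (hκ : κ ∈ projections n (n % 2)) (hκ' : F.s 0 * κ = κ) : κ * F.p = κ := by
  have := congrArg star (p_mul_κ hκ')
  rwa [star_mul, hκ.1.isSelfAdjoint.star_eq, F.hp.1.isSelfAdjoint.star_eq] at this

/-- An element is good for `κ` if its upper hooks are compatible with those of `κ`. -/
def IsGood (κ γ : Brauer n) : Prop := γ * star γ * κ = κ

theorem IsGood.of_mul {γ α : Brauer n} (h : IsGood κ (γ * α)) : IsGood κ γ := by
  have h' : γ * α * star (γ * α) * κ = κ := h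
  change γ * star γ * κ = κ
  conv_lhs => rw [← h']
  conv_rhs => rw [← h']
  simp only [← mul_assoc, mul_star_mul]

theorem IsGood.mul_of_rank_lt {γ : Brauer n} (hκ : rank κ = n % 2) (h : IsGood κ γ)
    (hγ : rank γ < 4 - n % 2) (α : Brauer n) : IsGood κ (γ * α) := by
  have h' : γ * star γ * κ = κ := h
  change γ * α * star (γ * α) * κ = κ
  have := mul_mul_of_rank_lt ((rank_mul_star γ).trans_lt hγ) hκ (γ * α * star (γ * α))
  rw [h'] at this
  conv_rhs => rw [← this]
  simp only [← mul_assoc, mul_star_mul]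

theorem isGood_of_s_mul {X : Brauer n} (hκ : rank κ = n % 2) (hκ' : F.s 0 * κ = κ) :
    IsGood κ (F.s 0 * X) := by
  change F.s 0 * X * star (F.s 0 * X) * κ = κ
  rw [mul_assoc (F.s 0), mul_mul_of_rank_lt (F.rank_s_lt 0) hκ, hκ']

theorem isGood_of_rank_eq {γ : Brauer n} (hκ' : F.s 0 * κ = κ) (h : F.p * γ = γ)
    (hr : rank γ = rank F.p) : IsGood κ γ := by
  change γ * star γ * κ = κ
  rw [mul_star_eq_of_rank F.hp.1 h hr.ge, p_mul_κ hκ']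

theorem not_isGood {γ : Brauer n} (hκ' : F.s 0 * κ = κ) {x : Fin n} (hx : x ≠ F.v 0)
    (hx' : x ≠ F.v 1) (h : Up γ (F.v 0) x) : ¬ IsGood κ γ := by
  intro hg
  have hg : γ * star γ * κ = κ := hg
  have h1 : Up (γ * star γ * κ) (F.v 0) x := Up.mul (Up.mul h)
  have h2 : Up (F.s 0 * κ) (F.v 0) (F.v 1) := (F.up_s 0).mul
  rw [hg] at h1
  rw [hκ'] at h2
  exact hx' (h1.unique h2 hx (F.v_ne 0).symm)

open Classical in
/-- The label of `α` with respect to a frame `F` and a minimal projection `κ`. There is none unless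
`F.p * α` is good for `κ`. If it is good, then the label consists of `κ * α` and, provided that
`F.p * α` has the same rank as `F.p`, of the projection with the lower hooks of `F.p * α`. -/
noncomputable def label (F : Frame n) (κ α : Brauer n) : Option (Brauer n × Option (Brauer n)) :=
  if IsGood κ (F.p * α) then
    some (κ * α, if rank (F.p * α) = rank F.p then some (star (F.p * α) * (F.p * α)) else none)
  else none

theorem label_eq_none {α : Brauer n} : F.label κ α = none ↔ ¬ IsGood κ (F.p * α) := by
  rw [label]
  split_ifs with h <;> simp [h]

theorem label_none_mul {α : Brauer n} (c : Brauer n) (h : F.label κ α = none) :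
    F.label κ (α * c) = none := by
  rw [label_eq_none] at h ⊢
  rw [← mul_assoc]
  exact fun h' => h h'.of_mul

/-- If `α` and `β` have the same label with a second entry, then `F.p * α` and `F.p * β` differ by a
left factor `g` such that `g` and `star g` fix `κ`; this is what makes the kernel of the labelling a right congruence. -/
theorem exists_eq_mul (hκ : κ ∈ projections n (n % 2)) (hκ' : F.s 0 * κ = κ) {α β : Brauer n}
    (h : κ * α = κ * β) (hα : rank (F.p * α) = rank F.p) (hβ : rank (F.p * β) = rank F.p)
    (hαβ : star (F.p * α) * (F.p * α) = star (F.p * β) * (F.p * β)) :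
    ∃ g, F.p * α = g * (F.p * β) ∧ g * κ = κ ∧ star g * κ = κ := by
  have hpp := F.hp.1.isIdempotentElem.eq
  have eα : F.p * α * star (F.p * α) = F.p :=
    mul_star_eq_of_rank F.hp.1 (by rw [← mul_assoc, hpp]) hα.ge
  have eβ : F.p * β * star (F.p * β) = F.p :=
    mul_star_eq_of_rank F.hp.1 (by rw [← mul_assoc, hpp]) hβ.ge
  have hκp := κ_mul_p hκ hκ'
  set γ := F.p * α
  set δ := F.p * β
  have hκγ : κ * γ = κ * δ := by
    simp only [γ, δ, ← mul_assoc, hκp, h]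
  have h1 : star (γ * star δ) * κ = κ := by
    have : κ * (γ * star δ) = κ := by rw [← mul_assoc, hκγ, mul_assoc, eβ, hκp]
    have := congrArg star this
    rwa [star_mul, hκ.1.isSelfAdjoint.star_eq] at this
  refine ⟨γ * star δ, ?_, ?_, h1⟩
  · rw [mul_assoc, ← hαβ, mul_star_mul']
  · conv_lhs => rw [← h1]
    rw [← mul_assoc, mul_star_mul_star_of_eq hαβ, eα, p_mul_κ hκ']

theorem IsGood.mul_left {g γ : Brauer n} (h : IsGood κ γ) (hg : g * κ = κ)
    (hg' : star g * κ = κ) : IsGood κ (g * γ) := by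
  have h : γ * star γ * κ = κ := h
  change g * γ * star (g * γ) * κ = κ
  rw [star_mul, mul_assoc, mul_assoc, mul_assoc, hg', ← mul_assoc γ, h, hg]

theorem label_mul_right (hκ : κ ∈ projections n (n % 2)) (hκ' : F.s 0 * κ = κ) {α β : Brauer n}
    (c : Brauer n) (h : F.label κ α = F.label κ β) :
    F.label κ (α * c) = F.label κ (β * c) := by
  by_cases hα : IsGood κ (F.p * α)
  swap
  · have h1 := label_eq_none.2 hα
    rw [label_none_mul c h1, label_none_mul c (h ▸ h1)]
  have hβ : IsGood κ (F.p * β) := by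
    by_contra hβ
    exact label_eq_none.1 (h.trans (label_eq_none.2 hβ)) hα
  rw [label, label, if_pos hα, if_pos hβ, Option.some_inj, Prod.mk.injEq] at h
  obtain ⟨h1, h2⟩ := h
  have hle : ∀ γ : Brauer n, rank γ ≠ rank F.p → rank γ ≤ rank F.p → rank γ < 4 - n % 2 :=
    fun γ h h' => F.hp.2 ▸ lt_of_le_of_ne h' h
  have hlt : ∀ γ : Brauer n, rank (F.p * γ) ≠ rank F.p →
      rank (F.p * (γ * c)) ≠ rank F.p := fun γ hγ h => by
    have h3 := rank_mul_le_left (F.p * γ) c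
    have h4 := rank_mul_le_left F.p γ
    rw [mul_assoc, h] at h3
    exact hγ (h4.antisymm h3)
  have h1c : κ * (α * c) = κ * (β * c) := by rw [← mul_assoc, h1, mul_assoc]
  by_cases hrα : rank (F.p * α) = rank F.p
  · by_cases hrβ : rank (F.p * β) = rank F.p
    · rw [if_pos hrα, if_pos hrβ, Option.some_inj] at h2
      have key : ∀ {α β : Brauer n}, κ * α = κ * β → rank (F.p * α) = rank F.p →
          rank (F.p * β) = rank F.p →
          star (F.p * α) * (F.p * α) = star (F.p * β) * (F.p * β) →
          (IsGood κ (F.p * (β * c)) → IsGood κ (F.p * (α * c))) ∧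
            rank (F.p * (α * c)) ≤ rank (F.p * (β * c)) := by
        intro α β h1 hα hβ h2
        obtain ⟨g, hg, hg1, hg2⟩ := exists_eq_mul hκ hκ' h1 hα hβ h2
        have e : F.p * (α * c) = g * (F.p * (β * c)) := by
          rw [← mul_assoc, hg, mul_assoc, mul_assoc F.p]
        rw [e]
        exact ⟨fun h => h.mul_left hg1 hg2, rank_mul_le_right _ _⟩
      obtain ⟨g1, r1⟩ := key h1 hrα hrβ h2
      obtain ⟨g2, r2⟩ := key h1.symm hrβ hrα h2.symm
      have hg : IsGood κ (F.p * (α * c)) ↔ IsGood κ (F.p * (β * c)) := ⟨g2, g1⟩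
      have hs : star (F.p * (α * c)) * (F.p * (α * c)) =
          star (F.p * (β * c)) * (F.p * (β * c)) := by
        rw [← mul_assoc F.p α, ← mul_assoc F.p β, star_mul_mul_mul (F.p * α),
          star_mul_mul_mul (F.p * β), h2]
      by_cases hgood : IsGood κ (F.p * (β * c))
      · rw [label, label, if_pos hgood, if_pos (hg.2 hgood), r1.antisymm r2, hs, h1c]
      · rw [label_eq_none.2 hgood, label_eq_none.2 (mt hg.1 hgood)]
    · rw [if_pos hrα, if_neg hrβ] at h2
      cases h2
  · by_cases hrβ : rank (F.p * β) = rank F.p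
    · rw [if_neg hrα, if_pos hrβ] at h2
      cases h2
    · have g1 := hα.mul_of_rank_lt hκ.2 (hle _ hrα (rank_mul_le_left _ _)) c
      have g2 := hβ.mul_of_rank_lt hκ.2 (hle _ hrβ (rank_mul_le_left _ _)) c
      rw [mul_assoc] at g1 g2
      rw [label, label, if_pos g1, if_pos g2, if_neg (hlt _ hrα), if_neg (hlt _ hrβ), h1c]

theorem label_κ_mul (hκ : κ ∈ projections n (n % 2)) (hκ' : F.s 0 * κ = κ) (α : Brauer n) :
    ∃ y, F.label κ (κ * α) = some (κ * α, y) := by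
  have hg : IsGood κ (F.p * (κ * α)) := by
    rw [← mul_assoc, p_mul_κ hκ']
    change κ * α * star (κ * α) * κ = κ
    rw [mul_assoc κ, mul_mul_of_minimal hκ.2 hκ.2, hκ.1.isIdempotentElem.eq]
  rw [label, if_pos hg]
  exact ⟨_, by rw [← mul_assoc, hκ.1.isIdempotentElem.eq]⟩

/-- The labels are of two kinds: those that stem from minimal projections, and three for each
projection of critical rank. -/
theorem ncard_label_le (hκ : κ ∈ projections n (n % 2)) (hκ' : F.s 0 * κ = κ) :
    {y | ∃ α, F.label κ α = some y}.ncard ≤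
      (projections n (n % 2)).ncard + 3 * (projections n (4 - n % 2)).ncard := by
  choose π hπ using fun q : projections n (4 - n % 2) => exists_conj F.hp q.2
  let f : Brauer n → Brauer n × Option (Brauer n) := fun q => (κ * q, none)
  let g : Fin 3 × projections n (4 - n % 2) → Brauer n × Option (Brauer n) :=
    fun a => (κ * F.s a.1 * perm (π a.2), some a.2)
  have hsub : {y | ∃ α, F.label κ α = some y} ⊆ f '' projections n (n % 2) ∪ Set.range g := by
    rintro y ⟨α, hα⟩
    rw [label] at hα
    split_ifs at hα with hg hr
    · right
      rw [Option.some_inj] at hα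
      let q : projections n (4 - n % 2) :=
        ⟨_, isStarProjection_star_mul (F.p * α), by rw [rank_star_mul, hr, F.hp.2]⟩
      have hκα : κ * α = κ * α * star (perm (π q)) * F.p * perm (π q) := by
        have e1 : κ * α * star (perm (π q)) * F.p * perm (π q) = κ * α * q := by
          rw [← hπ q]
          simp only [mul_assoc]
        have e2 : κ * α = κ * (F.p * α) := by rw [← mul_assoc, κ_mul_p hκ hκ']
        rw [e1, e2, mul_assoc, mul_star_mul']
      obtain ⟨i, hi⟩ := F.exists_mul_s (δ := κ * (α * star (perm (π q)))) (rank_mul_of_left hκ.2)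
      refine ⟨(i, q), ?_⟩
      rw [← hα, hκα, mul_assoc κ α, hi, mul_mul_of_rank_lt' (F.rank_s_lt i) hκ.2]
    · left
      rw [Option.some_inj] at hα
      have hr' : rank (κ * α) = n % 2 := rank_mul_of_left hκ.2
      refine ⟨star (κ * α) * (κ * α),
        ⟨isStarProjection_star_mul _, (rank_star_mul _).trans hr'⟩, ?_⟩
      rw [← hα]
      refine Prod.ext ?_ rfl
      change κ * (star (κ * α) * (κ * α)) = κ * α
      rw [← mul_mul_of_minimal hκ.2 ((rank_star_mul _).trans hr') α, mul_star_mul']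
  refine (Set.ncard_le_ncard hsub (Set.toFinite _)).trans ((Set.ncard_union_le _ _).trans ?_)
  refine Nat.add_le_add (Set.ncard_image_le (Set.toFinite _)) ?_
  rw [← Set.image_univ]
  refine (Set.ncard_image_le (Set.toFinite _)).trans ?_
  rw [Set.ncard_univ, Nat.card_prod, Nat.card_fin, Nat.card_coe_set_eq]

end Frame

/-! ### The labelling at rank two -/

open Classical in
/-- The label of `α` is `p * α` if this has the same rank as `p`, and there is none otherwise. The
second entry `none` only serves to give `rankLabel` the same type as `Frame.label`. -/
noncomputable def rankLabel (p α : Brauer n) : Option (Brauer n × Option (Brauer n)) :=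
  if rank (p * α) = rank p then some (p * α, none) else none

theorem rankLabel_eq_none {p α : Brauer n} : rankLabel p α = none ↔ rank (p * α) ≠ rank p := by
  rw [rankLabel]
  split_ifs with h <;> simp [h]

theorem rankLabel_none_mul {p α : Brauer n} (c : Brauer n) (h : rankLabel p α = none) :
    rankLabel p (α * c) = none := by
  rw [rankLabel_eq_none] at h ⊢
  intro h'
  have h1 := rank_mul_le_left (p * α) c
  rw [mul_assoc, h'] at h1
  exact h ((rank_mul_le_left p α).antisymm h1)

theorem rankLabel_mul_right {p α β : Brauer n} (c : Brauer n)
    (h : rankLabel p α = rankLabel p β) : rankLabel p (α * c) = rankLabel p (β * c) := by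
  by_cases hα : rank (p * α) = rank p
  · by_cases hβ : rank (p * β) = rank p
    · rw [rankLabel, rankLabel, if_pos hα, if_pos hβ, Option.some_inj, Prod.mk.injEq] at h
      rw [rankLabel, rankLabel, ← mul_assoc, h.1, mul_assoc]
    · exact absurd (h.trans (rankLabel_eq_none.2 hβ)) fun h => rankLabel_eq_none.1 h hα
  · have h1 := rankLabel_eq_none.2 hα
    rw [rankLabel_none_mul c h1, rankLabel_none_mul c (h ▸ h1)]

theorem eq_proj_of_tr {p h : Brauer n} (hp : IsStarProjection p) (h1 : p * h = h) (h2 : h * p = h)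
    (h3 : ∀ i ∈ dom p, Tr h i i) : h = p := by
  symm
  refine ext_partner ?_
  rintro (i | i)
  · rcases up_or_tr p i with ⟨j, hj, h⟩ | hi
    · exact ⟨.inl j, by simpa using hj, h, h1 ▸ h.mul⟩
    · exact ⟨.inr i, by simp, tr_of_mem_dom hp hi, h3 i hi⟩
  · rcases up_or_tr p i with ⟨j, hj, h⟩ | hi
    · exact ⟨.inr j, by simpa using hj, (lo_iff_up hp).2 h, h2 ▸ ((lo_iff_up hp).2 h).mul⟩
    · exact ⟨.inl i, by simp, (tr_of_mem_dom hp hi).symm, (h3 i hi).symm⟩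

/-- The group `H`-class of a projection of rank two has two elements. -/
theorem eq_or_eq_mul_swap {p h : Brauer n} (hp : IsStarProjection p) {u v : Fin n} (huv : u ≠ v)
    (hd : dom p = {u, v}) (h1 : p * h = h) (h2 : h * p = h) (hr : rank h = rank p) :
    h = p ∨ h = p * perm (Equiv.swap u v) := by
  set τ := Equiv.swap u v
  have hdh : dom h = dom p := Set.eq_of_subset_of_ncard_le (h1 ▸ dom_mul_subset p h)
    (le_of_eq hr.symm) (Set.toFinite _)
  have hds : dom (star h) ⊆ dom p := by
    have h3 := congrArg star h2
    rw [star_mul, hp.isSelfAdjoint.star_eq] at h3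
    exact h3 ▸ dom_mul_subset p (star h)
  obtain ⟨x, hx⟩ : u ∈ dom h := hdh ▸ hd ▸ Set.mem_insert _ _
  obtain ⟨y, hy⟩ : v ∈ dom h := hdh ▸ hd ▸ Set.mem_insert_of_mem _ rfl
  have hx' : x ∈ ({u, v} : Set (Fin n)) := hd ▸ hds ⟨u, tr_star.2 hx⟩
  have hy' : y ∈ ({u, v} : Set (Fin n)) := hd ▸ hds ⟨v, tr_star.2 hy⟩
  have hcomm : p * perm τ = perm τ * p := mul_perm_comm hp fun i hi => by
    rw [hd] at hi
    simp only [Set.mem_insert_iff, Set.mem_singleton_iff, not_or] at hi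
    exact Equiv.swap_apply_of_ne_of_ne hi.1 hi.2
  rcases hx' with rfl | rfl
  · left
    rcases hy' with rfl | rfl
    · exact absurd (hx.unique_left hy) huv
    · refine eq_proj_of_tr hp h1 h2 fun i hi => ?_
      rw [hd] at hi
      rcases hi with rfl | rfl
      · exact hx
      · exact hy
  · right
    rcases hy' with rfl | rfl
    swap
    · exact absurd (hx.unique_left hy) huv
    have h3 : h * perm τ = p := by
      refine eq_proj_of_tr hp (by rw [← mul_assoc, h1])
        (by rw [mul_assoc, ← hcomm, ← mul_assoc, h2]) fun i hi => ?_
      rw [hd] at hi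
      rcases hi with rfl | rfl
      · exact tr_mul hx (by simpa [τ] using tr_perm τ i)
      · exact tr_mul hy (by simpa [τ] using tr_perm τ i)
    rw [← h3, mul_assoc, ← perm_mul, Equiv.swap_mul_self, perm_one, mul_one]

theorem ncard_rankLabel_le {p : Brauer n} (hp : p ∈ projections n 2) :
    {y | ∃ α, rankLabel p α = some y}.ncard ≤ 2 * (projections n 2).ncard := by
  obtain ⟨u, v, huv, hd⟩ := Set.ncard_eq_two.1 hp.2
  choose π hπ using fun q : projections n 2 => exists_conj hp q.2
  let g : Fin 2 × projections n 2 → Brauer n × Option (Brauer n) :=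
    fun a => (![p, p * perm (Equiv.swap u v)] a.1 * perm (π a.2), none)
  have hsub : {y | ∃ α, rankLabel p α = some y} ⊆ Set.range g := by
    rintro y ⟨α, hα⟩
    rw [rankLabel] at hα
    split_ifs at hα with hr
    rw [Option.some_inj] at hα
    let q : projections n 2 :=
      ⟨_, isStarProjection_star_mul (p * α), by rw [rank_star_mul, hr, hp.2]⟩
    set h := p * α * star (perm (π q)) * p with hh
    have h1 : p * h = h := by
      simp only [hh, ← mul_assoc, hp.1.isIdempotentElem.eq]
    have h2 : h * p = h := by
      rw [hh, mul_assoc, hp.1.isIdempotentElem.eq]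
    have h3 : h * perm (π q) = p * α := by
      have e1 : h * perm (π q) = p * α * q := by
        rw [hh, ← hπ q]
        simp only [mul_assoc]
      rw [e1, mul_star_mul']
    have h4 : rank h = rank p := by
      rw [← rank_mul_perm (π q) h, h3, hr]
    rcases eq_or_eq_mul_swap hp.1 huv hd h1 h2 h4 with h5 | h5
    · exact ⟨(0, q), by rw [← hα, ← h3, h5]; rfl⟩
    · exact ⟨(1, q), by rw [← hα, ← h3, h5]; rfl⟩
  refine (Set.ncard_le_ncard hsub (Set.toFinite _)).trans ?_
  rw [← Set.image_univ]
  refine (Set.ncard_image_le (Set.toFinite _)).trans ?_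
  rw [Set.ncard_univ, Nat.card_prod, Nat.card_fin, Nat.card_coe_set_eq]

/-! ### Faithfulness -/

theorem exists_perm_two {a b c d : Fin n} (hab : a ≠ b) (hcd : c ≠ d) :
    ∃ π : Equiv.Perm (Fin n), π a = c ∧ π b = d := by
  have := Equiv.Perm.isMultiplyPretransitive (Fin n) 2
  have hinj : ∀ {x y : Fin n}, x ≠ y → Function.Injective ![x, y] := by
    intro x y hxy i j h
    fin_cases i <;> fin_cases j
    · rfl
    · exact absurd h hxy
    · exact absurd h.symm hxy
    · rfl
  obtain ⟨π, hπ⟩ := MulAction.exists_smul_eq (Equiv.Perm (Fin n))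
    (⟨_, hinj hab⟩ : Fin 2 ↪ Fin n) ⟨_, hinj hcd⟩
  exact ⟨π, DFunLike.congr_fun hπ 0, DFunLike.congr_fun hπ 1⟩

theorem tr_mul_star_perm {p : Brauer n} (hp : IsStarProjection p) {π : Equiv.Perm (Fin n)}
    {i j : Fin n} (hi : i ∈ dom p) (h : π i = j) : Tr (p * star (perm π)) i j :=
  tr_mul (tr_of_mem_dom hp hi) (tr_star.2 (h ▸ tr_perm π i))

variable {F : Frame n} {κ α β : Brauer n}

/-- If `F.label κ` does not distinguish `α` and `β`, and if `u` lies in an upper hook of `β`,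
then an upper hook `uv` of `α` is one of `β`. -/
theorem up_of_hooked (hκ : κ ∈ projections n (n % 2)) (hκ' : F.s 0 * κ = κ)
    (h : ∀ s, F.label κ (s * α) = F.label κ (s * β)) {u v w : Fin n} (huv : u ≠ v)
    (hα : Up α u v) (hw : w ≠ u) (hβ : Up β u w) : Up β u v := by
  by_contra hne
  have hwv : w ≠ v := fun h => hne (h ▸ hβ)
  have hinj : Function.Injective ![u, w, v] := by
    intro a b h
    fin_cases a <;> fin_cases b
    · rfl
    · exact absurd h.symm hw
    · exact absurd h huv
    · exact absurd h hw
    · rfl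
    · exact absurd h hwv
    · exact absurd h.symm huv
    · exact absurd h.symm hwv
    · rfl
  have := Equiv.Perm.isMultiplyPretransitive (Fin n) 3
  obtain ⟨π, hπ⟩ := MulAction.exists_smul_eq (Equiv.Perm (Fin n)) F.v
    (⟨_, hinj⟩ : Fin 3 ↪ Fin n)
  have ht : ∀ i, Tr (F.p * star (perm π)) (F.v i) (![u, w, v] i) := fun i =>
    tr_mul_star_perm F.hp.1 (F.mem_dom i) (DFunLike.congr_fun hπ i)
  have h1 : Up (F.p * (star (perm π) * α)) (F.v 0) (F.v 2) := by
    rw [← mul_assoc]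
    exact up_mul (ht 0) hα (ht 2)
  have h2 : Up (F.p * (star (perm π) * β)) (F.v 0) (F.v 1) := by
    rw [← mul_assoc]
    exact up_mul (ht 0) hβ (ht 1)
  have h3 := Frame.label_eq_none.2 (Frame.not_isGood hκ' (F.v_ne' 0).symm (F.v_ne 1).symm h1)
  rw [h, Frame.label_eq_none, ← F.s_mul_eq h2] at h3
  exact h3 (Frame.isGood_of_s_mul hκ.2 hκ')

/-- For odd `n`, an upper hook `uv` of `α` is not destroyed by a transversal of `β` at `u` unless
`F.label κ` distinguishes `α` and `β`. -/
theorem not_tr_of_odd (hn : n % 2 = 1) (hκ : κ ∈ projections n (n % 2)) (hκ' : F.s 0 * κ = κ)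
    (h : ∀ s, F.label κ (s * α) = F.label κ (s * β)) {u v x : Fin n} (huv : u ≠ v)
    (hα : Up α u v) : ¬ Tr β u x := by
  intro hβ
  obtain ⟨π, hπ2, hπ0⟩ := exists_perm_two (F.v_ne 2) huv
  have ht2 : Tr (F.p * star (perm π)) (F.v 2) u := tr_mul_star_perm F.hp.1 (F.mem_dom 2) hπ2
  have ht0 : Tr (F.p * star (perm π)) (F.v 0) v := tr_mul_star_perm F.hp.1 (F.mem_dom 0) hπ0
  have h1 : Up (F.p * (star (perm π) * α)) (F.v 0) (F.v 2) := by
    rw [← mul_assoc]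
    exact up_mul ht0 hα.symm ht2
  have h2 : Tr (F.p * (star (perm π) * β)) (F.v 2) x := by
    rw [← mul_assoc]
    exact tr_mul ht2 hβ
  have h3 := Frame.label_eq_none.2 (Frame.not_isGood hκ' (F.v_ne' 0).symm (F.v_ne 1).symm h1)
  rw [h, Frame.label_eq_none] at h3
  apply h3
  set γ := F.p * (star (perm π) * β) with hγ
  have hpγ : F.p * γ = γ := by rw [hγ, ← mul_assoc, F.hp.1.isIdempotentElem.eq]
  by_cases hr : rank γ = rank F.p
  · exact Frame.isGood_of_rank_eq hκ' hpγ hr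
  · have hr' : rank γ = n % 2 := by
      have h4 : rank γ ≤ rank F.p := rank_mul_le_left _ _
      have h5 := F.hp.2
      have h6 := rank_mod_two γ
      omega
    obtain ⟨i, hi⟩ := F.exists_s_mul hr'
    rw [hpγ] at hi
    have h5 : Up γ (F.v i) (F.v (i + 1)) := hi ▸ (F.up_s i).mul
    have h6 : i = 0 := by
      fin_cases i
      · rfl
      · exact absurd (h2.not_up h5.symm) (F.v_ne 1)
      · exact absurd (h2.not_up h5) (F.v_ne 2).symm
    rw [hi, h6]
    exact Frame.isGood_of_s_mul hκ.2 hκ'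

/-- For even `n`, the rank of a projection of rank two drops to zero at an upper hook of `α`, but
not at a transversal of `β`. -/
theorem not_tr_of_rankLabel {p : Brauer n} (hn : n % 2 = 0) (hp : p ∈ projections n 2)
    (h : ∀ s, rankLabel p (s * α) = rankLabel p (s * β)) {u v x : Fin n} (huv : u ≠ v)
    (hα : Up α u v) : ¬ Tr β u x := by
  intro hβ
  obtain ⟨a, b, hab, hd⟩ := Set.ncard_eq_two.1 hp.2
  have ha : a ∈ dom p := hd ▸ Set.mem_insert _ _
  have hb : b ∈ dom p := hd ▸ Set.mem_insert_of_mem _ rfl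
  obtain ⟨π, hπa, hπb⟩ := exists_perm_two hab huv
  have hta := tr_mul_star_perm hp.1 ha hπa
  have htb := tr_mul_star_perm hp.1 hb hπb
  have h1 : rank (p * star (perm π) * α) < rank (p * star (perm π)) :=
    rank_mul_lt ⟨_, hta⟩ hab.symm (up_mul hta hα htb)
  have h2 : rankLabel p (star (perm π) * α) = none := by
    rw [rankLabel_eq_none, ← mul_assoc]
    exact (h1.trans_le (rank_mul_le_left _ _)).ne
  rw [h, rankLabel_eq_none, ← mul_assoc] at h2
  apply h2
  have h3 : 0 < rank (p * star (perm π) * β) :=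
    (Set.ncard_pos (Set.toFinite _)).2 ⟨a, x, tr_mul hta hβ⟩
  have h4 := rank_mod_two (p * star (perm π) * β)
  have h5 := rank_mul_le_left (p * star (perm π)) β
  have h6 := rank_mul_le_left p (star (perm π))
  have h7 := hp.2
  omega

theorem tr_of_rankLabel {p : Brauer n} (hn : n % 2 = 0) (hp : p ∈ projections n 2)
    (h : ∀ s, rankLabel p (s * α) = rankLabel p (s * β)) {u x y : Fin n} (hα : Tr α u x)
    (hβ : Tr β u y) : x = y := by
  obtain ⟨a, b, hab, hd⟩ := Set.ncard_eq_two.1 hp.2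
  have ha : a ∈ dom p := hd ▸ Set.mem_insert _ _
  set π := Equiv.swap a u
  have hta := tr_mul_star_perm hp.1 ha (Equiv.swap_apply_left a u)
  have hr : ∀ {γ : Brauer n} {x}, Tr γ u x → rank (p * (star (perm π) * γ)) = rank p := by
    intro γ x hγ
    rw [← mul_assoc]
    have h3 : 0 < rank (p * star (perm π) * γ) :=
      (Set.ncard_pos (Set.toFinite _)).2 ⟨a, x, tr_mul hta hγ⟩
    have h4 := rank_mod_two (p * star (perm π) * γ)
    have h5 := rank_mul_le_left (p * star (perm π)) γ
    have h6 := rank_mul_le_left p (star (perm π))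
    have h7 := hp.2
    omega
  have h1 := h (star (perm π))
  rw [rankLabel, rankLabel, if_pos (hr hα), if_pos (hr hβ), Option.some_inj, Prod.mk.injEq,
    ← mul_assoc, ← mul_assoc] at h1
  exact (tr_mul hta hα).unique (h1.1 ▸ tr_mul hta hβ)

theorem mul_eq_of_label (hκ : κ ∈ projections n (n % 2)) (hκ' : F.s 0 * κ = κ)
    (h : ∀ s, F.label κ (s * α) = F.label κ (s * β)) (s : Brauer n) : κ * s * α = κ * s * β := by
  obtain ⟨y, hy⟩ := Frame.label_κ_mul hκ hκ' (s * α)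
  obtain ⟨z, hz⟩ := Frame.label_κ_mul hκ hκ' (s * β)
  rw [← mul_assoc] at hy hz
  rw [h, hz, Option.some_inj, Prod.mk.injEq] at hy
  exact hy.1.symm

theorem tr_of_odd (hn : n % 2 = 1) (hκ : κ ∈ projections n (n % 2)) (hκ' : F.s 0 * κ = κ)
    (h : ∀ s, F.label κ (s * α) = F.label κ (s * β)) {u x y : Fin n} (hα : Tr α u x)
    (hβ : Tr β u y) : x = y := by
  obtain ⟨a, ha⟩ : (dom κ).Nonempty :=
    Set.nonempty_of_ncard_ne_zero (by have : (dom κ).ncard = n % 2 := hκ.2; omega)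
  have hta := tr_mul_star_perm hκ.1 ha (Equiv.swap_apply_left a u)
  exact (tr_mul hta hα).unique (mul_eq_of_label hκ hκ' h _ ▸ tr_mul hta hβ)

/-- An element is determined by its upper hooks, its transversals, and its lower hooks, and the last
are determined by the first two and by the action on a minimal projection. -/
theorem eq_of_up_tr (hup : ∀ u v, Up α u v → Up β u v)
    (htr : ∀ u x, Tr α u x ↔ Tr β u x) (hκ : κ * α = κ * β) : α = β := by
  refine ext_partner ?_
  rintro (i | i)
  · rcases up_or_tr α i with ⟨j, hj, h⟩ | ⟨k, h⟩
    · exact ⟨.inl j, by simpa using hj, h, hup _ _ h⟩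
    · exact ⟨.inr k, by simp, h, (htr _ _).1 h⟩
  · rcases lo_or_tr α i with ⟨j, hj, h⟩ | ⟨k, h⟩
    · rcases lo_or_tr β i with ⟨j', hj', h'⟩ | ⟨k, h'⟩
      · obtain rfl := Lo.unique (hκ ▸ h.mul : Lo (κ * β) i j) h'.mul hj hj'
        exact ⟨.inr j, by simpa using hj, h, h'⟩
      · exact absurd (((htr _ _).2 h').not_lo h) hj
    · exact ⟨.inl k, by simp, h.symm, ((htr _ _).1 h).symm⟩

theorem eq_of_label (hκ : κ ∈ projections n (n % 2)) (hκ' : F.s 0 * κ = κ)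
    (h : ∀ s, F.label κ (s * α) = F.label κ (s * β))
    (h₁ : ∀ u v x, u ≠ v → Up α u v → ¬ Tr β u x) (h₂ : ∀ u v x, u ≠ v → Up β u v → ¬ Tr α u x)
    (h₃ : ∀ u x y, Tr α u x → Tr β u y → x = y) : α = β := by
  have hup : ∀ {α β : Brauer n}, (∀ s, F.label κ (s * α) = F.label κ (s * β)) →
      (∀ u v x, u ≠ v → Up α u v → ¬ Tr β u x) → ∀ u v, Up α u v → Up β u v := by
    intro α β h h₁ u v huv
    rcases eq_or_ne u v with rfl | hne
    · exact .refl _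
    obtain ⟨w, hw, hβ⟩ := (up_or_tr β u).resolve_right fun ⟨x, hx⟩ => h₁ u v x hne huv hx
    exact up_of_hooked hκ hκ' h hne huv hw hβ
  have hup₁ := hup h h₁
  have hup₂ := hup (fun s => (h s).symm) h₂
  refine eq_of_up_tr (κ := κ) hup₁ (fun u x => ⟨fun hx => ?_, fun hx => ?_⟩) ?_
  · rcases up_or_tr β u with ⟨j, hj, h'⟩ | ⟨y, hy⟩
    · exact absurd (hx.not_up (hup₂ _ _ h')) hj
    · rwa [h₃ u x y hx hy]
  · rcases up_or_tr α u with ⟨j, hj, h'⟩ | ⟨y, hy⟩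
    · exact absurd (hx.not_up (hup₁ _ _ h')) hj
    · rwa [← h₃ u y x hy hx]
  · simpa using mul_eq_of_label hκ hκ' h 1

/-! ### The degrees of the Brauer monoid -/

/-- The labelling of the Brauer monoid by a frame. -/
noncomputable def Frame.labelling (F : Frame n) {κ : Brauer n} (hκ : κ ∈ projections n (n % 2))
    (hκ' : F.s 0 * κ = κ) : Labelling (Brauer n) Unit (Brauer n × Option (Brauer n)) where
  label _ := F.label κ
  mul_right c h := Frame.label_mul_right hκ hκ' c h
  none_mul c h := Frame.label_none_mul c h

/-- The labelling of the Brauer monoid by a frame and a projection `p`. -/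
noncomputable def Frame.labelling₂ (F : Frame n) {κ : Brauer n} (hκ : κ ∈ projections n (n % 2))
    (hκ' : F.s 0 * κ = κ) (p : Brauer n) :
    Labelling (Brauer n) Bool (Brauer n × Option (Brauer n)) where
  label i := if i then rankLabel p else F.label κ
  mul_right {i} _ _ c h := by
    cases i
    · exact Frame.label_mul_right hκ hκ' c h
    · exact rankLabel_mul_right c h
  none_mul {i} _ c h := by
    cases i
    · exact Frame.label_none_mul c h
    · exact rankLabel_none_mul c h

variable {F : Frame n} {κ : Brauer n} (hκ : κ ∈ projections n (n % 2)) (hκ' : F.s 0 * κ = κ)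

theorem Frame.labelling_isFaithful (hn : n % 2 = 1) : (F.labelling hκ hκ').IsFaithful := by
  intro α β h
  have h' : ∀ s, F.label κ (s * α) = F.label κ (s * β) := h ()
  exact eq_of_label hκ hκ' h'
    (fun u v x huv hα => not_tr_of_odd hn hκ hκ' h' huv hα)
    (fun u v x huv hβ => not_tr_of_odd hn hκ hκ' (fun s => (h' s).symm) huv hβ)
    (fun u x y => tr_of_odd hn hκ hκ' h')

theorem Frame.labelling₂_isFaithful (hn : n % 2 = 0) {p : Brauer n} (hp : p ∈ projections n 2) :
    (F.labelling₂ hκ hκ' p).IsFaithful := by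
  intro α β h
  have h' : ∀ s, F.label κ (s * α) = F.label κ (s * β) := h false
  have h₂ : ∀ s, rankLabel p (s * α) = rankLabel p (s * β) := h true
  exact eq_of_label hκ hκ' h'
    (fun u v x huv hα => not_tr_of_rankLabel hn hp h₂ huv hα)
    (fun u v x huv hβ => not_tr_of_rankLabel hn hp (fun s => (h₂ s).symm) huv hβ)
    (fun u x y => tr_of_rankLabel hn hp h₂)

theorem Frame.ncard_points_labelling_le : (F.labelling hκ hκ').points.ncard ≤
    (projections n (n % 2)).ncard + 3 * (projections n (4 - n % 2)).ncard := by
  refine le_trans ?_ (Frame.ncard_label_le hκ hκ')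
  rw [← Set.ncard_image_of_injective {y | ∃ α, F.label κ α = some y} (Prod.mk_right_injective ())]
  refine Set.ncard_le_ncard ?_ (Set.toFinite _)
  rintro ⟨_, y⟩ ⟨α, hα⟩
  exact ⟨y, ⟨α, hα⟩, rfl⟩

theorem Frame.ncard_points_labelling₂_le {p : Brauer n} (hp : p ∈ projections n 2) :
    (F.labelling₂ hκ hκ' p).points.ncard ≤ (projections n (n % 2)).ncard +
      3 * (projections n (4 - n % 2)).ncard + 2 * (projections n 2).ncard := by
  refine le_trans ?_ (Nat.add_le_add (Frame.ncard_label_le hκ hκ') (ncard_rankLabel_le hp))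
  rw [← Set.ncard_image_of_injective {y | ∃ α, F.label κ α = some y}
      (Prod.mk_right_injective false),
    ← Set.ncard_image_of_injective {y | ∃ α, rankLabel p α = some y} (Prod.mk_right_injective true)]
  refine (Set.ncard_le_ncard ?_ (Set.toFinite _)).trans (Set.ncard_union_le _ _)
  rintro ⟨i, y⟩ ⟨α, hα⟩
  cases i
  · exact .inl ⟨y, ⟨α, hα⟩, rfl⟩
  · exact .inr ⟨y, ⟨α, hα⟩, rfl⟩

theorem le_of_isFaithful_odd (hn : 3 ≤ n) (hn2 : n % 2 = 1) (m : ℕ)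
    (μ : RightAction (Fin m) (Brauer n)) (hμ : μ.IsFaithful) :
    (projections n 1).ncard + 3 * (projections n 3).ncard + 1 ≤ m := by
  have h1 := ncard_projections_lt_ncard_below hn hμ
  have h2 := ncard_below_critical_add_le hn hμ
  rw [hn2] at h1 h2
  have h3 := Set.ncard_le_ncard (below_mono μ (show 1 + 1 ≤ 4 - 1 by omega)) (Set.toFinite _)
  rw [Nat.card_fin] at h2
  simp only [Nat.reduceSub] at h2 h3
  omega

theorem le_of_isFaithful_even (hn : 3 ≤ n) (hn2 : n % 2 = 0) (m : ℕ)
    (μ : RightAction (Fin m) (Brauer n)) (hμ : μ.IsFaithful) :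
    (projections n 0).ncard + 2 * (projections n 2).ncard + 3 * (projections n 4).ncard + 1 ≤
      m := by
  have h1 := ncard_projections_lt_ncard_below hn hμ
  have h2 := ncard_below_critical_add_le hn hμ
  have h3 := ncard_below_two_add_le hn hn2 hμ
  rw [hn2] at h1 h2
  have h4 := Set.ncard_le_ncard (below_mono μ (show 0 + 1 ≤ 2 by omega)) (Set.toFinite _)
  have h5 := Set.ncard_le_ncard (below_mono μ (show 3 ≤ 4 - 0 by omega)) (Set.toFinite _)
  rw [Nat.card_fin] at h2
  simp only [Nat.sub_zero] at h2 h5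
  omega

theorem degrees_odd (hn : 3 ≤ n) (hn2 : n % 2 = 1) :
    partialTransformationDegree (Brauer n) =
      (projections n 1).ncard + 3 * (projections n 3).ncard ∧
    transformationDegree (Brauer n) =
      (projections n 1).ncard + 3 * (projections n 3).ncard + 1 ∧
    rightCongruenceDegree (Brauer n) =
      (projections n 1).ncard + 3 * (projections n 3).ncard + 1 := by
  obtain ⟨F⟩ := Frame.nonempty hn
  obtain ⟨κ, hκ, hκ'⟩ := F.exists_κ hn
  have hf := Frame.labelling_isFaithful hκ hκ' hn2
  have hc := Frame.ncard_points_labelling_le hκ hκ'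
  have hlow := le_of_isFaithful_odd hn hn2
  have hpos := (Set.ncard_pos (Set.toFinite _)).2 (projections_minimal_nonempty hn)
  simp only [hn2, Nat.reduceSub] at hc hpos
  exact ⟨Labelling.partialTransformationDegree_eq hf hlow (Set.toFinite _) hc (by omega),
    Labelling.transformationDegree_eq hf hlow (Set.toFinite _) hc,
    Labelling.rightCongruenceDegree_eq hf hlow (Set.toFinite _) hc⟩

theorem degrees_even (hn : 3 ≤ n) (hn2 : n % 2 = 0) :
    partialTransformationDegree (Brauer n) =
      (projections n 0).ncard + 2 * (projections n 2).ncard + 3 * (projections n 4).ncard ∧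
    transformationDegree (Brauer n) =
      (projections n 0).ncard + 2 * (projections n 2).ncard + 3 * (projections n 4).ncard + 1 := by
  obtain ⟨F⟩ := Frame.nonempty hn
  obtain ⟨κ, hκ, hκ'⟩ := F.exists_κ hn
  obtain ⟨p, hp⟩ := projections_nonempty (n := n) (r := 2) (by omega) (by omega)
  have hf := Frame.labelling₂_isFaithful hκ hκ' hn2 hp
  have hc := Frame.ncard_points_labelling₂_le hκ hκ' hp
  have hlow := le_of_isFaithful_even hn hn2
  have hpos := (Set.ncard_pos (Set.toFinite _)).2 (projections_minimal_nonempty hn)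
  simp only [hn2, Nat.sub_zero] at hc hpos
  rw [add_right_comm] at hc
  exact ⟨Labelling.partialTransformationDegree_eq hf hlow (Set.toFinite _) hc (by omega),
    Labelling.transformationDegree_eq hf hlow (Set.toFinite _) hc⟩

/-! ### Closed formulas -/

theorem factorial_two_mul (k : ℕ) : (2 * k)! = 2 ^ k * k ! * (2 * k - 1)‼ := by
  induction k with
  | zero => rfl
  | succ k ih =>
    rcases Nat.eq_zero_or_pos k with rfl | hk
    · rfl
    have h : 2 * (k + 1) - 1 = (2 * k - 1) + 2 := by omega
    rw [h, Nat.doubleFactorial_add_two, show 2 * (k + 1) = 2 * k + 1 + 1 by ring,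
      Nat.factorial_succ, Nat.factorial_succ, ih, Nat.factorial_succ k,
      show 2 * k - 1 + 2 = 2 * k + 1 by omega]
    ring

theorem formula_odd (hn : 3 ≤ n) (hn2 : n % 2 = 1) :
    (((projections n 1).ncard + 3 * (projections n 3).ncard : ℕ) : ℚ) =
      ((n : ℚ) + 1) / 2 * (n‼ : ℚ) := by
  obtain ⟨k, rfl⟩ : ∃ k, n = 3 + 2 * k := ⟨(n - 3) / 2, by omega⟩
  have h1 := ncard_projections_mul 1 (k + 1)
  have h3 := ncard_projections_mul 3 k
  rw [show 1 + 2 * (k + 1) = 3 + 2 * k by ring] at h1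
  have hf : (3 + 2 * k)! = 2 ^ (k + 1) * (k + 1)! * (3 + 2 * k)‼ := by
    have := factorial_two_mul (k + 2)
    have e : (2 * (k + 2))! = (2 * (k + 2)) * (3 + 2 * k)! := by
      rw [show 2 * (k + 2) = (3 + 2 * k) + 1 by ring, Nat.factorial_succ]
    rw [e, show 2 * (k + 2) - 1 = 3 + 2 * k by omega, Nat.factorial_succ (k + 1)] at this
    have h0 : 0 < 2 * (k + 2) := by omega
    refine Nat.eq_of_mul_eq_mul_left h0 (this.trans ?_)
    ring
  rw [hf] at h1 h3
  have hk : (0 : ℚ) < k ! := by exact_mod_cast Nat.factorial_pos k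
  have h2 : (0 : ℚ) < 2 ^ k := by positivity
  have hk1 : ((k + 1)! : ℚ) = (k + 1) * k ! := by
    rw [Nat.factorial_succ]
    push_cast
    ring
  have q1 : ((projections (3 + 2 * k) 1).ncard : ℚ) = (3 + 2 * k)‼ := by
    have := congrArg (Nat.cast : ℕ → ℚ) h1
    push_cast [Nat.factorial_one, hk1, pow_succ] at this
    have hne : (2 ^ k * 2 * ((k + 1) * k !) : ℚ) ≠ 0 := by positivity
    refine mul_right_cancel₀ hne ?_
    linear_combination this
  have q3 : ((projections (3 + 2 * k) 3).ncard : ℚ) * 3 = (k + 1) * (3 + 2 * k)‼ := by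
    have := congrArg (Nat.cast : ℕ → ℚ) h3
    push_cast [show (3)! = 6 from rfl, hk1, pow_succ] at this
    have hne : (2 ^ k * 2 * k ! : ℚ) ≠ 0 := by positivity
    refine mul_right_cancel₀ hne ?_
    linear_combination this
  push_cast
  linear_combination q1 + q3

theorem formula_even (hn : 3 ≤ n) (hn2 : n % 2 = 0) :
    (((projections n 0).ncard + 2 * (projections n 2).ncard +
        3 * (projections n 4).ncard : ℕ) : ℚ) =
      ((n : ℚ) + 4) * ((n : ℚ) + 2) / 8 * ((n - 1)‼ : ℚ) := by
  obtain ⟨k, rfl⟩ : ∃ k, n = 4 + 2 * k := ⟨(n - 4) / 2, by omega⟩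
  have h0 := ncard_projections_mul 0 (k + 2)
  have h2 := ncard_projections_mul 2 (k + 1)
  have h4 := ncard_projections_mul 4 k
  have hf := factorial_two_mul (k + 2)
  rw [show 2 * (k + 2) = 4 + 2 * k by ring] at hf
  rw [show 0 + 2 * (k + 2) = 4 + 2 * k by ring, hf] at h0
  rw [show 2 + 2 * (k + 1) = 4 + 2 * k by ring, hf] at h2
  rw [hf] at h4
  set d := (4 + 2 * k - 1)‼
  have hk : (0 : ℚ) < k ! := by exact_mod_cast Nat.factorial_pos k
  have hk1 : ((k + 1)! : ℚ) = (k + 1) * k ! := by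
    rw [Nat.factorial_succ]
    push_cast
    ring
  have hk2 : ((k + 2)! : ℚ) = (k + 2) * ((k + 1) * k !) := by
    rw [Nat.factorial_succ (k + 1)]
    push_cast
    rw [hk1]
    ring
  have q0 : ((projections (4 + 2 * k) 0).ncard : ℚ) = d := by
    have := congrArg (Nat.cast : ℕ → ℚ) h0
    push_cast [Nat.factorial_zero, hk2, pow_succ] at this
    have hne : (2 ^ k * ((k + 2) * ((k + 1) * k !)) * 4 : ℚ) ≠ 0 := by positivity
    refine mul_right_cancel₀ hne ?_
    linear_combination this
  have q2 : ((projections (4 + 2 * k) 2).ncard : ℚ) = (k + 2) * d := by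
    have := congrArg (Nat.cast : ℕ → ℚ) h2
    push_cast [Nat.factorial_two, hk1, hk2, pow_succ] at this
    have hne : (2 ^ k * ((k + 1) * k !) * 4 : ℚ) ≠ 0 := by positivity
    refine mul_right_cancel₀ hne ?_
    linear_combination this
  have q4 : ((projections (4 + 2 * k) 4).ncard : ℚ) * 6 = (k + 2) * (k + 1) * d := by
    have := congrArg (Nat.cast : ℕ → ℚ) h4
    push_cast [show (4)! = 24 from rfl, hk2, pow_succ] at this
    have hne : (2 ^ k * k ! * 4 : ℚ) ≠ 0 := by positivity
    refine mul_right_cancel₀ hne ?_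
    linear_combination this
  push_cast
  linear_combination q0 + 2 * q2 + q4 / 2

end Brauer

theorem theorem6p1 (n : ℕ) (hn : 3 ≤ n) :
    (Odd n → partialTransformationDegree (brauerMonoid n) =
      (brauerProjections n 1).ncard + 3 * (brauerProjections n 3).ncard) ∧
    (Even n → partialTransformationDegree (brauerMonoid n) =
      (brauerProjections n 0).ncard + 2 * (brauerProjections n 2).ncard
        + 3 * (brauerProjections n 4).ncard) ∧
    transformationDegree (brauerMonoid n) = 1 + partialTransformationDegree (brauerMonoid n) ∧
    (Odd n → transformationDegree (brauerMonoid n) = rightCongruenceDegree (brauerMonoid n)) ∧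
    (Odd n → (partialTransformationDegree (brauerMonoid n) : ℚ) =
      ((n : ℚ) + 1) / 2 * (n‼ : ℚ)) ∧
    (Even n → (partialTransformationDegree (brauerMonoid n) : ℚ) =
      ((n : ℚ) + 4) * ((n : ℚ) + 2) / 8 * ((n - 1)‼ : ℚ)) := by
  simp only [Brauer.ncard_brauerProjections]
  rcases Nat.mod_two_eq_zero_or_one n with hn2 | hn2
  · obtain ⟨h1, h2⟩ := Brauer.degrees_even hn hn2
    have hodd : ¬ Odd n := by rwa [Nat.not_odd_iff]
    refine ⟨fun h => absurd h hodd, fun _ => h1, by rw [h1, h2, add_comm],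
      fun h => absurd h hodd, fun h => absurd h hodd, fun _ => ?_⟩
    rw [h1, Brauer.formula_even hn hn2]
  · obtain ⟨h1, h2, h3⟩ := Brauer.degrees_odd hn hn2
    have heven : ¬ Even n := by rwa [Nat.not_even_iff]
    refine ⟨fun _ => h1, fun h => absurd h heven, by rw [h1, h2, add_comm],
      fun _ => h2.trans h3.symm, fun _ => ?_, fun h => absurd h heven⟩
    rw [h1, Brauer.formula_odd hn hn2]
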